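/- **Setting.** Let $1\le r\le d$ and $n\ge 1$ be integers, let $\Theta\subset\mathbb R^d$ be open, and let $\{f(\cdot|\theta):\theta\in\Theta\}$ be a family of probability densities with respect to a measure $\nu$ on a measurable space $\mathcal X$ (for instance Lebesgue or counting measure on $\mathbb R^t$). Let $\theta_0\in\Theta$ and let $X_1,\dots,X_n$ be i.i.d. $\mathcal X$-valued random elements with density $f(\cdot|\theta_0)$; $\mathbb E$ denotes expectation under $\theta_0$. Assume that for almost every $x$ (with respect to the law of $X_1$) $f(x|\cdot)$ is positive near $\theta_0$ and $\log f(x|\cdot)$ is differentiable at $\theta_0$, and put $$Y_{j,i}=\frac{\partial}{\partial\theta_j}\log f(X_i|\theta)\Big|_{\theta=\theta_0},\qquad 1\le j\le d,\ 1\le i\le n .$$ Assume that the $Y_{j,i}$ have finite absolute moments up to order five, that $\mathbb E\,Y_{j,i}=0$, and that the Fisher information matrix $I(\theta_0)=\big(\mathbb E[Y_{j,1}Y_{k,1}]\big)_{1\le j,k\le d}$ is positive definite. Let $W=(\xi,\eta)\in\mathbb R^r\times\mathbb R^{d-r}$ be the normalised score vector, $W_j=n^{-1/2}\sum_{i=1}^nY_{j,i}$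 for $1\le j\le d$, with $\xi=(W_1,\dots,W_r)$ and $\eta=(W_{r+1},\dots,W_d)$. Let $Z=(Z_1,\dots,Z_d)$ be standard normal in $\mathbb R^d$, and let $I(\theta_0)^{1/2}$ be the positive definite square root, with inverse $I(\theta_0)^{-1/2}$. Let $D$ be a real $r\times(d-r)$ matrix, $U$ a real symmetric positive semidefinite $r\times r$ matrix, and $$g(x,y)=(x-Dy)^{\intercal}U(x-Dy),\qquad x\in\mathbb R^r,\ y\in\mathbb R^{d-r}.$$ For a real matrix $A$ write $|||A|||_\infty=\max_a\sum_b|A_{a,b}|$ (zero if $A$ has no entries), and let $$c=\max\{|||U|||_\infty,\ |||D^{\intercal}UD|||_\infty,\ |||D^{\intercal}U|||_\infty\}.$$ **Proposition 3.** For every bounded $h\in C^2(\mathbb R)$ with bounded $h'$ and $h''$, $$\Big|\mathbb E\,h(g(W))-\mathbb E\,h\big(g(I(\theta_0)^{1/2}Z)\big)\Big|\le\frac{2(\|h'\|+\|h''\|)}{\sqrt n}\,R(W,U,D),$$ where $\|\cdot\|$ is the supremum norm and, with $$\alpha_s=\mathbb E\big|(I(\theta_0)^{-1/2}Z)_s\big|,\qquad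 \beta_{s,t}=\mathbb E\big|(I(\theta_0)^{-1/2}Z)_s\,Z_t^2\big|,$$ \begin{align*} R(W,U,D)=\frac cn\min_{1\le s\le d}\ \alpha_s\sum_{i=1}^n\sum_{j,k,l=1}^d\bigg\{&\mathbb E|Y_{j,i}Y_{k,i}Y_{l,i}|\\ &+8cd\sum_{t=1}^d\Big(4\,\mathbb E|Y_{j,i}Y_{k,i}Y_{l,i}|\,\mathbb E(W_t^2)+\frac4n\,\mathbb E|Y_{j,i}Y_{k,i}Y_{l,i}Y_{t,i}^2|+\frac{\beta_{s,t}}{\alpha_s}\,\mathbb E|Y_{j,i}Y_{k,i}Y_{l,i}|\Big)\\ &+2\,|\mathbb E(Y_{j,i}Y_{k,i})|\bigg[\mathbb E|Y_{l,i}|+16cd\sum_{t=1}^d\Big(4\,\mathbb E|Y_{l,i}|\,\mathbb E(W_t^2)+\frac4n\,\mathbb E|Y_{l,i}Y_{t,i}^2|+\frac{\beta_{s,t}}{\alpha_s}\,\mathbb E|Y_{l,i}|\Big)\bigg]\bigg\}, \end{align*} the minimum being taken over $s$ of the whole product that follows it. -/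

import Mathlib

open MeasureTheory ProbabilityTheory Matrix
open scoped MatrixOrder

noncomputable section

namespace Wilks

/-- `f x θ` is a family of probability densities with respect to the dominating measure `ν`
(Lebesgue measure for densities, counting measure for mass functions), indexed by `θ ∈ Θ`. -/
structure IsDensityFamily {𝓧 ι : Type*} [MeasurableSpace 𝓧] (ν : Measure 𝓧)
    (Θ : Set (ι → ℝ)) (f : 𝓧 → (ι → ℝ) → ℝ) : Prop where
  nonneg : ∀ θ ∈ Θ, ∀ x, 0 ≤ f x θ
  measurable : ∀ θ ∈ Θ, Measurable fun x => f x θ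
  lintegral_eq_one : ∀ θ ∈ Θ, ∫⁻ x, ENNReal.ofReal (f x θ) ∂ν = 1

/-- The law of one observation under the parameter `θ`. -/
def obsLaw {𝓧 ι : Type*} [MeasurableSpace 𝓧] (ν : Measure 𝓧) (f : 𝓧 → (ι → ℝ) → ℝ)
    (θ : ι → ℝ) : Measure 𝓧 :=
  ν.withDensity fun x => ENNReal.ofReal (f x θ)

/-- The score of one observation: its `i`-th entry is `∂/∂θ_i log f(x|θ)`. -/
def score {𝓧 ι : Type*} [DecidableEq ι] (f : 𝓧 → (ι → ℝ) → ℝ) (θ : ι → ℝ) (x : 𝓧) : ι → ℝ :=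
  fun i => deriv (fun t => Real.log (f x (Function.update θ i t))) (θ i)

/-- The expected Fisher information matrix of one observation. -/
def fisherInfo {𝓧 ι : Type*} [MeasurableSpace 𝓧] [DecidableEq ι] (ν : Measure 𝓧)
    (f : 𝓧 → (ι → ℝ) → ℝ) (θ : ι → ℝ) : Matrix ι ι ℝ :=
  Matrix.of fun i j => ∫ x, score f θ x i * score f θ x j ∂(obsLaw ν f θ)

/-- `W = n^{-1/2} ∑_i Y_i`, where `Y i ω` is the `i`-th random vector. -/
def normSum {Ω ι : Type*} {n : ℕ} (Y : Fin n → Ω → ι → ℝ) (ω : Ω) : ι → ℝ :=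
  fun j => (1 / √(n : ℝ)) * ∑ i, Y i ω j

/-- The standard normal distribution on `ℝ^ι`. -/
def stdNormal (ι : Type*) [Fintype ι] : Measure (ι → ℝ) :=
  Measure.pi fun _ => gaussianReal 0 1

/-- The matrix norm `max_i ∑_j |A_ij|` (zero for a matrix without rows). -/
def rowSumNorm {κ₁ κ₂ : Type*} [Fintype κ₂] (A : Matrix κ₁ κ₂ ℝ) : ℝ :=
  ⨆ i, ∑ j, |A i j|

/-- The supremum norm of a bounded function on the real line. -/
def supNorm (φ : ℝ → ℝ) : ℝ := ⨆ x, |φ x|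

/-- Twice continuously differentiable functions, bounded together with their first two
derivatives. -/
structure IsCb2 (h : ℝ → ℝ) : Prop where
  contDiff : ContDiff ℝ 2 h
  bounded : ∃ C, ∀ x, |h x| ≤ C
  bounded_deriv : ∃ C, ∀ x, |deriv h x| ≤ C
  bounded_deriv2 : ∃ C, ∀ x, |deriv (deriv h) x| ≤ C

/-- `g(x, y) = (x - D y)ᵀ U (x - D y)`, for `w = (x, y)`. -/
def quadForm {r q : ℕ} (U : Matrix (Fin r) (Fin r) ℝ) (D : Matrix (Fin r) (Fin q) ℝ)
    (w : Fin r ⊕ Fin q → ℝ) : ℝ :=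
  let v : Fin r → ℝ := (fun i => w (Sum.inl i)) - D *ᵥ (fun i => w (Sum.inr i))
  v ⬝ᵥ (U *ᵥ v)

/-- `c(U, D)`, the largest of the `∞`-norms of `U`, `Dᵀ U D` and `Dᵀ U`. -/
def cConst {r q : ℕ} (U : Matrix (Fin r) (Fin r) ℝ) (D : Matrix (Fin r) (Fin q) ℝ) : ℝ :=
  max (rowSumNorm U) (max (rowSumNorm (Dᵀ * U * D)) (rowSumNorm (Dᵀ * U)))

/-- `E |(I^{-1/2} Z)_s|` for a standard normal vector `Z`. -/
def gaussAbs {ι : Type*} [Fintype ι] [DecidableEq ι] (I : Matrix ι ι ℝ) (s : ι) : ℝ :=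
  ∫ z, |((CFC.sqrt I)⁻¹ *ᵥ z) s| ∂(stdNormal ι)

/-- `E |(I^{-1/2} Z)_s Z_t²|` for a standard normal vector `Z`. -/
def gaussAbsSq {ι : Type*} [Fintype ι] [DecidableEq ι] (I : Matrix ι ι ℝ) (s t : ι) : ℝ :=
  ∫ z, |((CFC.sqrt I)⁻¹ *ᵥ z) s * z t ^ 2| ∂(stdNormal ι)

/-- The factor `R(W, U, D)` of the bound, for random vectors `Y i` (`i < n`) in `ℝ^(r+q)` and a
matrix `I`; here `W = n^{-1/2} ∑_i Y_i` and `d = r + q`. The minimum is over the index `s` of the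
whole product. -/
def rBound {Ω : Type*} [MeasurableSpace Ω] (P : Measure Ω) {n r q : ℕ}
    (Y : Fin n → Ω → (Fin r ⊕ Fin q) → ℝ)
    (I : Matrix (Fin r ⊕ Fin q) (Fin r ⊕ Fin q) ℝ)
    (U : Matrix (Fin r) (Fin r) ℝ) (D : Matrix (Fin r) (Fin q) ℝ) : ℝ :=
  let c : ℝ := cConst U D
  let d : ℝ := (r : ℝ) + (q : ℝ)
  let EW2 : Fin r ⊕ Fin q → ℝ := fun t => ∫ ω, normSum Y ω t ^ 2 ∂P
  c / n * ⨅ s : Fin r ⊕ Fin q, gaussAbs I s *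
    ∑ i : Fin n, ∑ j : Fin r ⊕ Fin q, ∑ k : Fin r ⊕ Fin q, ∑ l : Fin r ⊕ Fin q,
      ((∫ ω, |Y i ω j * Y i ω k * Y i ω l| ∂P)
        + 8 * c * d * ∑ t : Fin r ⊕ Fin q,
            (4 * (∫ ω, |Y i ω j * Y i ω k * Y i ω l| ∂P) * EW2 t
              + 4 / n * (∫ ω, |Y i ω j * Y i ω k * Y i ω l * Y i ω t ^ 2| ∂P)
              + gaussAbsSq I s t / gaussAbs I s * (∫ ω, |Y i ω j * Y i ω k * Y i ω l| ∂P))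
        + 2 * |∫ ω, Y i ω j * Y i ω k ∂P| *
            ((∫ ω, |Y i ω l| ∂P)
              + 16 * c * d * ∑ t : Fin r ⊕ Fin q,
                  (4 * (∫ ω, |Y i ω l| ∂P) * EW2 t
                    + 4 / n * (∫ ω, |Y i ω l * Y i ω t ^ 2| ∂P)
                    + gaussAbsSq I s t / gaussAbs I s * (∫ ω, |Y i ω l| ∂P))))

end Wilks

end

/-! Let A be the matrix of g and S the square root of the Fisher information. Diagonalising S A S in
an orthonormal eigenbasis turns the score into an isotropic vector (centred, identity covariance),
turns g into |x|² := ∑ lam_j x_j² with nonnegative weights sorted increasingly, and turns S Z into a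
standard normal vector. It remains to compare E h(|x|²) for a normalised sum V of i.i.d. isotropic
vectors and for a standard normal Z.

The comparison interpolates along the quarter circle sin φ · V + cos φ · Z. Put F(x) = h(|x|²) and s
= sin φ / √n. After Gaussian integration by parts in Z, the φ-derivative of E F is n^{-1/2} times a
sum over the summands y of cos φ · E[∂_y F(x + s y) − s ΔF(x + s y)], where x contains the other
summands and the Gaussian part and is independent of y. Mean zero and identity covariance of y
cancel the leading terms, and increments of second derivatives of F remain. A third derivative of h
is not available, but the factor cos φ pays for exactly one Gaussian integration by parts, which
moves the missing derivative onto the Gaussian weight. This is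
`TestData.abs_integral_secondDer_sub_le`.

In ∂²_a F = 4 h''(|x|²)⟨a,x⟩² + 2|a|² h'(|x|²) only the increment of h'' under a shift b needs this
smoothing. Moving b into place coordinate by coordinate against the full form ⟨a,x⟩ would produce ∑
|b_m| without weights, which the weighted norm of b does not control. `abel_sum` pairs the move of
coordinate m with the part of ⟨a,x⟩ in the coordinates up to m only. Since the weights increase,
that part has second moment at most lam_m |a|² (`dotProduct_trunc_le`), which supplies the missing
weight (`TestData.abs_integral_step_le`). In the remaining terms the square of the linear form gains
index m and carries a factor lam_m x_m; since lam_m x_m h''(|x|²) is half the m-th partial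
derivative of h'(|x|²), one integration by parts again suffices (`TestData.abs_integral_cross_le`).
The outcome, `TestData.abs_integral_sub_integral_le`, involves ‖h''‖ and moments of the weighted
norm.

Finally both sides of the proposition are reduced to the same two quantities, E[|Y|₁³ w] and ∑|I_jk|
· E[|Y|₁ w] with |·|₁ the ℓ¹-norm and w = tr I + |Y|²/n (Euclidean norm). The upper bound uses
|A_jk| ≤ c (`moment_bound`). The lower bound for R drops nonnegative terms and uses α_s ≥ 1/√(3 tr
I) (`le_rBound`, `one_le_gaussAbs_mul`). The numerical constants then leave room. -/

noncomputable section

namespace Wilks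

/-! ### Continuous functions of polynomial growth -/

section Growth

variable {E F : Type*} [NormedAddCommGroup E] [NormedAddCommGroup F]

/-- Continuous real functions bounded by a multiple of `(1 + ‖p‖) ^ k`. -/
def PolyGrowth (k : ℕ) (f : E → ℝ) : Prop :=
  Continuous f ∧ ∃ C : ℝ, 0 ≤ C ∧ ∀ p, |f p| ≤ C * (1 + ‖p‖) ^ k

/-- The `k`-th absolute moment of the measure is finite. -/
def HasMoment [MeasurableSpace E] (k : ℕ) (μ : Measure E) : Prop :=
  Integrable (fun p => (1 + ‖p‖) ^ k) μ

lemma one_le_one_add_norm (p : E) : 1 ≤ 1 + ‖p‖ := by linarith [norm_nonneg p]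

namespace PolyGrowth

variable {k l : ℕ} {f g : E → ℝ}

lemma continuous (hf : PolyGrowth k f) : Continuous f := hf.1

lemma integrable [MeasurableSpace E] [OpensMeasurableSpace E] {μ : Measure E}
    (hf : PolyGrowth k f) (hμ : HasMoment k μ) : Integrable f μ := by
  obtain ⟨hc, C, -, hC⟩ := hf
  refine (hμ.const_mul C).mono' hc.aestronglyMeasurable (.of_forall fun p => ?_)
  simpa using hC p

lemma mono (hf : PolyGrowth k f) (hkl : k ≤ l) : PolyGrowth l f := by
  obtain ⟨hc, C, hC0, hC⟩ := hf
  refine ⟨hc, C, hC0, fun p => (hC p).trans ?_⟩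
  exact mul_le_mul_of_nonneg_left (pow_le_pow_right₀ (one_le_one_add_norm p) hkl) hC0

lemma of_bounded (hc : Continuous f) {C : ℝ} (hC : ∀ p, |f p| ≤ C) : PolyGrowth 0 f :=
  ⟨hc, |C|, abs_nonneg _, fun p => by simpa using (hC p).trans (le_abs_self C)⟩

lemma const (c : ℝ) : PolyGrowth k (fun _ : E => c) :=
  (of_bounded continuous_const (fun _ => le_rfl)).mono (Nat.zero_le k)

lemma add (hf : PolyGrowth k f) (hg : PolyGrowth k g) : PolyGrowth k (fun p => f p + g p) := by
  obtain ⟨hc, C, hC0, hC⟩ := hf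
  obtain ⟨hc', C', hC0', hC'⟩ := hg
  refine ⟨hc.add hc', C + C', by positivity, fun p => (abs_add_le _ _).trans ?_⟩
  rw [add_mul]
  exact add_le_add (hC p) (hC' p)

lemma neg (hf : PolyGrowth k f) : PolyGrowth k (fun p => -f p) := by
  obtain ⟨hc, C, hC0, hC⟩ := hf
  exact ⟨hc.neg, C, hC0, fun p => by simpa using hC p⟩

lemma sub (hf : PolyGrowth k f) (hg : PolyGrowth k g) : PolyGrowth k (fun p => f p - g p) := by
  simpa [sub_eq_add_neg] using hf.add hg.neg

lemma mul (hf : PolyGrowth k f) (hg : PolyGrowth l g) :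
    PolyGrowth (k + l) (fun p => f p * g p) := by
  obtain ⟨hc, C, hC0, hC⟩ := hf
  obtain ⟨hc', C', hC0', hC'⟩ := hg
  refine ⟨hc.mul hc', C * C', by positivity, fun p => ?_⟩
  rw [abs_mul, pow_add, mul_mul_mul_comm]
  exact mul_le_mul (hC p) (hC' p) (abs_nonneg _) ((abs_nonneg _).trans (hC p))

lemma const_mul (hf : PolyGrowth k f) (c : ℝ) : PolyGrowth k (fun p => c * f p) := by
  simpa using (const (k := 0) c).mul hf

lemma pow (hf : PolyGrowth k f) (m : ℕ) : PolyGrowth (m * k) (fun p => f p ^ m) := by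
  induction m with
  | zero => simpa using const (E := E) (k := 0) 1
  | succ m ih => simpa [pow_succ, Nat.succ_mul] using ih.mul hf

lemma abs (hf : PolyGrowth k f) : PolyGrowth k (fun p => |f p|) := by
  obtain ⟨hc, C, hC0, hC⟩ := hf
  exact ⟨hc.abs, C, hC0, fun p => by simpa using hC p⟩

lemma sum {ι : Type*} (s : Finset ι) {f : ι → E → ℝ} (hf : ∀ i ∈ s, PolyGrowth k (f i)) :
    PolyGrowth k (fun p => ∑ i ∈ s, f i p) := by
  classical
  induction s using Finset.induction_on with
  | empty => simpa using const (E := E) (k := k) 0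
  | insert i s hi ih =>
    simp only [Finset.sum_insert hi]
    exact (hf i (Finset.mem_insert_self i s)).add
      (ih fun j hj => hf j (Finset.mem_insert_of_mem hj))

lemma comp {φ : F → E} (hf : PolyGrowth k f) (hφ : Continuous φ) {A : ℝ}
    (hA : ∀ p, ‖φ p‖ ≤ A * (1 + ‖p‖)) : PolyGrowth k (fun p => f (φ p)) := by
  obtain ⟨hc, C, hC0, hC⟩ := hf
  refine ⟨hc.comp hφ, C * (1 + |A|) ^ k, by positivity, fun p => (hC _).trans ?_⟩
  rw [mul_assoc, ← mul_pow]
  have h1 := one_le_one_add_norm p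
  have h2 : A * (1 + ‖p‖) ≤ |A| * (1 + ‖p‖) :=
    mul_le_mul_of_nonneg_right (le_abs_self A) (by linarith)
  gcongr
  nlinarith [hA p]

lemma sqrt (hf : PolyGrowth (2 * k) f) : PolyGrowth k (fun p => √(f p)) := by
  obtain ⟨hc, C, hC0, hC⟩ := hf
  refine ⟨hc.sqrt, √C, Real.sqrt_nonneg _, fun p => ?_⟩
  rw [abs_of_nonneg (Real.sqrt_nonneg _)]
  have h1 := one_le_one_add_norm p
  apply Real.sqrt_le_iff.2 ⟨by positivity, ?_⟩
  rw [mul_pow, Real.sq_sqrt hC0, ← pow_mul, mul_comm k 2]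
  exact (le_abs_self _).trans (hC p)

lemma apply {ι : Type*} [Fintype ι] (i : ι) : PolyGrowth 1 (fun p : ι → ℝ => p i) :=
  ⟨continuous_apply i, 1, zero_le_one, fun p => by
    have := norm_le_pi_norm p i
    rw [Real.norm_eq_abs] at this
    simpa using this.trans (by linarith)⟩

lemma id : PolyGrowth 1 (fun p : ℝ => p) :=
  ⟨continuous_id, 1, zero_le_one, fun p => by simp⟩

end PolyGrowth

namespace HasMoment

variable [MeasurableSpace E] [MeasurableSpace F] {k l : ℕ}

lemma mono [OpensMeasurableSpace E] {μ : Measure E} (h : HasMoment l μ) (hkl : k ≤ l) :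
    HasMoment k μ := by
  have : PolyGrowth k (fun p : E => (1 + ‖p‖) ^ k) := by
    refine ⟨by fun_prop, 1, zero_le_one, fun p => ?_⟩
    rw [abs_of_nonneg (by positivity), one_mul]
  exact (this.mono hkl).integrable h

lemma prod {μ : Measure E} {ν : Measure F} [SFinite μ] [SFinite ν]
    [OpensMeasurableSpace E] [OpensMeasurableSpace F] [SecondCountableTopology E]
    (hμ : HasMoment k μ) (hν : HasMoment k ν) : HasMoment k (μ.prod ν) := by
  refine (Integrable.mul_prod hμ hν).mono'
    (Continuous.aestronglyMeasurable (by fun_prop)) (.of_forall fun p => ?_)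
  rw [Real.norm_of_nonneg (by positivity), ← mul_pow]
  have h1 := norm_nonneg p.1
  have h2 := norm_nonneg p.2
  have h3 : ‖p‖ ≤ ‖p.1‖ + ‖p.2‖ := by
    rw [Prod.norm_def]; exact max_le (by linarith) (by linarith)
  gcongr
  nlinarith

/-- For the sup norm, 1 + ‖p‖ is at most the product of the 1 + ‖p i‖, since every factor is at
least 1; the k-th power of that product is integrable factor by factor. -/
lemma pi {ι : Type*} [Fintype ι] [BorelSpace E] [SecondCountableTopology E] {μ : Measure E}
    [IsProbabilityMeasure μ] (hμ : HasMoment k μ) :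
    HasMoment k (Measure.pi fun _ : ι => μ) := by
  have h := Integrable.fintype_prod (μ := fun _ : ι => μ)
    (f := fun (_ : ι) (p : E) => (1 + ‖p‖) ^ k) (fun _ => hμ)
  refine h.mono' (Continuous.aestronglyMeasurable (by fun_prop)) (.of_forall fun p => ?_)
  rw [Real.norm_of_nonneg (by positivity), Finset.prod_pow]
  have h1 : (1 : ℝ) ≤ ∏ i, (1 + ‖p i‖) :=
    Finset.one_le_prod (s := Finset.univ) fun i _ => one_le_one_add_norm _
  have h2 : ‖p‖ ≤ (∏ i, (1 + ‖p i‖)) - 1 := by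
    refine (pi_norm_le_iff_of_nonneg (by linarith)).2 fun i => ?_
    classical
    rw [← Finset.mul_prod_erase _ _ (Finset.mem_univ i)]
    have : (1 : ℝ) ≤ ∏ j ∈ Finset.univ.erase i, (1 + ‖p j‖) :=
      Finset.one_le_prod fun j _ => one_le_one_add_norm _
    nlinarith [norm_nonneg (p i)]
  gcongr
  linarith

lemma map [OpensMeasurableSpace E] [BorelSpace F] [OpensMeasurableSpace F]
    [SecondCountableTopology F] {μ : Measure E} {φ : E → F}
    (h : HasMoment k μ) (hφ : Continuous φ) {A : ℝ} (hA : ∀ p, ‖φ p‖ ≤ A * (1 + ‖p‖)) :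
    HasMoment k (μ.map φ) := by
  have : PolyGrowth k (fun p : F => (1 + ‖p‖) ^ k) := by
    refine ⟨by fun_prop, 1, zero_le_one, fun p => ?_⟩
    rw [abs_of_nonneg (by positivity), one_mul]
  unfold HasMoment
  rw [integrable_map_measure (Continuous.aestronglyMeasurable (by fun_prop))
    hφ.measurable.aemeasurable]
  exact (this.comp hφ hA).integrable h

end HasMoment

end Growth

/-! ### Gaussian moments and integration by parts -/

lemma hasMoment_of_memLp {E : Type*} [NormedAddCommGroup E] [MeasurableSpace E]
    {k : ℕ} {μ : Measure E} [IsFiniteMeasure μ] (h : MemLp (fun p : E => p) k μ) :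
    HasMoment k μ := by
  rcases Nat.eq_zero_or_pos k with rfl | hk
  · simp [HasMoment]
  have h1 : MemLp (fun p : E => 1 + ‖p‖) k μ := (memLp_const (1 : ℝ)).add h.norm
  have h2 := h1.integrable_norm_pow hk.ne'
  refine h2.congr (.of_forall fun p => ?_)
  change ‖1 + ‖p‖‖ ^ k = (1 + ‖p‖) ^ k
  rw [Real.norm_of_nonneg (zero_le_one.trans (one_le_one_add_norm p))]

lemma hasMoment_gaussianReal (k : ℕ) : HasMoment k (gaussianReal 0 1) :=
  hasMoment_of_memLp (memLp_id_gaussianReal' _ (by simp))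

instance (ι : Type*) [Fintype ι] : IsProbabilityMeasure (stdNormal ι) := by
  unfold stdNormal; infer_instance

lemma hasMoment_stdNormal (ι : Type*) [Fintype ι] (k : ℕ) : HasMoment k (stdNormal ι) :=
  (hasMoment_gaussianReal k).pi

lemma hasDerivAt_gaussianPDFReal (t : ℝ) :
    HasDerivAt (gaussianPDFReal 0 1) (-t * gaussianPDFReal 0 1 t) t := by
  have h1 : HasDerivAt (fun x : ℝ => -(x - 0) ^ 2 / (2 * ((1 : NNReal) : ℝ))) (-t) t := by
    have := (((hasDerivAt_id t).sub_const 0).pow 2).neg.div_const (2 * ((1 : NNReal) : ℝ))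
    refine this.congr_deriv ?_
    simp only [id_eq, sub_zero, NNReal.coe_one]
    norm_num
    ring
  have h2 := (h1.exp).const_mul ((√(2 * Real.pi * ((1 : NNReal) : ℝ)))⁻¹)
  rw [gaussianPDFReal_def]
  refine h2.congr_deriv ?_
  ring

lemma integrable_gaussianPDFReal_mul {f : ℝ → ℝ} (hf : Integrable f (gaussianReal 0 1)) :
    Integrable (fun t => gaussianPDFReal 0 1 t * f t) := by
  rw [gaussianReal_of_var_ne_zero _ one_ne_zero] at hf
  have := (integrable_withDensity_iff_integrable_smul' (measurable_gaussianPDF 0 1)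
    (by simp [gaussianPDF_lt_top])).1 hf
  simpa [toReal_gaussianPDF] using this

/-- The Gaussian density p satisfies p' = −t p, so this is integration by parts on the whole line.
Integrability of f p takes the place of vanishing boundary terms. -/
lemma integral_mul_gaussianReal {k : ℕ} {f f' : ℝ → ℝ} (hf : PolyGrowth k f)
    (hf' : PolyGrowth k f') (hd : ∀ t, HasDerivAt f (f' t) t) :
    ∫ t, t * f t ∂(gaussianReal 0 1) = ∫ t, f' t ∂(gaussianReal 0 1) := by
  rw [integral_gaussianReal_eq_integral_smul one_ne_zero,
    integral_gaussianReal_eq_integral_smul one_ne_zero]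
  have i1 := integrable_gaussianPDFReal_mul (hf.integrable (hasMoment_gaussianReal k))
  have i2 := integrable_gaussianPDFReal_mul (hf'.integrable (hasMoment_gaussianReal k))
  have i3 := integrable_gaussianPDFReal_mul
    ((PolyGrowth.id.mul hf).integrable (hasMoment_gaussianReal _))
  have h := integral_mul_deriv_eq_deriv_mul_of_integrable (u := f) (u' := f')
    (v := gaussianPDFReal 0 1) (v' := fun t => -t * gaussianPDFReal 0 1 t)
    (fun t _ => hd t) (fun t _ => hasDerivAt_gaussianPDFReal t)
    (i3.neg.congr (.of_forall fun t => by simp; ring))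
    (i2.congr (.of_forall fun t => by simp; ring))
    (i1.congr (.of_forall fun t => by simp; ring))
  have e1 : ∫ t, gaussianPDFReal 0 1 t • (t * f t)
      = -∫ t, f t * (-t * gaussianPDFReal 0 1 t) := by
    rw [← integral_neg]; congr 1; ext t; simp only [smul_eq_mul]; ring
  have e2 : ∫ t, gaussianPDFReal 0 1 t • f' t = ∫ t, f' t * gaussianPDFReal 0 1 t := by
    congr 1; ext t; simp only [smul_eq_mul]; ring
  rw [e1, h, e2, neg_neg]

/-- Gaussian integration by parts in one coordinate. -/
lemma integral_coord_mul_stdNormal {N k : ℕ} (m : Fin N) {f f' : (Fin N → ℝ) → ℝ}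
    (hf : PolyGrowth k f) (hf' : PolyGrowth k f')
    (hd : ∀ z, HasLineDerivAt ℝ f (f' z) z (Pi.single m 1)) :
    ∫ z, z m * f z ∂(stdNormal (Fin N)) = ∫ z, f' z ∂(stdNormal (Fin N)) := by
  obtain _ | n := N
  · exact m.elim0
  have mp := (measurePreserving_piFinSuccAbove (fun _ : Fin (n + 1) => gaussianReal 0 1) m).symm
  -- Fubini with coordinate m integrated innermost, which leaves a one-dimensional integration by
  -- parts for each value of the other coordinates.
  have key : ∀ φ : (Fin (n + 1) → ℝ) → ℝ, Integrable φ (stdNormal (Fin (n + 1))) →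
      ∫ z, φ z ∂(stdNormal (Fin (n + 1)))
        = ∫ v, (∫ t, φ (m.insertNth t v) ∂(gaussianReal 0 1)) ∂(stdNormal (Fin n)) := by
    intro φ hφ
    have h1 := mp.integrable_comp_emb (MeasurableEquiv.measurableEmbedding _) (g := φ)
    unfold stdNormal at hφ ⊢
    rw [← mp.integral_comp (MeasurableEquiv.measurableEmbedding _),
      integral_prod_symm (fun x => φ ((MeasurableEquiv.piFinSuccAbove (fun _ => ℝ) m).symm x))
        (h1.2 hφ)]
    rfl
  have hnorm : ∀ (t : ℝ) (v : Fin n → ℝ),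
      ‖(m.insertNth t v : Fin (n + 1) → ℝ)‖ ≤ (1 + ‖v‖) * (1 + ‖t‖) := by
    intro t v
    have h1 := norm_nonneg v
    have h2 := norm_nonneg t
    refine (pi_norm_le_iff_of_nonneg (by positivity)).2 fun i => ?_
    refine Fin.succAboveCases m ?_ (fun j => ?_) i
    · rw [Fin.insertNth_apply_same]; nlinarith
    · rw [Fin.insertNth_apply_succAbove]; nlinarith [norm_le_pi_norm v j]
  have hcont : ∀ v : Fin n → ℝ, Continuous fun t : ℝ => (m.insertNth t v : Fin (n + 1) → ℝ) :=
    fun v => Continuous.finInsertNth m continuous_id continuous_const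
  rw [key _ (((PolyGrowth.apply m).mul hf).integrable (hasMoment_stdNormal _ _)),
    key _ (hf'.integrable (hasMoment_stdNormal _ _))]
  congr 1
  ext v
  simp only [Fin.insertNth_apply_same]
  refine integral_mul_gaussianReal (hf.comp (hcont v) (hnorm · v))
    (hf'.comp (hcont v) (hnorm · v)) fun t => ?_
  have h := hd (m.insertNth t v)
  unfold HasLineDerivAt at h
  -- The line derivative lives at parameter 0; translating the parameter by t makes it the
  -- derivative of the one-variable slice at t.
  have h2 : HasDerivAt (fun s : ℝ => s - t) 1 t := (hasDerivAt_id t).sub_const t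
  have h3 := HasDerivAt.comp t (h₂ := fun s : ℝ => f (m.insertNth t v + s • Pi.single m 1))
    (h := fun s : ℝ => s - t) (by simpa using h) h2
  rw [mul_one] at h3
  refine h3.congr_of_eventuallyEq (.of_forall fun s => ?_)
  simp only [Function.comp]
  congr 1
  ext i
  refine Fin.succAboveCases m ?_ (fun j => ?_) i
  · simp
  · simp

/-- Gaussian integration by parts in the second factor of a product. -/
lemma integral_coord_mul_prod_stdNormal {N : ℕ} {ν : Measure (Fin N → ℝ)} [IsProbabilityMeasure ν]
    (hν : HasMoment 4 ν) (m : Fin N) {f f' : (Fin N → ℝ) × (Fin N → ℝ) → ℝ}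
    (hf : PolyGrowth 3 f) (hf' : PolyGrowth 3 f')
    (hd : ∀ p, HasLineDerivAt ℝ f (f' p) p (0, Pi.single m 1)) :
    ∫ p, p.2 m * f p ∂(ν.prod (stdNormal (Fin N))) = ∫ p, f' p ∂(ν.prod (stdNormal (Fin N))) := by
  have hm := hν.prod (hasMoment_stdNormal (Fin N) 4)
  have hc : PolyGrowth 1 (fun p : (Fin N → ℝ) × (Fin N → ℝ) => p.2 m) :=
    (PolyGrowth.apply m).comp continuous_snd (A := 1) fun p => by
      linarith [norm_snd_le p, norm_nonneg p]
  rw [integral_prod _ ((hc.mul hf).integrable hm),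
    integral_prod _ (hf'.integrable (hm.mono (by norm_num)))]
  congr 1
  ext w
  have hA : ∀ z : Fin N → ℝ, ‖(w, z)‖ ≤ (1 + ‖w‖) * (1 + ‖z‖) := fun z => by
    have h1 := norm_nonneg w
    have h2 := norm_nonneg z
    rw [Prod.norm_def]
    exact max_le (by simp only; nlinarith) (by simp only; nlinarith)
  refine integral_coord_mul_stdNormal m (hf.comp (by fun_prop) hA) (hf'.comp (by fun_prop) hA)
    fun z => ?_
  have h := hd (w, z)
  unfold HasLineDerivAt at h ⊢
  simpa using h

/-! ### A weighted inner product and its truncations -/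

section Weighted

variable {N : ℕ} (lam : Fin N → ℝ)

/-- The bilinear form `∑ lam_j a_j b_j`. -/
def wip (a b : Fin N → ℝ) : ℝ := ∑ j, lam j * a j * b j

/-- The seminorm of the weighted inner product. -/
def wnorm (a : Fin N → ℝ) : ℝ := √(wip lam a a)

/-- Keep the coordinates with index below `k`. -/
def trunc (k : ℕ) (a : Fin N → ℝ) : Fin N → ℝ := fun j => if (j : ℕ) < k then a j else 0

lemma wip_comm (a b : Fin N → ℝ) : wip lam a b = wip lam b a :=
  Finset.sum_congr rfl fun _ _ => by ring

lemma wip_add_right (a b c : Fin N → ℝ) : wip lam a (b + c) = wip lam a b + wip lam a c := by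
  simp only [wip, Pi.add_apply, mul_add, Finset.sum_add_distrib]

lemma wip_add_left (a b c : Fin N → ℝ) : wip lam (a + b) c = wip lam a c + wip lam b c := by
  rw [wip_comm, wip_add_right, wip_comm lam c a, wip_comm lam c b]

lemma wip_smul_right (a b : Fin N → ℝ) (t : ℝ) : wip lam a (t • b) = t * wip lam a b := by
  simp only [wip, Pi.smul_apply, smul_eq_mul, Finset.mul_sum]
  exact Finset.sum_congr rfl fun _ _ => by ring

lemma wip_smul_left (a b : Fin N → ℝ) (t : ℝ) : wip lam (t • a) b = t * wip lam a b := by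
  rw [wip_comm, wip_smul_right, wip_comm]

lemma wip_single_right (a : Fin N → ℝ) (m : Fin N) (t : ℝ) :
    wip lam a (Pi.single m t) = lam m * a m * t := by
  rw [wip, Finset.sum_eq_single m]
  · simp
  · intro j _ hj; simp [hj]
  · simp

lemma wip_zero_left (b : Fin N → ℝ) : wip lam 0 b = 0 := by simp [wip]

lemma wip_add_self (x b : Fin N → ℝ) :
    wip lam (x + b) (x + b) = wip lam x x + 2 * wip lam b x + wip lam b b := by
  rw [wip_add_right, wip_add_left, wip_add_left, wip_comm lam x b]; ring

lemma wip_eq_dotProduct (a b : Fin N → ℝ) : wip lam a b = (lam * a) ⬝ᵥ b := rfl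

lemma continuous_wip {X : Type*} [TopologicalSpace X] {a b : X → Fin N → ℝ}
    (ha : Continuous a) (hb : Continuous b) : Continuous fun x => wip lam (a x) (b x) := by
  unfold wip; fun_prop

lemma trunc_zero (a : Fin N → ℝ) : trunc 0 a = 0 := by ext; simp [trunc]

lemma trunc_self (a : Fin N → ℝ) : trunc N a = a := by ext j; simp [trunc]

lemma trunc_succ (m : Fin N) (a : Fin N → ℝ) :
    trunc (m + 1) a = trunc m a + Pi.single m (a m) := by
  ext j
  simp only [trunc, Pi.add_apply, Pi.single_apply]
  rcases lt_trichotomy (j : ℕ) m with h | h | h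
  · have : j ≠ m := fun e => by simp [e] at h
    simp [this, h, Nat.lt_succ_of_lt h]
  · have : j = m := Fin.ext h
    simp [this]
  · have : j ≠ m := fun e => by simp [e] at h
    simp [this, not_lt.2 h.le, not_lt.2 (Nat.succ_le_of_lt h)]

lemma trunc_apply_self (m : Fin N) (a : Fin N → ℝ) : trunc m a m = 0 := by simp [trunc]

lemma trunc_succ_apply_self (m : Fin N) (a : Fin N → ℝ) : trunc (m + 1) a m = a m := by
  simp [trunc]

variable {lam}

lemma wip_self_nonneg (hlam : ∀ j, 0 ≤ lam j) (a : Fin N → ℝ) : 0 ≤ wip lam a a :=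
  Finset.sum_nonneg fun j _ => by
    rw [mul_assoc]; exact mul_nonneg (hlam j) (mul_self_nonneg _)

lemma wnorm_nonneg (a : Fin N → ℝ) : 0 ≤ wnorm lam a := Real.sqrt_nonneg _

lemma wnorm_sq (hlam : ∀ j, 0 ≤ lam j) (a : Fin N → ℝ) : wnorm lam a ^ 2 = wip lam a a :=
  Real.sq_sqrt (wip_self_nonneg hlam a)

lemma wnorm_smul (t : ℝ) (a : Fin N → ℝ) : wnorm lam (t • a) = |t| * wnorm lam a := by
  rw [wnorm, wip_smul_left, wip_smul_right, ← mul_assoc, Real.sqrt_mul (mul_self_nonneg t),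
    Real.sqrt_mul_self_eq_abs, wnorm]

lemma wip_sq_le (hlam : ∀ j, 0 ≤ lam j) (a b : Fin N → ℝ) :
    wip lam a b ^ 2 ≤ wip lam a a * wip lam b b := by
  have h := Finset.sum_mul_sq_le_sq_mul_sq Finset.univ (fun j => √(lam j) * a j)
    (fun j => √(lam j) * b j)
  have e : ∀ (u v : Fin N → ℝ) j, √(lam j) * u j * (√(lam j) * v j) = lam j * u j * v j :=
    fun u v j => by rw [mul_mul_mul_comm, Real.mul_self_sqrt (hlam j), mul_assoc]
  simp only [sq (√(lam _) * _), e] at h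
  exact h

lemma abs_wip_le (hlam : ∀ j, 0 ≤ lam j) (a b : Fin N → ℝ) :
    |wip lam a b| ≤ wnorm lam a * wnorm lam b := by
  apply abs_le_of_sq_le_sq _ (mul_nonneg (wnorm_nonneg _) (wnorm_nonneg _))
  rw [mul_pow, wnorm_sq hlam, wnorm_sq hlam]
  exact wip_sq_le hlam a b

lemma wip_trunc_self_le (hlam : ∀ j, 0 ≤ lam j) (k : ℕ) (a : Fin N → ℝ) :
    wip lam (trunc k a) (trunc k a) ≤ wip lam a a := by
  refine Finset.sum_le_sum fun j _ => ?_
  unfold trunc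
  split_ifs
  · rfl
  · simpa [mul_assoc] using mul_nonneg (hlam j) (mul_self_nonneg (a j))

/-- The Euclidean square of the coefficients of a truncated linear form. -/
lemma dotProduct_trunc_le (hlam : ∀ j, 0 ≤ lam j) (hmono : Monotone lam) (a : Fin N → ℝ)
    (m : Fin N) {k : ℕ} (hk : k ≤ m + 1) :
    (lam * trunc k a) ⬝ᵥ (lam * trunc k a) ≤ lam m * wip lam a a := by
  rw [wip, Finset.mul_sum]
  refine Finset.sum_le_sum fun j _ => ?_
  simp only [Pi.mul_apply, trunc]
  have h0 := mul_self_nonneg (a j)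
  split_ifs with hj
  -- The ordering of the weights is used here: a kept index satisfies j < k ≤ m + 1, so one of the
  -- two factors lam j may be replaced by lam m.
  · have h1 : lam j ≤ lam m := hmono (Fin.le_def.2 (by omega))
    have : lam j * a j * (lam j * a j) = lam j * (lam j * (a j * a j)) := by ring
    rw [this, mul_assoc (lam j)]
    exact mul_le_mul_of_nonneg_right h1 (mul_nonneg (hlam j) h0)
  · have := mul_nonneg (hlam m) (mul_nonneg (hlam j) h0)
    simpa [mul_assoc] using this

lemma dotProduct_weight_le (hlam : ∀ j, 0 ≤ lam j) (a : Fin N → ℝ) :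
    (lam * a) ⬝ᵥ (lam * a) ≤ (∑ j, lam j) * wip lam a a := by
  rw [wip, Finset.mul_sum]
  refine Finset.sum_le_sum fun j _ => ?_
  simp only [Pi.mul_apply]
  have h1 : lam j ≤ ∑ j, lam j := Finset.single_le_sum (fun j _ => hlam j) (Finset.mem_univ j)
  have : lam j * a j * (lam j * a j) = lam j * (lam j * (a j * a j)) := by ring
  rw [this, mul_assoc (lam j)]
  exact mul_le_mul_of_nonneg_right h1 (mul_nonneg (hlam j) (mul_self_nonneg _))

/-- Cauchy–Schwarz after writing lam m as √(lam m) · √(lam m). With a single √(lam m) in front, as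
in the next lemma, the total weight is replaced by the dimension. -/
lemma sum_weight_mul_abs_le (hlam : ∀ j, 0 ≤ lam j) (a : Fin N → ℝ) :
    ∑ m, lam m * |a m| ≤ √(∑ j, lam j) * wnorm lam a := by
  rw [wnorm, ← Real.sqrt_mul (Finset.sum_nonneg fun j _ => hlam j)]
  refine Real.le_sqrt_of_sq_le ?_
  have h := Finset.sum_mul_sq_le_sq_mul_sq Finset.univ (fun j => √(lam j))
    (fun j => √(lam j) * |a j|)
  have e1 : ∀ j, √(lam j) * (√(lam j) * |a j|) = lam j * |a j| :=
    fun j => by rw [← mul_assoc, Real.mul_self_sqrt (hlam j)]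
  have e2 : ∀ j, (√(lam j) * |a j|) ^ 2 = lam j * a j * a j :=
    fun j => by rw [mul_pow, Real.sq_sqrt (hlam j), sq_abs]; ring
  simp only [e1, e2, Real.sq_sqrt (hlam _)] at h
  exact h

lemma sum_sqrt_weight_mul_abs_le (hlam : ∀ j, 0 ≤ lam j) (a : Fin N → ℝ) :
    ∑ m, √(lam m) * |a m| ≤ √N * wnorm lam a := by
  rw [wnorm, ← Real.sqrt_mul (Nat.cast_nonneg N)]
  refine Real.le_sqrt_of_sq_le ?_
  have h := Finset.sum_mul_sq_le_sq_mul_sq Finset.univ (fun _ : Fin N => (1 : ℝ))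
    (fun j => √(lam j) * |a j|)
  have e2 : ∀ j, (√(lam j) * |a j|) ^ 2 = lam j * a j * a j :=
    fun j => by rw [mul_pow, Real.sq_sqrt (hlam j), sq_abs]; ring
  simp only [e2, one_mul, one_pow, Finset.sum_const, Finset.card_univ, Fintype.card_fin,
    nsmul_eq_mul, mul_one] at h
  exact h

end Weighted

lemma integral_add_three {Ω : Type*} [MeasurableSpace Ω] {μ : Measure Ω} {f g h : Ω → ℝ}
    (hf : Integrable f μ) (hg : Integrable g μ) (hh : Integrable h μ) :
    ∫ x, (f x + g x + h x) ∂μ = ∫ x, f x ∂μ + ∫ x, g x ∂μ + ∫ x, h x ∂μ := by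
  rw [← integral_add hf hg]
  exact integral_add (hf.add hg) hh

/-- Cauchy–Schwarz with prescribed bounds on the second moments. -/
lemma integral_abs_mul_le {Ω : Type*} [MeasurableSpace Ω] {μ : Measure Ω} {f g : Ω → ℝ} {A B : ℝ}
    (hf : Integrable (fun x => f x ^ 2) μ) (hg : Integrable (fun x => g x ^ 2) μ)
    (hfg : Integrable (fun x => |f x * g x|) μ) (hA : 0 ≤ A) (hB : 0 ≤ B)
    (h1 : ∫ x, f x ^ 2 ∂μ ≤ A ^ 2) (h2 : ∫ x, g x ^ 2 ∂μ ≤ B ^ 2) :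
    ∫ x, |f x * g x| ∂μ ≤ A * B := by
  -- The polynomial t ↦ ∫ (t|f| + |g|)² is nonnegative, so its discriminant is nonpositive.
  have hq : ∀ t : ℝ, 0 ≤ (∫ x, f x ^ 2 ∂μ) * (t * t) + (2 * ∫ x, |f x * g x| ∂μ) * t
      + ∫ x, g x ^ 2 ∂μ := by
    intro t
    have : (∫ x, f x ^ 2 ∂μ) * (t * t) + (2 * ∫ x, |f x * g x| ∂μ) * t + ∫ x, g x ^ 2 ∂μ
        = ∫ x, (t * |f x| + |g x|) ^ 2 ∂μ := by
      have e : ∀ x, (t * |f x| + |g x|) ^ 2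
          = (t * t) * f x ^ 2 + (2 * t) * |f x * g x| + g x ^ 2 := by
        intro x
        rw [abs_mul, ← sq_abs (f x), ← sq_abs (g x)]; ring
      simp only [e]
      rw [integral_add_three (hf.const_mul _) (hfg.const_mul _) hg, integral_const_mul,
        integral_const_mul]
      ring
    rw [this]
    exact integral_nonneg fun x => sq_nonneg _
  have hd := discrim_le_zero hq
  unfold discrim at hd
  have h0 : 0 ≤ ∫ x, |f x * g x| ∂μ := integral_nonneg fun x => abs_nonneg _
  have hfn : 0 ≤ ∫ x, f x ^ 2 ∂μ := integral_nonneg fun x => sq_nonneg _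
  have hgn : 0 ≤ ∫ x, g x ^ 2 ∂μ := integral_nonneg fun x => sq_nonneg _
  refine le_of_sq_le_sq ?_ (mul_nonneg hA hB)
  calc (∫ x, |f x * g x| ∂μ) ^ 2 ≤ (∫ x, f x ^ 2 ∂μ) * ∫ x, g x ^ 2 ∂μ := by nlinarith
    _ ≤ A ^ 2 * B ^ 2 := mul_le_mul h1 h2 hgn (sq_nonneg _)
    _ = (A * B) ^ 2 := by ring

/-! ### Moments of linear forms of a mixture -/

section Moments

variable {N : ℕ}

lemma polyGrowth_dotProduct {ι : Type*} [Fintype ι] (c : ι → ℝ) :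
    PolyGrowth 1 (fun z : ι → ℝ => c ⬝ᵥ z) :=
  PolyGrowth.sum _ fun i _ => (PolyGrowth.apply i).const_mul (c i)

lemma hasDerivAt_dotProduct_single (c z : Fin N → ℝ) (m : Fin N) (κ t : ℝ) :
    HasDerivAt (fun t : ℝ => c ⬝ᵥ (z + (κ * t) • Pi.single m (1 : ℝ))) (κ * c m) t := by
  have h : (fun t : ℝ => c ⬝ᵥ (z + (κ * t) • Pi.single m (1 : ℝ)))
      = fun t => c ⬝ᵥ z + t * (κ * c m) := by
    ext t
    rw [dotProduct_add, dotProduct_smul, dotProduct_single, smul_eq_mul]; ring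
  rw [h]
  simpa using ((hasDerivAt_id t).mul_const (κ * c m)).const_add (c ⬝ᵥ z)

lemma hasLineDerivAt_dotProduct (c z : Fin N → ℝ) (m : Fin N) :
    HasLineDerivAt ℝ (fun z => c ⬝ᵥ z) (c m) z (Pi.single m 1) := by
  simpa [HasLineDerivAt] using hasDerivAt_dotProduct_single c z m 1 0

lemma integral_coord_mul_dotProduct (c : Fin N → ℝ) (m : Fin N) :
    ∫ z, z m * (c ⬝ᵥ z) ∂(stdNormal (Fin N)) = c m := by
  rw [integral_coord_mul_stdNormal (k := 1) m (polyGrowth_dotProduct c) (PolyGrowth.const (c m))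
    fun z => hasLineDerivAt_dotProduct c z m]
  simp

lemma integral_dotProduct_sq_stdNormal (c : Fin N → ℝ) :
    ∫ z, (c ⬝ᵥ z) ^ 2 ∂(stdNormal (Fin N)) = c ⬝ᵥ c := by
  have e : ∀ z : Fin N → ℝ, (c ⬝ᵥ z) ^ 2 = ∑ i, c i * (z i * (c ⬝ᵥ z)) := by
    intro z
    rw [sq]
    nth_rewrite 1 [dotProduct]
    rw [Finset.sum_mul]
    exact Finset.sum_congr rfl fun i _ => by ring
  simp only [e]
  rw [integral_finsetSum _ fun i _ => (((PolyGrowth.apply i).mul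
    (polyGrowth_dotProduct c)).const_mul (c i)).integrable (hasMoment_stdNormal _ 2)]
  simp only [integral_const_mul, integral_coord_mul_dotProduct]
  rfl

lemma integral_coord_sq_mul_dotProduct_sq (c : Fin N → ℝ) (m : Fin N) :
    ∫ z, z m ^ 2 * (c ⬝ᵥ z) ^ 2 ∂(stdNormal (Fin N)) = c ⬝ᵥ c + 2 * c m ^ 2 := by
  have hl := polyGrowth_dotProduct c
  have hz := PolyGrowth.apply (ι := Fin N) m
  have h := integral_coord_mul_stdNormal (k := 3) m
    (f := fun z => z m * (c ⬝ᵥ z) ^ 2)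
    (f' := fun z => (c ⬝ᵥ z) ^ 2 + (2 * c m) * (z m * (c ⬝ᵥ z)))
    (by simpa using hz.mul (hl.pow 2))
    (by simpa using ((hl.pow 2).add ((hz.mul hl).const_mul (2 * c m))).mono (by norm_num))
    (fun (z : Fin N → ℝ) => by
      have h1 : HasDerivAt (fun t : ℝ => (z + t • (Pi.single m 1 : Fin N → ℝ)) m) 1 0 := by
        simpa using (hasDerivAt_id (0 : ℝ)).const_add (z m)
      have h2 := hasLineDerivAt_dotProduct c z m
      unfold HasLineDerivAt at h2 ⊢
      refine (h1.mul (h2.pow 2)).congr_deriv ?_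
      simp
      ring)
  have e : ∀ z : Fin N → ℝ, z m ^ 2 * (c ⬝ᵥ z) ^ 2 = z m * (z m * (c ⬝ᵥ z) ^ 2) :=
    fun z => by ring
  simp only [e]
  rw [h, integral_add ((hl.pow 2).integrable (hasMoment_stdNormal _ _))
    (((hz.mul hl).const_mul _).integrable (hasMoment_stdNormal _ _)), integral_const_mul,
    integral_coord_mul_dotProduct, integral_dotProduct_sq_stdNormal]
  ring

/-- A centred probability measure with covariance `ρ • 1` and finite fourth moment. -/
structure IsIsotropic (ν : Measure (Fin N → ℝ)) (ρ : ℝ) : Prop where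
  moment : HasMoment 4 ν
  mean : ∀ j, ∫ w, w j ∂ν = 0
  cov : ∀ j k, ∫ w, w j * w k ∂ν = if j = k then ρ else 0

lemma IsIsotropic.integral_dotProduct {ν : Measure (Fin N → ℝ)} {ρ : ℝ} (hν : IsIsotropic ν ρ)
    (c : Fin N → ℝ) : ∫ w, c ⬝ᵥ w ∂ν = 0 := by
  simp only [dotProduct]
  rw [integral_finsetSum _ fun i _ =>
    ((PolyGrowth.apply i).const_mul (c i)).integrable (hν.moment.mono (by norm_num))]
  simp [integral_const_mul, hν.mean]

lemma IsIsotropic.integral_dotProduct_sq {ν : Measure (Fin N → ℝ)} {ρ : ℝ}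
    (hν : IsIsotropic ν ρ) (c : Fin N → ℝ) : ∫ w, (c ⬝ᵥ w) ^ 2 ∂ν = ρ * (c ⬝ᵥ c) := by
  have e : ∀ z : Fin N → ℝ, (c ⬝ᵥ z) ^ 2 = ∑ i, ∑ j, (c i * c j) * (z i * z j) := by
    intro z
    rw [sq, dotProduct, Finset.sum_mul_sum]
    exact Finset.sum_congr rfl fun i _ => Finset.sum_congr rfl fun j _ => by ring
  have hi : ∀ i j, Integrable (fun z : Fin N → ℝ => (c i * c j) * (z i * z j)) ν := fun i j =>
    (((PolyGrowth.apply i).mul (PolyGrowth.apply j)).const_mul _).integrable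
      (hν.moment.mono (by norm_num))
  simp only [e]
  rw [integral_finsetSum _ fun i _ => integrable_finsetSum _ fun j _ => hi i j]
  rw [Finset.sum_congr rfl fun i _ => integral_finsetSum _ fun j _ => hi i j]
  simp only [integral_const_mul, hν.cov, dotProduct, Finset.mul_sum]
  refine Finset.sum_congr rfl fun i _ => ?_
  simp [mul_comm]

/-- The point `w + κ z`. -/
def mix (κ : ℝ) (p : (Fin N → ℝ) × (Fin N → ℝ)) : Fin N → ℝ := p.1 + κ • p.2

lemma continuous_mix (κ : ℝ) : Continuous (mix (N := N) κ) := by unfold mix; fun_prop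

lemma norm_mix_le (κ : ℝ) (p : (Fin N → ℝ) × (Fin N → ℝ)) :
    ‖mix κ p‖ ≤ (1 + |κ|) * (1 + ‖p‖) := by
  unfold mix
  refine (norm_add_le _ _).trans ?_
  rw [norm_smul, Real.norm_eq_abs]
  have h1 := norm_fst_le p
  have h2 := norm_snd_le p
  have h3 := norm_nonneg p
  have h4 := abs_nonneg κ
  nlinarith [mul_le_mul_of_nonneg_left h2 h4]

lemma PolyGrowth.comp_mix {k : ℕ} {f : (Fin N → ℝ) → ℝ} (hf : PolyGrowth k f) (κ : ℝ) :
    PolyGrowth k (fun p => f (mix κ p)) :=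
  hf.comp (continuous_mix κ) (norm_mix_le κ)

lemma PolyGrowth.comp_fst {E F : Type*} [NormedAddCommGroup E] [NormedAddCommGroup F] {k : ℕ}
    {f : E → ℝ} (hf : PolyGrowth k f) : PolyGrowth k (fun p : E × F => f p.1) :=
  hf.comp continuous_fst (A := 1) fun p => by linarith [norm_fst_le p, norm_nonneg p]

lemma PolyGrowth.comp_snd {E F : Type*} [NormedAddCommGroup E] [NormedAddCommGroup F] {k : ℕ}
    {f : F → ℝ} (hf : PolyGrowth k f) : PolyGrowth k (fun p : E × F => f p.2) :=
  hf.comp continuous_snd (A := 1) fun p => by linarith [norm_snd_le p, norm_nonneg p]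

variable {ν : Measure (Fin N → ℝ)} [IsProbabilityMeasure ν] {ρ κ : ℝ}

lemma IsIsotropic.hasMoment_prod (hν : IsIsotropic ν ρ) :
    HasMoment 4 (ν.prod (stdNormal (Fin N))) :=
  hν.moment.prod (hasMoment_stdNormal _ 4)

/-- After expanding the square, the cross term vanishes because the first component is centred and
independent of the second. -/
lemma IsIsotropic.integral_weight_mul_dotProduct_mix_sq (hν : IsIsotropic ν ρ) (κ : ℝ)
    (c : Fin N → ℝ) {q : (Fin N → ℝ) → ℝ} (hq : PolyGrowth 2 q) :
    ∫ p, q p.2 * (c ⬝ᵥ mix κ p) ^ 2 ∂(ν.prod (stdNormal (Fin N)))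
      = ρ * (c ⬝ᵥ c) * (∫ z, q z ∂(stdNormal (Fin N)))
        + κ ^ 2 * ∫ z, q z * (c ⬝ᵥ z) ^ 2 ∂(stdNormal (Fin N)) := by
  have hm := hν.hasMoment_prod
  have hl := polyGrowth_dotProduct c
  have e : ∀ p : (Fin N → ℝ) × (Fin N → ℝ), q p.2 * (c ⬝ᵥ mix κ p) ^ 2
      = (c ⬝ᵥ p.1) ^ 2 * q p.2 + (2 * κ) * ((c ⬝ᵥ p.1) * (q p.2 * (c ⬝ᵥ p.2)))
        + κ ^ 2 * (1 * (q p.2 * (c ⬝ᵥ p.2) ^ 2)) := by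
    intro p
    rw [mix, dotProduct_add, dotProduct_smul, smul_eq_mul]; ring
  simp only [e]
  have g1 : PolyGrowth 4 (fun p : (Fin N → ℝ) × (Fin N → ℝ) => (c ⬝ᵥ p.1) ^ 2 * q p.2) := by
    simpa using (hl.pow 2).comp_fst.mul hq.comp_snd
  have g2 : PolyGrowth 4 (fun p : (Fin N → ℝ) × (Fin N → ℝ) =>
      (2 * κ) * ((c ⬝ᵥ p.1) * (q p.2 * (c ⬝ᵥ p.2)))) := by
    simpa using ((hl.comp_fst.mul (hq.mul hl).comp_snd).const_mul (2 * κ))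
  have g3 : PolyGrowth 4 (fun p : (Fin N → ℝ) × (Fin N → ℝ) =>
      κ ^ 2 * (1 * (q p.2 * (c ⬝ᵥ p.2) ^ 2))) := by
    simpa using ((hq.mul (hl.pow 2)).comp_snd.const_mul (κ ^ 2))
  rw [integral_add_three (g1.integrable hm) (g2.integrable hm) (g3.integrable hm),
    integral_const_mul, integral_const_mul,
    integral_prod_mul (fun w : Fin N → ℝ => (c ⬝ᵥ w) ^ 2) q,
    integral_prod_mul (fun w : Fin N → ℝ => c ⬝ᵥ w) (fun z => q z * (c ⬝ᵥ z)),
    integral_prod_mul (fun _ : Fin N → ℝ => (1 : ℝ)) (fun z => q z * (c ⬝ᵥ z) ^ 2),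
    hν.integral_dotProduct, hν.integral_dotProduct_sq]
  simp

lemma dotProduct_self_nonneg' (c : Fin N → ℝ) : 0 ≤ c ⬝ᵥ c :=
  Finset.sum_nonneg fun i _ => mul_self_nonneg (c i)

lemma IsIsotropic.integral_dotProduct_mix_sq_le (hν : IsIsotropic ν ρ) (hρ : ρ + κ ^ 2 ≤ 1)
    (c : Fin N → ℝ) :
    ∫ p, (c ⬝ᵥ mix κ p) ^ 2 ∂(ν.prod (stdNormal (Fin N))) ≤ c ⬝ᵥ c := by
  have := hν.integral_weight_mul_dotProduct_mix_sq κ c (q := fun _ => 1) (PolyGrowth.const 1)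
  simp only [one_mul, integral_dotProduct_sq_stdNormal] at this
  rw [this]
  simp only [integral_const, probReal_univ, smul_eq_mul, mul_one]
  nlinarith [dotProduct_self_nonneg' c]

lemma integral_coord_sq_stdNormal (m : Fin N) : ∫ z, z m ^ 2 ∂(stdNormal (Fin N)) = 1 := by
  have := integral_dotProduct_sq_stdNormal (Pi.single m (1 : ℝ))
  simpa using this

/-- The factor z_m² has mean 1, so it only alters the Gaussian part, turning c·c into c·c + 2 c_m² ≤
3 c·c; then ρ + κ² ≤ 1 applies. -/
lemma IsIsotropic.integral_coord_sq_mul_dotProduct_mix_sq_le (hν : IsIsotropic ν ρ)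
    (hρ0 : 0 ≤ ρ) (hρ : ρ + κ ^ 2 ≤ 1) (c : Fin N → ℝ) (m : Fin N) :
    ∫ p, p.2 m ^ 2 * (c ⬝ᵥ mix κ p) ^ 2 ∂(ν.prod (stdNormal (Fin N))) ≤ 3 * (c ⬝ᵥ c) := by
  rw [hν.integral_weight_mul_dotProduct_mix_sq κ c (q := fun z => z m ^ 2)
    (by simpa using (PolyGrowth.apply m).pow 2), integral_coord_sq_mul_dotProduct_sq,
    integral_coord_sq_stdNormal]
  have h1 := dotProduct_self_nonneg' c
  have h2 : c m ^ 2 ≤ c ⬝ᵥ c := by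
    rw [sq]
    exact Finset.single_le_sum (f := fun i => c i * c i) (fun i _ => mul_self_nonneg _)
      (Finset.mem_univ m)
  nlinarith [mul_nonneg hρ0 h1, mul_le_mul_of_nonneg_left h2 (sq_nonneg κ)]

end Moments

/-! ### Smoothing a second derivative by a Gaussian component -/

/-- Nonnegative increasing weights together with a test function `h` with two bounded
derivatives `h₁`, `h₂`. -/
structure TestData {N : ℕ} (lam : Fin N → ℝ) (h h₁ h₂ : ℝ → ℝ) (H₁ H₂ : ℝ) : Prop where
  nonneg : ∀ j, 0 ≤ lam j
  mono : Monotone lam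
  deriv : ∀ x, HasDerivAt h (h₁ x) x
  deriv₂ : ∀ x, HasDerivAt h₁ (h₂ x) x
  continuous₂ : Continuous h₂
  bound₁ : ∀ x, |h₁ x| ≤ H₁
  bound₂ : ∀ x, |h₂ x| ≤ H₂

section Smoothing

variable {N : ℕ} {lam : Fin N → ℝ} {h h₁ h₂ : ℝ → ℝ} {H₁ H₂ : ℝ}

namespace TestData

lemma continuous₁ (T : TestData lam h h₁ h₂ H₁ H₂) : Continuous h₁ :=
  continuous_iff_continuousAt.2 fun x => (T.deriv₂ x).continuousAt

lemma continuous (T : TestData lam h h₁ h₂ H₁ H₂) : Continuous h :=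
  continuous_iff_continuousAt.2 fun x => (T.deriv x).continuousAt

lemma bound_nonneg (T : TestData lam h h₁ h₂ H₁ H₂) : 0 ≤ H₂ :=
  (abs_nonneg _).trans (T.bound₂ 0)

lemma abs_sub_le (T : TestData lam h h₁ h₂ H₁ H₂) (x y : ℝ) :
    |h₁ x - h₁ y| ≤ H₂ * |x - y| := by
  have := Convex.norm_image_sub_le_of_norm_hasDerivWithin_le (f := h₁) (f' := h₂)
    (s := Set.univ) (x := y) (y := x) (C := H₂) (fun t _ => (T.deriv₂ t).hasDerivWithinAt)
    (fun t _ => by simpa using T.bound₂ t) convex_univ (Set.mem_univ _) (Set.mem_univ _)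
  simpa using this

lemma polyGrowth₁ (T : TestData lam h h₁ h₂ H₁ H₂) {E : Type*} [NormedAddCommGroup E]
    {x : E → Fin N → ℝ} (hx : Continuous x) :
    PolyGrowth 0 (fun p => h₁ (wip lam (x p) (x p))) :=
  .of_bounded (T.continuous₁.comp (continuous_wip lam hx hx)) fun _ => T.bound₁ _

lemma polyGrowth₂ (T : TestData lam h h₁ h₂ H₁ H₂) {E : Type*} [NormedAddCommGroup E]
    {x : E → Fin N → ℝ} (hx : Continuous x) :
    PolyGrowth 0 (fun p => h₂ (wip lam (x p) (x p))) :=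
  .of_bounded (T.continuous₂.comp (continuous_wip lam hx hx)) fun _ => T.bound₂ _

end TestData

lemma mix_add_smul (κ t : ℝ) (p : (Fin N → ℝ) × (Fin N → ℝ)) (m : Fin N) :
    mix κ (p + t • ((0, Pi.single m 1) : (Fin N → ℝ) × (Fin N → ℝ)))
      = mix κ p + (κ * t) • (Pi.single m 1 : Fin N → ℝ) := by
  simp only [mix, Prod.fst_add, Prod.snd_add, Prod.smul_fst, Prod.smul_snd, smul_zero, add_zero,
    smul_add, smul_smul, add_assoc]

lemma polyGrowth_wip_mix (κ : ℝ) (a : Fin N → ℝ) :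
    PolyGrowth 1 (fun p => wip lam a (mix κ p)) :=
  (polyGrowth_dotProduct (lam * a)).comp_mix κ

lemma polyGrowth_snd (m : Fin N) :
    PolyGrowth 1 (fun p : (Fin N → ℝ) × (Fin N → ℝ) => p.2 m) :=
  (PolyGrowth.apply m).comp_snd

lemma hasDerivAt_wip_line (a x : Fin N → ℝ) (m : Fin N) (κ : ℝ) :
    HasDerivAt (fun t : ℝ => wip lam a (x + (κ * t) • Pi.single m 1)) (κ * (lam m * a m)) 0 := by
  simpa [wip_eq_dotProduct] using hasDerivAt_dotProduct_single (lam * a) x m κ 0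

lemma hasDerivAt_wip_self_line (x : Fin N → ℝ) (m : Fin N) (κ : ℝ) :
    HasDerivAt (fun t : ℝ => wip lam (x + (κ * t) • Pi.single m 1) (x + (κ * t) • Pi.single m 1))
      (2 * κ * (lam m * x m)) 0 := by
  have e : (fun t : ℝ => wip lam (x + (κ * t) • Pi.single m 1) (x + (κ * t) • Pi.single m 1))
      = fun t => wip lam x x + t * (2 * κ * (lam m * x m)) + t ^ 2 * (κ ^ 2 * lam m) := by
    ext t
    rw [wip_add_self, wip_smul_left, wip_smul_left, wip_smul_right, wip_single_right,
      wip_comm lam (Pi.single m 1) x, wip_single_right]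
    simp
    ring
  rw [e]
  have h1 := ((hasDerivAt_id (0 : ℝ)).mul_const (2 * κ * (lam m * x m))).const_add (wip lam x x)
  have h2 := ((hasDerivAt_id (0 : ℝ)).pow 2).mul_const (κ ^ 2 * lam m)
  refine (h1.add h2).congr_deriv ?_
  simp

variable {ν : Measure (Fin N → ℝ)} [IsProbabilityMeasure ν] {ρ κ : ℝ}

lemma IsIsotropic.integral_wip_trunc_sq_le (hν : IsIsotropic ν ρ) (hρ : ρ + κ ^ 2 ≤ 1)
    (hlam : ∀ j, 0 ≤ lam j) (hmono : Monotone lam) (a : Fin N → ℝ) (m : Fin N) {k : ℕ}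
    (hk : k ≤ m + 1) :
    ∫ p, wip lam (trunc k a) (mix κ p) ^ 2 ∂(ν.prod (stdNormal (Fin N)))
      ≤ (√(lam m) * wnorm lam a) ^ 2 := by
  rw [mul_pow, Real.sq_sqrt (hlam m), wnorm_sq hlam]
  exact (hν.integral_dotProduct_mix_sq_le hρ _).trans (dotProduct_trunc_le hlam hmono a m hk)

lemma IsIsotropic.integral_coord_mul_wip_trunc_sq_le (hν : IsIsotropic ν ρ) (hρ0 : 0 ≤ ρ)
    (hρ : ρ + κ ^ 2 ≤ 1) (hlam : ∀ j, 0 ≤ lam j) (hmono : Monotone lam) (a : Fin N → ℝ)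
    (m : Fin N) {k : ℕ} (hk : k ≤ m + 1) :
    ∫ p, (p.2 m * wip lam (trunc k a) (mix κ p)) ^ 2 ∂(ν.prod (stdNormal (Fin N)))
      ≤ (√3 * (√(lam m) * wnorm lam a)) ^ 2 := by
  rw [mul_pow, mul_pow, Real.sq_sqrt (hlam m), wnorm_sq hlam, Real.sq_sqrt (by norm_num)]
  simp only [mul_pow]
  refine (hν.integral_coord_sq_mul_dotProduct_mix_sq_le hρ0 hρ _ m).trans ?_
  exact mul_le_mul_of_nonneg_left (dotProduct_trunc_le hlam hmono a m hk) (by norm_num)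

lemma integral_snd_sq (m : Fin N) :
    ∫ p, p.2 m ^ 2 ∂(ν.prod (stdNormal (Fin N))) = 1 := by
  have := integral_prod_mul (μ := ν) (ν := stdNormal (Fin N)) (fun _ => (1 : ℝ))
    (fun z => z m ^ 2)
  simpa [integral_coord_sq_stdNormal] using this

lemma weight_mul_abs_le (hlam : ∀ j, 0 ≤ lam j) (a : Fin N → ℝ) (m : Fin N) :
    lam m * |a m| ≤ √(lam m) * wnorm lam a := by
  have h1 : √(lam m) * |a m| ≤ wnorm lam a := by
    refine Real.le_sqrt_of_sq_le ?_
    rw [mul_pow, Real.sq_sqrt (hlam m), sq_abs, sq, ← mul_assoc]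
    exact Finset.single_le_sum (f := fun j => lam j * a j * a j)
      (fun j _ => by rw [mul_assoc]; exact mul_nonneg (hlam j) (mul_self_nonneg _))
      (Finset.mem_univ m)
  calc lam m * |a m| = √(lam m) * (√(lam m) * |a m|) := by
        rw [← mul_assoc, Real.mul_self_sqrt (hlam m)]
    _ ≤ _ := mul_le_mul_of_nonneg_left h1 (Real.sqrt_nonneg _)

lemma sqrt_three_le : √3 ≤ (7 / 4 : ℝ) := Real.sqrt_le_iff.2 (by norm_num)

lemma IsIsotropic.integral_abs_wip_trunc_le (hν : IsIsotropic ν ρ) (hρ : ρ + κ ^ 2 ≤ 1)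
    (hlam : ∀ j, 0 ≤ lam j) (hmono : Monotone lam) (a : Fin N → ℝ) (m : Fin N) {k : ℕ}
    (hk : k ≤ m + 1) :
    ∫ p, |wip lam (trunc k a) (mix κ p)| ∂(ν.prod (stdNormal (Fin N)))
      ≤ √(lam m) * wnorm lam a := by
  have hm := hν.hasMoment_prod
  have hg := polyGrowth_wip_mix (lam := lam) κ (trunc k a)
  have h := integral_abs_mul_le (g := fun _ => (1 : ℝ)) (A := √(lam m) * wnorm lam a) (B := 1)
    ((hg.pow 2).integrable (hm.mono (by norm_num))) (integrable_const _)
    (((hg.mul (PolyGrowth.const (k := 0) 1)).abs).integrable (hm.mono (by norm_num)))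
    (by have := wnorm_nonneg (lam := lam) a; positivity) zero_le_one
    (hν.integral_wip_trunc_sq_le hρ hlam hmono a m hk) (by simp)
  simpa using h

lemma IsIsotropic.integral_abs_coord_mul_wip_trunc_le (hν : IsIsotropic ν ρ) (hρ : ρ + κ ^ 2 ≤ 1)
    (hlam : ∀ j, 0 ≤ lam j) (hmono : Monotone lam) (a : Fin N → ℝ) (m : Fin N) {k : ℕ}
    (hk : k ≤ m + 1) :
    ∫ p, |p.2 m * wip lam (trunc k a) (mix κ p)| ∂(ν.prod (stdNormal (Fin N)))
      ≤ √(lam m) * wnorm lam a := by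
  have hm := hν.hasMoment_prod
  have hg := polyGrowth_wip_mix (lam := lam) κ (trunc k a)
  have hz := polyGrowth_snd (N := N) m
  have h := integral_abs_mul_le (A := 1) (B := √(lam m) * wnorm lam a)
    ((hz.pow 2).integrable (hm.mono (by norm_num))) ((hg.pow 2).integrable (hm.mono (by norm_num)))
    ((hz.mul hg).abs.integrable (hm.mono (by norm_num))) zero_le_one
    (by have := wnorm_nonneg (lam := lam) a; positivity) (by simp [integral_snd_sq])
    (hν.integral_wip_trunc_sq_le hρ hlam hmono a m hk)
  simpa using h

/-- Cauchy–Schwarz with z_m attached to one factor: each truncated form contributes √(lam m), and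
the attached z_m costs √3 ≤ 7/4. -/
lemma IsIsotropic.integral_abs_wip_trunc_mul_le (hν : IsIsotropic ν ρ) (hρ0 : 0 ≤ ρ)
    (hρ : ρ + κ ^ 2 ≤ 1)
    (hlam : ∀ j, 0 ≤ lam j) (hmono : Monotone lam) (a b : Fin N → ℝ) (m : Fin N) {k l : ℕ}
    (hk : k ≤ m + 1) (hl : l ≤ m + 1) :
    ∫ p, |wip lam (trunc l b) (mix κ p) * (p.2 m * wip lam (trunc k a) (mix κ p))|
        ∂(ν.prod (stdNormal (Fin N)))
      ≤ 7 / 4 * (lam m * (wnorm lam a * wnorm lam b)) := by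
  have hm := hν.hasMoment_prod
  have hg := polyGrowth_wip_mix (lam := lam) κ (trunc k a)
  have hg' := polyGrowth_wip_mix (lam := lam) κ (trunc l b)
  have hz := polyGrowth_snd (N := N) m
  have ha := wnorm_nonneg (lam := lam) a
  have hb := wnorm_nonneg (lam := lam) b
  have h := integral_abs_mul_le (A := √(lam m) * wnorm lam b)
    (B := √3 * (√(lam m) * wnorm lam a))
    ((hg'.pow 2).integrable (hm.mono (by norm_num)))
    (((hz.mul hg).pow 2).integrable (hm.mono (by norm_num)))
    ((hg'.mul (hz.mul hg)).abs.integrable (hm.mono (by norm_num)))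
    (by positivity) (by positivity) (hν.integral_wip_trunc_sq_le hρ hlam hmono b m hl)
    (hν.integral_coord_mul_wip_trunc_sq_le hρ0 hρ hlam hmono a m hk)
  refine h.trans ?_
  have e : √(lam m) * wnorm lam b * (√3 * (√(lam m) * wnorm lam a))
      = √3 * (√(lam m) * √(lam m) * (wnorm lam a * wnorm lam b)) := by ring
  rw [e, Real.mul_self_sqrt (hlam m)]
  exact mul_le_mul_of_nonneg_right sqrt_three_le
    (mul_nonneg (hlam m) (mul_nonneg ha hb))

/-- Moving one coordinate of the argument of `h₂`, against the square of a linear form in the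
coordinates up to it. -/
lemma TestData.abs_integral_step_le (T : TestData lam h h₁ h₂ H₁ H₂) (hν : IsIsotropic ν ρ)
    (hρ0 : 0 ≤ ρ) (hκ0 : 0 ≤ κ) (hκ1 : κ ≤ 1) (hρ : ρ + κ ^ 2 ≤ 1) (a b c : Fin N → ℝ)
    (m : Fin N) :
    |κ * ∫ p, (h₂ (wip lam (mix κ p + (c + Pi.single m (b m))) (mix κ p + (c + Pi.single m (b m))))
          - h₂ (wip lam (mix κ p + c) (mix κ p + c)))
          * wip lam (trunc (m + 1) a) (mix κ p) ^ 2 ∂(ν.prod (stdNormal (Fin N)))|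
      ≤ H₂ * (15 / 4 * (wnorm lam a ^ 2 * (lam m * |b m|))) := by
  have hm := hν.hasMoment_prod
  set Q := ν.prod (stdNormal (Fin N)) with hQ
  set P : (Fin N → ℝ) × (Fin N → ℝ) → ℝ := fun p => wip lam (trunc (m + 1) a) (mix κ p) with hP
  have hPg : PolyGrowth 1 P := polyGrowth_wip_mix κ _
  have hz := polyGrowth_snd (N := N) m
  set u : (Fin N → ℝ) × (Fin N → ℝ) → ℝ → ℝ := fun p τ =>
    h₂ (wip lam (mix κ p + (c + τ • Pi.single m 1)) (mix κ p + (c + τ • Pi.single m 1))) with hu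
  have huc : Continuous (Function.uncurry u) := by
    refine T.continuous₂.comp (continuous_wip lam ?_ ?_) <;>
    · have := continuous_mix (N := N) κ
      fun_prop
  have hub : ∀ p τ, |u p τ| ≤ H₂ := fun p τ => T.bound₂ _
  -- An antiderivative in coordinate m. Moving z by t along the m-th axis translates τ by κ t, so
  -- the line derivative of g is κ times the increment of `h₂`; no derivative of `h₂` is needed, and
  -- g is at most H₂ |b m|.
  set g : (Fin N → ℝ) × (Fin N → ℝ) → ℝ := fun p => ∫ τ in (0 : ℝ)..(b m), u p τ with hg
  have hgb : ∀ p, |g p| ≤ H₂ * |b m| := fun p => by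
    have := intervalIntegral.norm_integral_le_of_norm_le_const (a := 0) (b := b m) (f := u p)
      (C := H₂) (fun τ _ => by simpa using hub p τ)
    simpa using this
  have hgg : PolyGrowth 0 g := .of_bounded
    (intervalIntegral.continuous_parametric_intervalIntegral_of_continuous huc continuous_const) hgb
  have hgd : ∀ p, HasLineDerivAt ℝ g (κ * (u p (b m) - u p 0)) p (0, Pi.single m 1) := by
    intro p
    have e : ∀ t : ℝ, g (p + t • ((0, Pi.single m 1) : (Fin N → ℝ) × (Fin N → ℝ)))
        = (∫ τ in (0 : ℝ)..(b m + κ * t), u p τ) - ∫ τ in (0 : ℝ)..(κ * t), u p τ := by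
      intro t
      have e1 : ∀ τ, u (p + t • ((0, Pi.single m 1) : (Fin N → ℝ) × (Fin N → ℝ))) τ
          = u p (τ + κ * t) := by
        intro τ
        have : mix κ (p + t • ((0, Pi.single m 1) : (Fin N → ℝ) × (Fin N → ℝ)))
            + (c + τ • (Pi.single m 1 : Fin N → ℝ))
            = mix κ p + (c + (τ + κ * t) • (Pi.single m 1 : Fin N → ℝ)) := by
          rw [mix_add_smul, add_smul]; abel
        simp only [hu, this]
      have hi : ∀ x y, IntervalIntegrable (u p) volume x y := fun x y =>
        (huc.comp (by fun_prop : Continuous fun τ : ℝ => (p, τ))).intervalIntegrable x y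
      simp only [hg, e1]
      rw [intervalIntegral.integral_comp_add_right (fun τ => u p τ), zero_add,
        intervalIntegral.integral_interval_sub_left (hi _ _) (hi _ _)]
    unfold HasLineDerivAt
    simp only [e]
    have hcu : Continuous (u p) := huc.comp (by fun_prop : Continuous fun τ : ℝ => (p, τ))
    have hF : ∀ x, HasDerivAt (fun x => ∫ τ in (0 : ℝ)..x, u p τ) (u p x) x := fun x =>
      intervalIntegral.integral_hasDerivAt_right (hcu.intervalIntegrable _ _)
        (hcu.stronglyMeasurableAtFilter _ _) hcu.continuousAt
    have h1 : HasDerivAt (fun t : ℝ => κ * t) κ 0 := by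
      simpa using (hasDerivAt_id (0 : ℝ)).const_mul κ
    have h2 : HasDerivAt (fun t : ℝ => b m + κ * t) κ 0 := h1.const_add _
    have h3 := HasDerivAt.comp (0 : ℝ) (h₂ := fun x => ∫ τ in (0 : ℝ)..x, u p τ) (hF _) h2
    have h4 := HasDerivAt.comp (0 : ℝ) (h₂ := fun x => ∫ τ in (0 : ℝ)..x, u p τ) (hF _) h1
    refine (h3.sub h4).congr_deriv ?_
    simp only [mul_zero, add_zero]
    ring
  have hPd : ∀ p, HasLineDerivAt ℝ P (κ * (lam m * a m)) p (0, Pi.single m 1) := by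
    intro p
    unfold HasLineDerivAt
    simp only [hP, mix_add_smul]
    simpa [trunc_succ_apply_self] using
      hasDerivAt_wip_line (lam := lam) (trunc (m + 1) a) (mix κ p) m κ
  have hub0 : PolyGrowth 0 (fun p => u p 0) := .of_bounded (by
    exact huc.comp (by fun_prop : Continuous fun p : (Fin N → ℝ) × (Fin N → ℝ) => (p, (0 : ℝ))))
    fun p => hub p 0
  have hub1 : PolyGrowth 0 (fun p => u p (b m)) := .of_bounded (by
    exact huc.comp (by fun_prop : Continuous fun p : (Fin N → ℝ) × (Fin N → ℝ) => (p, b m)))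
    fun p => hub p (b m)
  have hD := (hub1.sub hub0).mul (hPg.pow 2)
  have hE := (hgg.mul hPg).const_mul (2 * κ * (lam m * a m))
  -- Integrating z_m g P² by parts yields the wanted increment with its prefactor κ, plus a
  -- correction because P itself depends on coordinate m.
  have ibp := integral_coord_mul_prod_stdNormal hν.moment m (f := fun p => g p * P p ^ 2)
    (f' := fun p => κ * ((u p (b m) - u p 0) * P p ^ 2)
      + 2 * κ * (lam m * a m) * (g p * P p))
    ((hgg.mul (hPg.pow 2)).mono (by norm_num))
    (((hD.const_mul κ).mono (by norm_num)).add (hE.mono (by norm_num)))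
    (fun p => by
      have h1 := hgd p
      have h2 := hPd p
      unfold HasLineDerivAt at h1 h2 ⊢
      refine (h1.mul (h2.pow 2)).congr_deriv ?_
      simp only [zero_smul, add_zero, Pi.pow_apply]
      ring)
  rw [integral_add (hD.const_mul κ |>.integrable (hm.mono (by norm_num)))
    (hE.integrable (hm.mono (by norm_num))), integral_const_mul] at ibp
  have hmain : κ * ∫ p, (u p (b m) - u p 0) * P p ^ 2 ∂Q
      = ∫ p, (g p * (P p * (p.2 m * P p)) - 2 * κ * (lam m * a m) * (g p * P p)) ∂Q := by
    rw [integral_sub ((hgg.mul (hPg.mul (hz.mul hPg))).integrable (hm.mono (by norm_num)))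
      (hE.integrable (hm.mono (by norm_num)))]
    have : ∫ p, g p * (P p * (p.2 m * P p)) ∂Q = ∫ p, p.2 m * (g p * P p ^ 2) ∂Q := by
      congr 1; ext p; ring
    rw [this, ibp]; ring
  have e0 : ∀ p, (h₂ (wip lam (mix κ p + (c + Pi.single m (b m)))
      (mix κ p + (c + Pi.single m (b m)))) - h₂ (wip lam (mix κ p + c) (mix κ p + c)))
      = u p (b m) - u p 0 := by
    intro p
    have : b m • (Pi.single m 1 : Fin N → ℝ) = Pi.single m (b m) := by
      rw [← Pi.single_smul]; simp
    simp only [hu, this, zero_smul, add_zero]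
  simp only [e0]
  rw [hmain]
  have hA := wnorm_nonneg (lam := lam) a
  have hH := T.bound_nonneg
  have b1 := hν.integral_abs_wip_trunc_mul_le hρ0 hρ T.nonneg T.mono a a m (k := m + 1)
    (l := m + 1) le_rfl le_rfl
  have b2 := hν.integral_abs_wip_trunc_le hρ T.nonneg T.mono a m (k := m + 1) le_rfl
  have i1 := (hPg.mul (hz.mul hPg)).abs.integrable (hm.mono (by norm_num))
  have i2 := hPg.abs.integrable (hm.mono (by norm_num))
  calc |∫ p, (g p * (P p * (p.2 m * P p)) - 2 * κ * (lam m * a m) * (g p * P p)) ∂Q|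
      ≤ ∫ p, (H₂ * |b m| * |P p * (p.2 m * P p)|
          + 2 * (lam m * |a m|) * (H₂ * |b m|) * |P p|) ∂Q := by
        refine (abs_integral_le_integral_abs).trans
          (integral_mono_of_nonneg (.of_forall fun p => abs_nonneg _)
            ((i1.const_mul _).add (i2.const_mul _)) (.of_forall fun p => ?_))
        refine (abs_sub _ _).trans (add_le_add ?_ ?_)
        · rw [abs_mul]
          exact mul_le_mul_of_nonneg_right (hgb p) (abs_nonneg _)
        · rw [abs_mul, abs_mul (g p), abs_mul, abs_mul, abs_mul, abs_two, abs_of_nonneg hκ0,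
            abs_of_nonneg (T.nonneg m), ← mul_assoc]
          have := mul_nonneg (T.nonneg m) (abs_nonneg (a m))
          refine mul_le_mul_of_nonneg_right (mul_le_mul ?_ (hgb p) (abs_nonneg _) (by positivity))
            (abs_nonneg _)
          nlinarith
    _ = H₂ * |b m| * (∫ p, |P p * (p.2 m * P p)| ∂Q)
          + 2 * (lam m * |a m|) * (H₂ * |b m|) * ∫ p, |P p| ∂Q := by
        rw [integral_add (i1.const_mul _) (i2.const_mul _), integral_const_mul, integral_const_mul]
    _ ≤ H₂ * |b m| * (7 / 4 * (lam m * (wnorm lam a * wnorm lam a)))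
          + 2 * (√(lam m) * wnorm lam a) * (H₂ * |b m|) * (√(lam m) * wnorm lam a) := by
        have := weight_mul_abs_le T.nonneg a m
        have h0 := mul_nonneg (T.nonneg m) (abs_nonneg (a m))
        have h0' : 0 ≤ ∫ p, |P p| ∂Q := integral_nonneg fun _ => abs_nonneg _
        gcongr
    _ = H₂ * |b m| * (7 / 4 * (lam m * (wnorm lam a * wnorm lam a)))
          + 2 * (√(lam m) * √(lam m)) * (H₂ * |b m|) * (wnorm lam a * wnorm lam a) := by ring
    -- 15/4 = 7/4 + 2: the main term and the correction from differentiating P.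
    _ = H₂ * (15 / 4 * (wnorm lam a ^ 2 * (lam m * |b m|))) := by
        rw [Real.mul_self_sqrt (T.nonneg m)]; ring

end Smoothing

/-! ### Cross terms, Abel summation and the increment of the second derivative -/

section Smoothing

variable {N : ℕ} {lam : Fin N → ℝ} {h h₁ h₂ : ℝ → ℝ} {H₁ H₂ : ℝ}
  {ν : Measure (Fin N → ℝ)} [IsProbabilityMeasure ν] {ρ κ : ℝ}

/-- Moving the coordinates below `m` in the argument of `h₂`, against the part of the square of a
linear form whose largest index is `m`. -/
lemma TestData.abs_integral_cross_le (T : TestData lam h h₁ h₂ H₁ H₂) (hν : IsIsotropic ν ρ)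
    (hρ0 : 0 ≤ ρ) (hκ0 : 0 ≤ κ) (hκ1 : κ ≤ 1) (hρ : ρ + κ ^ 2 ≤ 1) (a b : Fin N → ℝ)
    (m : Fin N) :
    |κ * ∫ p, (h₂ (wip lam (mix κ p + trunc m b) (mix κ p + trunc m b))
          - h₂ (wip lam (mix κ p) (mix κ p)))
          * (wip lam (trunc (m + 1) a) (mix κ p) ^ 2 - wip lam (trunc m a) (mix κ p) ^ 2)
          ∂(ν.prod (stdNormal (Fin N)))|
      ≤ H₂ * (9 / 2 * (wnorm lam a * wnorm lam b * (lam m * |a m|))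
          + 3 / 2 * (wnorm lam a * wnorm lam b ^ 2 * (√(lam m) * |a m|))) := by
  have hm := hν.hasMoment_prod
  set Q := ν.prod (stdNormal (Fin N)) with hQ
  set c := trunc m b with hc
  set P : (Fin N → ℝ) × (Fin N → ℝ) → ℝ := fun p => wip lam (trunc m a) (mix κ p) with hP
  set P' : (Fin N → ℝ) × (Fin N → ℝ) → ℝ := fun p => wip lam (trunc (m + 1) a) (mix κ p) with hP'
  set q : (Fin N → ℝ) × (Fin N → ℝ) → ℝ := fun p => wip lam c (mix κ p) with hq
  have hPg : PolyGrowth 1 P := polyGrowth_wip_mix κ _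
  have hPg' : PolyGrowth 1 P' := polyGrowth_wip_mix κ _
  have hqg : PolyGrowth 1 q := polyGrowth_wip_mix κ _
  have hz := polyGrowth_snd (N := N) m
  have hx : PolyGrowth 1 (fun p => mix (N := N) κ p m) := (PolyGrowth.apply m).comp_mix κ
  set u : (Fin N → ℝ) × (Fin N → ℝ) → ℝ := fun p =>
    h₂ (wip lam (mix κ p + c) (mix κ p + c)) - h₂ (wip lam (mix κ p) (mix κ p)) with hu
  -- Since c has no m-th coordinate, the weighted squares of x and of x + c have the same derivative
  -- 2 κ lam_m x_m in the m-th Gaussian coordinate. Hence g differentiates to that factor times u.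
  set g : (Fin N → ℝ) × (Fin N → ℝ) → ℝ := fun p =>
    h₁ (wip lam (mix κ p + c) (mix κ p + c)) - h₁ (wip lam (mix κ p) (mix κ p)) with hg
  have hmc := continuous_mix (N := N) κ
  have hug : PolyGrowth 0 u := (T.polyGrowth₂ (by fun_prop)).sub (T.polyGrowth₂ hmc)
  have hgg : PolyGrowth 0 g := (T.polyGrowth₁ (by fun_prop)).sub (T.polyGrowth₁ hmc)
  have hH := T.bound_nonneg
  have hA := wnorm_nonneg (lam := lam) a
  have hB := wnorm_nonneg (lam := lam) b
  have hgb : ∀ p, |g p| ≤ H₂ * (2 * |q p| + wnorm lam b ^ 2) := by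
    intro p
    refine (T.abs_sub_le _ _).trans (mul_le_mul_of_nonneg_left ?_ hH)
    rw [wip_add_self]
    have h1 := wip_trunc_self_le T.nonneg m b
    have h2 := wip_self_nonneg T.nonneg (trunc m b)
    rw [wnorm_sq T.nonneg]
    have : wip lam (mix κ p) (mix κ p) + 2 * wip lam c (mix κ p) + wip lam c c
        - wip lam (mix κ p) (mix κ p) = 2 * q p + wip lam c c := by ring
    rw [this]
    refine (abs_add_le _ _).trans ?_
    rw [abs_mul, abs_two, abs_of_nonneg h2]
    linarith
  have hgd : ∀ p, HasLineDerivAt ℝ g (2 * κ * lam m * (mix κ p m * u p)) p (0, Pi.single m 1) := by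
    intro p
    unfold HasLineDerivAt
    have e1 := hasDerivAt_wip_self_line (lam := lam) (mix κ p + c) m κ
    have e2 := hasDerivAt_wip_self_line (lam := lam) (mix κ p) m κ
    have k1 := HasDerivAt.comp (0 : ℝ) (h₂ := h₁) (T.deriv₂ _) e1
    have k2 := HasDerivAt.comp (0 : ℝ) (h₂ := h₁) (T.deriv₂ _) e2
    have hsw : ∀ t : ℝ, mix κ p + (κ * t) • (Pi.single m 1 : Fin N → ℝ) + c
        = mix κ p + c + (κ * t) • (Pi.single m 1 : Fin N → ℝ) := fun t => by abel
    simp only [hg, mix_add_smul, hsw]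
    refine (k1.sub k2).congr_deriv ?_
    have hc0 : c m = 0 := trunc_apply_self m b
    simp only [mul_zero, zero_smul, add_zero, Pi.add_apply, hc0, hu]
    ring
  have hPd : ∀ p, HasLineDerivAt ℝ P 0 p (0, Pi.single m 1) := by
    intro p
    unfold HasLineDerivAt
    simp only [hP, mix_add_smul]
    simpa [trunc_apply_self] using hasDerivAt_wip_line (lam := lam) (trunc m a) (mix κ p) m κ
  have hPd' : ∀ p, HasLineDerivAt ℝ P' (κ * (lam m * a m)) p (0, Pi.single m 1) := by
    intro p
    unfold HasLineDerivAt
    simp only [hP', mix_add_smul]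
    simpa [trunc_succ_apply_self] using
      hasDerivAt_wip_line (lam := lam) (trunc (m + 1) a) (mix κ p) m κ
  have hD := (hx.mul hug).mul (hPg'.add hPg)
  have ibp := integral_coord_mul_prod_stdNormal hν.moment m (f := fun p => g p * (P' p + P p))
    (f' := fun p => 2 * κ * lam m * (mix κ p m * u p * (P' p + P p)) + κ * (lam m * a m) * g p)
    ((hgg.mul (hPg'.add hPg)).mono (by norm_num))
    (((hD.const_mul _).mono (by norm_num)).add ((hgg.const_mul _).mono (by norm_num)))
    (fun p => by
      have h1 := hgd p
      have h2 := hPd p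
      have h3 := hPd' p
      unfold HasLineDerivAt at h1 h2 h3 ⊢
      refine (h1.mul (h3.add h2)).congr_deriv ?_
      simp only [zero_smul, add_zero, Pi.add_apply]
      ring)
  have iD := hD.integrable (hm.mono (by norm_num))
  have ig := hgg.integrable (hm.mono (by norm_num))
  rw [integral_add (iD.const_mul _) (ig.const_mul _), integral_const_mul, integral_const_mul] at ibp
  have hmain : κ * ∫ p, u p * (P' p ^ 2 - P p ^ 2) ∂Q
      = a m / 2 * ∫ p, g p * (p.2 m * P' p + p.2 m * P p - κ * (lam m * a m)) ∂Q := by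
    -- Difference of squares: P' − P = lam_m a_m x_m contains precisely the factor lam_m x_m that
    -- makes u a derivative of g.
    have e1 : ∀ p, u p * (P' p ^ 2 - P p ^ 2)
        = (lam m * a m) * (mix κ p m * u p * (P' p + P p)) := by
      intro p
      have : P' p = P p + lam m * a m * mix κ p m := by
        simp only [hP', hP, trunc_succ, wip_add_left]
        rw [wip_comm lam (Pi.single m (a m)), wip_single_right]; ring
      rw [this]; ring
    have e2 : ∫ p, g p * (p.2 m * P' p + p.2 m * P p - κ * (lam m * a m)) ∂Q
        = ∫ p, p.2 m * (g p * (P' p + P p)) ∂Q - κ * (lam m * a m) * ∫ p, g p ∂Q := by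
      rw [← integral_const_mul, ← integral_sub
        ((hz.mul (hgg.mul (hPg'.add hPg))).integrable (hm.mono (by norm_num))) (ig.const_mul _)]
      congr 1; ext p; ring
    simp only [e1]
    rw [integral_const_mul, e2, ibp]
    ring
  have hstart : κ * ∫ p, (h₂ (wip lam (mix κ p + c) (mix κ p + c))
          - h₂ (wip lam (mix κ p) (mix κ p)))
          * (wip lam (trunc (m + 1) a) (mix κ p) ^ 2 - wip lam (trunc m a) (mix κ p) ^ 2) ∂Q
      = κ * ∫ p, u p * (P' p ^ 2 - P p ^ 2) ∂Q := rfl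
  rw [hstart, hmain]
  set V := √(lam m) * wnorm lam a with hV
  set W := √(lam m) * wnorm lam b with hW
  have hV0 : 0 ≤ V := by positivity
  have hW0 : 0 ≤ W := by positivity
  have b1 := hν.integral_abs_wip_trunc_mul_le hρ0 hρ T.nonneg T.mono a b m (k := m + 1)
    (l := m) le_rfl (Nat.le_succ _)
  have b2 := hν.integral_abs_wip_trunc_mul_le hρ0 hρ T.nonneg T.mono a b m (k := m)
    (l := m) (Nat.le_succ _) (Nat.le_succ _)
  have b3 := hν.integral_abs_wip_trunc_le hρ T.nonneg T.mono b m (k := m) (Nat.le_succ _)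
  have b4 := hν.integral_abs_coord_mul_wip_trunc_le hρ T.nonneg T.mono a m (k := m + 1) le_rfl
  have b5 := hν.integral_abs_coord_mul_wip_trunc_le hρ T.nonneg T.mono a m (k := m) (Nat.le_succ _)
  have hla := weight_mul_abs_le T.nonneg a m
  have hla0 := mul_nonneg (T.nonneg m) (abs_nonneg (a m))
  have i1 : Integrable (fun p => |q p * (p.2 m * P' p)|) Q :=
    (hqg.mul (hz.mul hPg')).abs.integrable (hm.mono (by norm_num))
  have i2 : Integrable (fun p => |q p * (p.2 m * P p)|) Q :=
    (hqg.mul (hz.mul hPg)).abs.integrable (hm.mono (by norm_num))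
  have i3 : Integrable (fun p => |q p|) Q := hqg.abs.integrable (hm.mono (by norm_num))
  have i4 : Integrable (fun p => |p.2 m * P' p|) Q :=
    (hz.mul hPg').abs.integrable (hm.mono (by norm_num))
  have i5 : Integrable (fun p => |p.2 m * P p|) Q :=
    (hz.mul hPg).abs.integrable (hm.mono (by norm_num))
  have i123 := ((i1.const_mul 2).add (i2.const_mul 2)).add (i3.const_mul (2 * V))
  have i45 := ((i4.add i5).add (integrable_const V)).const_mul (wnorm lam b ^ 2)
  have hbd : |∫ p, g p * (p.2 m * P' p + p.2 m * P p - κ * (lam m * a m)) ∂Q|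
      ≤ H₂ * (9 * (lam m * (wnorm lam a * wnorm lam b)) + 3 * V * wnorm lam b ^ 2) := by
    calc |∫ p, g p * (p.2 m * P' p + p.2 m * P p - κ * (lam m * a m)) ∂Q|
        ≤ ∫ p, H₂ * (2 * |q p * (p.2 m * P' p)| + 2 * |q p * (p.2 m * P p)| + 2 * V * |q p|
            + wnorm lam b ^ 2 * (|p.2 m * P' p| + |p.2 m * P p| + V)) ∂Q := by
          refine (abs_integral_le_integral_abs).trans
            (integral_mono_of_nonneg (.of_forall fun p => abs_nonneg _)
              ((i123.add i45).const_mul H₂) (.of_forall fun p => ?_))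
          have h1 : |p.2 m * P' p + p.2 m * P p - κ * (lam m * a m)|
              ≤ |p.2 m * P' p| + |p.2 m * P p| + V := by
            refine (abs_sub _ _).trans (add_le_add (abs_add_le _ _) ?_)
            rw [abs_mul, abs_mul, abs_of_nonneg hκ0, abs_of_nonneg (T.nonneg m)]
            nlinarith
          have h2 := mul_le_mul (hgb p) h1 (abs_nonneg _)
            (mul_nonneg hH (by positivity))
          show |g p * _| ≤ _
          rw [abs_mul]
          refine h2.trans (le_of_eq ?_)
          simp only [abs_mul (q p)]
          ring
      _ = H₂ * (2 * (∫ p, |q p * (p.2 m * P' p)| ∂Q) + 2 * (∫ p, |q p * (p.2 m * P p)| ∂Q)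
            + 2 * V * (∫ p, |q p| ∂Q) + wnorm lam b ^ 2 * ((∫ p, |p.2 m * P' p| ∂Q)
            + (∫ p, |p.2 m * P p| ∂Q) + V)) := by
          have e1 := integral_add_three (i1.const_mul 2) (i2.const_mul 2) (i3.const_mul (2 * V))
          have e2 := integral_add_three i4 i5 (integrable_const V)
          have e3 := integral_add i123 i45
          simp only [Pi.add_apply] at e3
          rw [integral_const_mul, e3, e1, integral_const_mul, integral_const_mul,
            integral_const_mul, integral_const_mul, e2, integral_const]
          simp
      _ ≤ H₂ * (2 * (7 / 4 * (lam m * (wnorm lam a * wnorm lam b)))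
            + 2 * (7 / 4 * (lam m * (wnorm lam a * wnorm lam b)))
            + 2 * V * W + wnorm lam b ^ 2 * (V + V + V)) := by
          gcongr
      -- 7 = 2 · 7/4 + 2 · 7/4. The product 2 V W adds another 2 lam m, which gives 9; the factor a
      -- m / 2 in front later halves it.
      _ = H₂ * (7 * (lam m * (wnorm lam a * wnorm lam b))
            + 2 * (√(lam m) * √(lam m) * (wnorm lam a * wnorm lam b))
            + 3 * V * wnorm lam b ^ 2) := by
          simp only [hV, hW]; ring
      _ = _ := by rw [Real.mul_self_sqrt (T.nonneg m)]; ring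
  rw [abs_mul, abs_div, abs_two]
  refine (mul_le_mul_of_nonneg_left hbd (by positivity)).trans (le_of_eq ?_)
  simp only [hV]; ring

/-- Abel summation. -/
lemma abel_sum (U R : ℕ → ℝ) (hR : R 0 = 0) (N : ℕ) :
    (U N - U 0) * R N = ∑ m : Fin N, ((U (m + 1) - U m) * R (m + 1)
      + (U m - U 0) * (R (m + 1) - R m)) := by
  rw [Fin.sum_univ_eq_sum_range
    (fun m => (U (m + 1) - U m) * R (m + 1) + (U m - U 0) * (R (m + 1) - R m)) N]
  have : ∀ m, (U (m + 1) - U m) * R (m + 1) + (U m - U 0) * (R (m + 1) - R m)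
      = (U (m + 1) - U 0) * R (m + 1) - (U m - U 0) * R m := fun m => by ring
  simp only [this]
  rw [Finset.sum_range_sub (fun m => (U m - U 0) * R m)]
  simp [hR]

/-- The effect of a shift on `h₂`, against the square of a linear form. -/
lemma TestData.abs_integral_shift_le (T : TestData lam h h₁ h₂ H₁ H₂) (hν : IsIsotropic ν ρ)
    (hρ0 : 0 ≤ ρ) (hκ0 : 0 ≤ κ) (hκ1 : κ ≤ 1) (hρ : ρ + κ ^ 2 ≤ 1) (a b : Fin N → ℝ) :
    |κ * ∫ p, (h₂ (wip lam (mix κ p + b) (mix κ p + b)) - h₂ (wip lam (mix κ p) (mix κ p)))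
          * wip lam a (mix κ p) ^ 2 ∂(ν.prod (stdNormal (Fin N)))|
      ≤ H₂ * (9 * (wnorm lam a ^ 2 * wnorm lam b * √(∑ j, lam j))
          + 3 / 2 * (√N * (wnorm lam a ^ 2 * wnorm lam b ^ 2))) := by
  have hm := hν.hasMoment_prod
  set Q := ν.prod (stdNormal (Fin N)) with hQ
  have hmc := continuous_mix (N := N) κ
  set U : ℕ → (Fin N → ℝ) × (Fin N → ℝ) → ℝ := fun k p =>
    h₂ (wip lam (mix κ p + trunc k b) (mix κ p + trunc k b)) with hU
  set R : ℕ → (Fin N → ℝ) × (Fin N → ℝ) → ℝ := fun k p =>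
    wip lam (trunc k a) (mix κ p) ^ 2 with hR
  have hUg : ∀ k, PolyGrowth 0 (U k) := fun k => T.polyGrowth₂ (by fun_prop)
  have hRg : ∀ k, PolyGrowth 2 (R k) := fun k => by
    simpa using (polyGrowth_wip_mix (lam := lam) κ (trunc k a)).pow 2
  have hU0 : ∀ p, U 0 p = h₂ (wip lam (mix κ p) (mix κ p)) := fun p => by
    simp only [hU, trunc_zero, add_zero]
  -- In the first product coordinate m of the shift moves against the form truncated after m; in the
  -- second the coordinates below m have moved and the square of the form gains index m.
  have hstep : ∀ p, (h₂ (wip lam (mix κ p + b) (mix κ p + b)) - h₂ (wip lam (mix κ p) (mix κ p)))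
      * wip lam a (mix κ p) ^ 2 = ∑ m : Fin N, ((U (m + 1) p - U m p) * R (m + 1) p
        + (U m p - U 0 p) * (R (m + 1) p - R m p)) := by
    intro p
    have := abel_sum (fun k => U k p) (fun k => R k p)
      (by simp only [hR, trunc_zero, wip_zero_left]; norm_num) N
    rw [← this, hU0]
    simp only [hU, hR, trunc_self]
  have i1 : ∀ m : Fin N, Integrable (fun p => (U (m + 1) p - U m p) * R (m + 1) p) Q := fun m =>
    (((hUg _).sub (hUg _)).mul (hRg _)).integrable (hm.mono (by norm_num))
  have i2 : ∀ m : Fin N, Integrable (fun p => (U m p - U 0 p) * (R (m + 1) p - R m p)) Q :=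
    fun m => (((hUg _).sub (hUg _)).mul ((hRg _).sub (hRg _))).integrable (hm.mono (by norm_num))
  have i12 : ∀ m : Fin N, Integrable (fun p => (U (m + 1) p - U m p) * R (m + 1) p
      + (U m p - U 0 p) * (R (m + 1) p - R m p)) Q := fun m => (i1 m).add (i2 m)
  simp only [hstep]
  rw [integral_finsetSum _ fun m _ => i12 m, Finset.mul_sum]
  have hH := T.bound_nonneg
  have hA := wnorm_nonneg (lam := lam) a
  have hB := wnorm_nonneg (lam := lam) b
  calc |∑ m : Fin N, κ * ∫ p, ((U (m + 1) p - U m p) * R (m + 1) p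
        + (U m p - U 0 p) * (R (m + 1) p - R m p)) ∂Q|
      ≤ ∑ m : Fin N, (H₂ * (15 / 4 * (wnorm lam a ^ 2 * (lam m * |b m|)))
          + H₂ * (9 / 2 * (wnorm lam a * wnorm lam b * (lam m * |a m|))
          + 3 / 2 * (wnorm lam a * wnorm lam b ^ 2 * (√(lam m) * |a m|)))) := by
        refine (Finset.abs_sum_le_sum_abs _ _).trans (Finset.sum_le_sum fun m _ => ?_)
        rw [integral_add (i1 m) (i2 m), mul_add]
        refine (abs_add_le _ _).trans (add_le_add ?_ ?_)
        · have := T.abs_integral_step_le hν hρ0 hκ0 hκ1 hρ a b (trunc m b) m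
          rw [← trunc_succ] at this
          exact this
        · have := T.abs_integral_cross_le hν hρ0 hκ0 hκ1 hρ a b m
          simp only [hU0]
          exact this
    _ = H₂ * (15 / 4 * (wnorm lam a ^ 2 * ∑ m, lam m * |b m|)
          + 9 / 2 * (wnorm lam a * wnorm lam b * ∑ m, lam m * |a m|)
          + 3 / 2 * (wnorm lam a * wnorm lam b ^ 2 * ∑ m, √(lam m) * |a m|)) := by
        simp only [Finset.mul_sum, ← Finset.sum_add_distrib]
        exact Finset.sum_congr rfl fun m _ => by ring
    _ ≤ H₂ * (15 / 4 * (wnorm lam a ^ 2 * (√(∑ j, lam j) * wnorm lam b))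
          + 9 / 2 * (wnorm lam a * wnorm lam b * (√(∑ j, lam j) * wnorm lam a))
          + 3 / 2 * (wnorm lam a * wnorm lam b ^ 2 * (√N * wnorm lam a))) := by
        have h1 := sum_weight_mul_abs_le T.nonneg a
        have h2 := sum_weight_mul_abs_le T.nonneg b
        have h3 := sum_sqrt_weight_mul_abs_le T.nonneg a
        gcongr
    -- 15/4 + 9/2 = 33/4 is rounded up to 9.
    _ ≤ _ := by
        refine mul_le_mul_of_nonneg_left ?_ hH
        have : 0 ≤ wnorm lam a ^ 2 * wnorm lam b * √(∑ j, lam j) := by positivity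
        nlinarith

/-- The second derivative of `x ↦ h (∑ lam_j x_j²)` in the direction `a`. -/
def secondDer (lam : Fin N → ℝ) (h₁ h₂ : ℝ → ℝ) (a x : Fin N → ℝ) : ℝ :=
  4 * (h₂ (wip lam x x) * wip lam a x ^ 2) + 2 * wip lam a a * h₁ (wip lam x x)

lemma IsIsotropic.integral_abs_wip_le (hν : IsIsotropic ν ρ) (hρ : ρ + κ ^ 2 ≤ 1)
    (hlam : ∀ j, 0 ≤ lam j) (a : Fin N → ℝ) :
    ∫ p, |wip lam a (mix κ p)| ∂(ν.prod (stdNormal (Fin N))) ≤ √(∑ j, lam j) * wnorm lam a := by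
  have hm := hν.hasMoment_prod
  have hg := polyGrowth_wip_mix (lam := lam) κ a
  have ha := wnorm_nonneg (lam := lam) a
  have h := integral_abs_mul_le (g := fun _ => (1 : ℝ)) (A := √(∑ j, lam j) * wnorm lam a) (B := 1)
    ((hg.pow 2).integrable (hm.mono (by norm_num))) (integrable_const _)
    (((hg.mul (PolyGrowth.const (k := 0) 1)).abs).integrable (hm.mono (by norm_num)))
    (by positivity) zero_le_one
    (by
      rw [mul_pow, Real.sq_sqrt (Finset.sum_nonneg fun j _ => hlam j), wnorm_sq hlam]
      exact (hν.integral_dotProduct_mix_sq_le hρ _).trans (dotProduct_weight_le hlam a))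
    (by simp)
  simpa using h

lemma TestData.polyGrowth_secondDer (T : TestData lam h h₁ h₂ H₁ H₂) (a : Fin N → ℝ) :
    PolyGrowth 2 (secondDer lam h₁ h₂ a) := by
  have h1 : PolyGrowth 1 (fun x => wip lam a x) := polyGrowth_dotProduct (lam * a)
  have h2 := ((T.polyGrowth₂ continuous_id).mul (h1.pow 2)).const_mul 4
  have h3 := (T.polyGrowth₁ continuous_id).const_mul (2 * wip lam a a)
  exact (h2.mono (by norm_num)).add (h3.mono (by norm_num))

/-- Only the increment of `h₂` against the square of the linear form (S below) needs Gaussian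
smoothing. In the remainder V the linear form changes by the constant `wip lam a b` and `h₁` is
Lipschitz, so pointwise bounds suffice. The constant 48 is 4 · 9 from S plus 12 from V, and 6 √N is
4 · (3/2) √N. -/
lemma TestData.abs_integral_secondDer_sub_le (T : TestData lam h h₁ h₂ H₁ H₂)
    (hν : IsIsotropic ν ρ) (hρ0 : 0 ≤ ρ) (hκ0 : 0 ≤ κ) (hκ1 : κ ≤ 1) (hρ : ρ + κ ^ 2 ≤ 1)
    (a b : Fin N → ℝ) :
    |κ * ∫ p, (secondDer lam h₁ h₂ a (mix κ p + b) - secondDer lam h₁ h₂ a (mix κ p))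
        ∂(ν.prod (stdNormal (Fin N)))|
      ≤ H₂ * (48 * (wnorm lam a ^ 2 * wnorm lam b * √(∑ j, lam j))
          + (6 * √N + 6) * (wnorm lam a ^ 2 * wnorm lam b ^ 2)) := by
  have hm := hν.hasMoment_prod
  set Q := ν.prod (stdNormal (Fin N)) with hQ
  have hmc := continuous_mix (N := N) κ
  set S : (Fin N → ℝ) × (Fin N → ℝ) → ℝ := fun p =>
    (h₂ (wip lam (mix κ p + b) (mix κ p + b)) - h₂ (wip lam (mix κ p) (mix κ p)))
          * wip lam a (mix κ p) ^ 2 with hS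
  set V : (Fin N → ℝ) × (Fin N → ℝ) → ℝ := fun p =>
    4 * (h₂ (wip lam (mix κ p + b) (mix κ p + b))
      * (wip lam a b * (2 * wip lam a (mix κ p) + wip lam a b)))
    + 2 * wip lam a a * (h₁ (wip lam (mix κ p + b) (mix κ p + b))
      - h₁ (wip lam (mix κ p) (mix κ p)))
    with hV
  have e : ∀ p, secondDer lam h₁ h₂ a (mix κ p + b) - secondDer lam h₁ h₂ a (mix κ p)
      = 4 * S p + V p := by
    intro p
    simp only [secondDer, hS, hV, wip_add_right lam a (mix κ p) b]
    ring
  have hH := T.bound_nonneg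
  have hA := wnorm_nonneg (lam := lam) a
  have hB := wnorm_nonneg (lam := lam) b
  have ga := polyGrowth_wip_mix (lam := lam) κ a
  have gb := polyGrowth_wip_mix (lam := lam) κ b
  have g2 : PolyGrowth 0 (fun p => h₂ (wip lam (mix κ p + b) (mix κ p + b))) :=
    T.polyGrowth₂ (by fun_prop)
  have g1 : PolyGrowth 0 (fun p => h₁ (wip lam (mix κ p + b) (mix κ p + b))) :=
    T.polyGrowth₁ (by fun_prop)
  have iS : Integrable S Q :=
    ((g2.sub (T.polyGrowth₂ hmc)).mul (ga.pow 2)).integrable (hm.mono (by norm_num))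
  have gV : PolyGrowth 1 V := by
    have k1 := (g2.mul (((ga.const_mul 2).add (PolyGrowth.const (wip lam a b))).const_mul
      (wip lam a b))).const_mul 4
    have k2 := ((g1.sub (T.polyGrowth₁ hmc)).const_mul (2 * wip lam a a)).mono
      (l := 0 + 1) (by norm_num)
    simpa using k1.add k2
  have iV : Integrable V Q := gV.integrable (hm.mono (by norm_num))
  have ia := ga.abs.integrable (hm.mono (k := 1) (by norm_num))
  have ib := gb.abs.integrable (hm.mono (k := 1) (by norm_num))
  simp only [e]
  rw [integral_add (iS.const_mul 4) iV, integral_const_mul, mul_add]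
  have hSb := T.abs_integral_shift_le hν hρ0 hκ0 hκ1 hρ a b
  set σ := √(∑ j, lam j) with hσ
  have hab := abs_wip_le T.nonneg a b
  have hVb : |∫ p, V p ∂Q| ≤ H₂ * (12 * (wnorm lam a ^ 2 * wnorm lam b * σ)
      + 6 * (wnorm lam a ^ 2 * wnorm lam b ^ 2)) := by
    calc |∫ p, V p ∂Q| ≤ ∫ p, (H₂ * (8 * (wnorm lam a * wnorm lam b)) * |wip lam a (mix κ p)|
          + H₂ * (4 * wnorm lam a ^ 2) * |wip lam b (mix κ p)|
          + H₂ * (6 * (wnorm lam a ^ 2 * wnorm lam b ^ 2))) ∂Q := by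
          refine (abs_integral_le_integral_abs).trans
            (integral_mono_of_nonneg (.of_forall fun p => abs_nonneg _)
              (((ia.const_mul _).add (ib.const_mul _)).add (integrable_const _))
              (.of_forall fun p => ?_))
          have k1 : |h₂ (wip lam (mix κ p + b) (mix κ p + b))
              * (wip lam a b * (2 * wip lam a (mix κ p) + wip lam a b))|
              ≤ H₂ * ((wnorm lam a * wnorm lam b)
                * (2 * |wip lam a (mix κ p)| + wnorm lam a * wnorm lam b)) := by
            rw [abs_mul, abs_mul]
            have : |2 * wip lam a (mix κ p) + wip lam a b|
                ≤ 2 * |wip lam a (mix κ p)| + wnorm lam a * wnorm lam b := by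
              refine (abs_add_le _ _).trans (add_le_add (le_of_eq ?_) hab)
              rw [abs_mul, abs_two]
            gcongr
            exact T.bound₂ _
          have k2 : |h₁ (wip lam (mix κ p + b) (mix κ p + b)) - h₁ (wip lam (mix κ p) (mix κ p))|
              ≤ H₂ * (2 * |wip lam b (mix κ p)| + wnorm lam b ^ 2) := by
            refine (T.abs_sub_le _ _).trans (mul_le_mul_of_nonneg_left ?_ hH)
            rw [wip_add_self, wnorm_sq T.nonneg]
            have : wip lam (mix κ p) (mix κ p) + 2 * wip lam b (mix κ p) + wip lam b b
                - wip lam (mix κ p) (mix κ p) = 2 * wip lam b (mix κ p) + wip lam b b := by ring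
            rw [this]
            refine (abs_add_le _ _).trans ?_
            rw [abs_mul, abs_two, abs_of_nonneg (wip_self_nonneg T.nonneg b)]
          show |V p| ≤ _
          refine (abs_add_le _ _).trans ?_
          rw [abs_mul, abs_mul (2 * wip lam a a), abs_mul 2, abs_two,
            abs_of_nonneg (wip_self_nonneg T.nonneg a), ← wnorm_sq T.nonneg a,
            abs_of_nonneg (by norm_num : (0 : ℝ) ≤ 4)]
          have k3 := mul_le_mul_of_nonneg_left k2 (by positivity : 0 ≤ 2 * wnorm lam a ^ 2)
          simp only
          linarith
      _ = H₂ * (8 * (wnorm lam a * wnorm lam b)) * (∫ p, |wip lam a (mix κ p)| ∂Q)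
          + H₂ * (4 * wnorm lam a ^ 2) * (∫ p, |wip lam b (mix κ p)| ∂Q)
          + H₂ * (6 * (wnorm lam a ^ 2 * wnorm lam b ^ 2)) := by
          rw [integral_add_three (ia.const_mul _) (ib.const_mul _) (integrable_const _),
            integral_const_mul, integral_const_mul, integral_const]
          simp
      _ ≤ H₂ * (8 * (wnorm lam a * wnorm lam b)) * (σ * wnorm lam a)
          + H₂ * (4 * wnorm lam a ^ 2) * (σ * wnorm lam b)
          + H₂ * (6 * (wnorm lam a ^ 2 * wnorm lam b ^ 2)) := by
          have h1 := hν.integral_abs_wip_le hρ T.nonneg a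
          have h2 := hν.integral_abs_wip_le hρ T.nonneg b
          gcongr
      _ = _ := by ring
  have hκV : |κ * ∫ p, V p ∂Q| ≤ |∫ p, V p ∂Q| := by
    rw [abs_mul, abs_of_nonneg hκ0]
    nlinarith [abs_nonneg (∫ p, V p ∂Q)]
  have hκS : |κ * (4 * ∫ p, S p ∂Q)| ≤ 4 * (H₂ * (9 * (wnorm lam a ^ 2 * wnorm lam b * σ)
          + 3 / 2 * (√N * (wnorm lam a ^ 2 * wnorm lam b ^ 2)))) := by
    have : κ * (4 * ∫ p, S p ∂Q) = 4 * (κ * ∫ p, S p ∂Q) := by ring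
    rw [this, abs_mul, abs_of_nonneg (by norm_num : (0 : ℝ) ≤ 4)]
    exact mul_le_mul_of_nonneg_left hSb (by norm_num)
  refine (abs_add_le _ _).trans ((add_le_add hκS (hκV.trans hVb)).trans (le_of_eq ?_))
  ring

end Smoothing

/-! ### Taylor expansion in one summand -/

section Taylor

variable {N : ℕ} {lam : Fin N → ℝ} {h h₁ h₂ : ℝ → ℝ} {H₁ H₂ : ℝ}
  {ν : Measure (Fin N → ℝ)} [IsProbabilityMeasure ν] {ρ κ : ℝ}

/-- The derivative of `x ↦ h (∑ lam_j x_j²)` in the direction `a`. -/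
def firstDer (lam : Fin N → ℝ) (h₁ : ℝ → ℝ) (a x : Fin N → ℝ) : ℝ :=
  2 * (wip lam a x * h₁ (wip lam x x))

/-- The Laplacian of `x ↦ h (∑ lam_j x_j²)`. -/
def lapl (lam : Fin N → ℝ) (h₁ h₂ : ℝ → ℝ) (x : Fin N → ℝ) : ℝ :=
  ∑ m, secondDer lam h₁ h₂ (Pi.single m 1) x

lemma wip_single_single (m : Fin N) : wip lam (Pi.single m 1) (Pi.single m 1) = lam m := by
  rw [wip_single_right]; simp

lemma lapl_eq (x : Fin N → ℝ) : lapl lam h₁ h₂ x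
    = 4 * (h₂ (wip lam x x) * ((lam * x) ⬝ᵥ (lam * x))) + 2 * (∑ j, lam j) * h₁ (wip lam x x) := by
  have e : ∀ m, wip lam (Pi.single m 1) x = lam m * x m := fun m => by
    rw [wip_comm, wip_single_right, mul_one]
  simp only [lapl, secondDer, wip_single_single, e, Finset.sum_add_distrib, dotProduct,
    Pi.mul_apply, Finset.mul_sum, Finset.sum_mul]
  congr 1
  exact Finset.sum_congr rfl fun m _ => by ring

lemma hasDerivAt_wip_add_smul (a x y : Fin N → ℝ) (t : ℝ) :
    HasDerivAt (fun t : ℝ => wip lam a (x + t • y)) (wip lam a y) t := by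
  have e : (fun t : ℝ => wip lam a (x + t • y)) = fun t => wip lam a x + t * wip lam a y := by
    ext t; rw [wip_add_right, wip_smul_right]
  rw [e]
  simpa using ((hasDerivAt_id t).mul_const (wip lam a y)).const_add (wip lam a x)

lemma hasDerivAt_wip_self_add_smul (x y : Fin N → ℝ) (t : ℝ) :
    HasDerivAt (fun t : ℝ => wip lam (x + t • y) (x + t • y)) (2 * wip lam y (x + t • y)) t := by
  have e : (fun t : ℝ => wip lam (x + t • y) (x + t • y))
      = fun t => wip lam x x + t * (2 * wip lam y x) + t ^ 2 * wip lam y y := by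
    ext t; rw [wip_add_self, wip_smul_left, wip_smul_left, wip_smul_right]; ring
  rw [e, wip_add_right, wip_smul_right]
  have h1 := ((hasDerivAt_id t).mul_const (2 * wip lam y x)).const_add (wip lam x x)
  have h2 := ((hasDerivAt_id t).pow 2).mul_const (wip lam y y)
  refine (h1.add h2).congr_deriv ?_
  simp
  ring

lemma TestData.hasDerivAt_firstDer (T : TestData lam h h₁ h₂ H₁ H₂) (x y : Fin N → ℝ) (t : ℝ) :
    HasDerivAt (fun t : ℝ => firstDer lam h₁ y (x + t • y)) (secondDer lam h₁ h₂ y (x + t • y))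
      t := by
  have h1 := hasDerivAt_wip_add_smul (lam := lam) y x y t
  have h2 := HasDerivAt.comp t (h₂ := h₁) (T.deriv₂ _)
    (hasDerivAt_wip_self_add_smul (lam := lam) x y t)
  refine ((h1.mul h2).const_mul 2).congr_deriv ?_
  simp only [secondDer, Function.comp]
  ring

lemma polyGrowth_wip {E : Type*} [NormedAddCommGroup E] {a b : E → Fin N → ℝ} {k l : ℕ}
    (ha : ∀ j, PolyGrowth k (fun p => a p j)) (hb : ∀ j, PolyGrowth l (fun p => b p j)) :
    PolyGrowth (k + l) (fun p => wip lam (a p) (b p)) :=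
  PolyGrowth.sum _ fun j _ => ((ha j).const_mul (lam j)).mul (hb j)

lemma TestData.polyGrowth_firstDer (T : TestData lam h h₁ h₂ H₁ H₂) {E : Type*}
    [NormedAddCommGroup E] {a x : E → Fin N → ℝ} (ha : ∀ j, PolyGrowth 1 (fun p => a p j))
    (hx : ∀ j, PolyGrowth 1 (fun p => x p j)) :
    PolyGrowth 2 (fun p => firstDer lam h₁ (a p) (x p)) := by
  have hc : Continuous x := continuous_pi fun j => (hx j).continuous
  exact ((polyGrowth_wip ha hx).mul (T.polyGrowth₁ hc)).const_mul 2

lemma TestData.polyGrowth_secondDer' (T : TestData lam h h₁ h₂ H₁ H₂) {E : Type*}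
    [NormedAddCommGroup E] {a x : E → Fin N → ℝ} (ha : ∀ j, PolyGrowth 1 (fun p => a p j))
    (hx : ∀ j, PolyGrowth 1 (fun p => x p j)) :
    PolyGrowth 4 (fun p => secondDer lam h₁ h₂ (a p) (x p)) := by
  have hc : Continuous x := continuous_pi fun j => (hx j).continuous
  have h1 := ((T.polyGrowth₂ hc).mul ((polyGrowth_wip (lam := lam) ha hx).pow 2)).const_mul 4
  have h2 := ((polyGrowth_wip (lam := lam) ha ha).const_mul 2).mul (T.polyGrowth₁ hc)
  exact (h1.mono (by norm_num)).add (h2.mono (by norm_num))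

lemma TestData.polyGrowth_lapl (T : TestData lam h h₁ h₂ H₁ H₂) :
    PolyGrowth 2 (lapl lam h₁ h₂) :=
  PolyGrowth.sum _ fun m _ => T.polyGrowth_secondDer (Pi.single m 1)

lemma PolyGrowth.comp_mix_add {k : ℕ} {f : (Fin N → ℝ) → ℝ} (hf : PolyGrowth k f) (κ : ℝ)
    (b : Fin N → ℝ) : PolyGrowth k (fun p => f (mix κ p + b)) := by
  have hmc := continuous_mix (N := N) κ
  refine hf.comp (by fun_prop) (A := (1 + |κ|) + ‖b‖) fun p => (norm_add_le _ _).trans ?_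
  have := norm_mix_le κ p
  nlinarith [norm_nonneg p, norm_nonneg b, mul_nonneg (norm_nonneg b) (norm_nonneg p)]

lemma TestData.hasDerivAt_integral_firstDer (T : TestData lam h h₁ h₂ H₁ H₂)
    (hν : IsIsotropic ν ρ) (y : Fin N → ℝ) (t₀ : ℝ) :
    HasDerivAt (fun t : ℝ => ∫ p, firstDer lam h₁ y (mix κ p + t • y)
        ∂(ν.prod (stdNormal (Fin N))))
      (∫ p, secondDer lam h₁ h₂ y (mix κ p + t₀ • y) ∂(ν.prod (stdNormal (Fin N)))) t₀ := by
  have hm := hν.hasMoment_prod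
  have hmc := continuous_mix (N := N) κ
  have gf : PolyGrowth 2 (firstDer lam h₁ y) :=
    T.polyGrowth_firstDer (a := fun _ => y) (x := fun x => x) (fun j => PolyGrowth.const (y j))
      PolyGrowth.apply
  have gy := polyGrowth_wip_mix (lam := lam) κ y
  have gb : PolyGrowth 2 (fun p : (Fin N → ℝ) × (Fin N → ℝ) =>
      4 * (H₂ * (|wip lam y (mix κ p)| + (|t₀| + 1) * wip lam y y) ^ 2)
        + 2 * wip lam y y * H₁) := by
    have k1 := gy.abs.add (PolyGrowth.const ((|t₀| + 1) * wip lam y y))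
    simpa using (((k1.pow 2).const_mul H₂).const_mul 4).add
      (PolyGrowth.const (2 * wip lam y y * H₁))
  have hyy := wip_self_nonneg T.nonneg y
  have hH := T.bound_nonneg
  -- On the unit ball around t₀ one has |t| ≤ |t₀| + 1, which gives a dominating function of
  -- quadratic growth.
  refine (hasDerivAt_integral_of_dominated_loc_of_deriv_le
    (F := fun t p => firstDer lam h₁ y (mix κ p + t • y))
    (F' := fun t p => secondDer lam h₁ h₂ y (mix κ p + t • y)) (Metric.ball_mem_nhds t₀ one_pos)
    (.of_forall fun t => (gf.comp_mix_add κ (t • y)).continuous.aestronglyMeasurable)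
    ((gf.comp_mix_add κ _).integrable (hm.mono (by norm_num)))
    ((T.polyGrowth_secondDer y).comp_mix_add κ _).continuous.aestronglyMeasurable
    (.of_forall fun p t ht => ?_) (gb.integrable (hm.mono (by norm_num)))
    (.of_forall fun p t _ => T.hasDerivAt_firstDer _ y t)).2
  have ht' : |t| ≤ |t₀| + 1 := by
    have h1 : |t - t₀| < 1 := by simpa [Real.dist_eq] using ht
    have h2 := abs_sub_abs_le_abs_sub t t₀
    linarith
  rw [Real.norm_eq_abs]
  refine (abs_add_le _ _).trans (add_le_add ?_ ?_)
  · rw [abs_mul, abs_of_nonneg (by norm_num : (0 : ℝ) ≤ 4), abs_mul, abs_pow]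
    have : |wip lam y (mix κ p + t • y)| ≤ |wip lam y (mix κ p)| + (|t₀| + 1) * wip lam y y := by
      rw [wip_add_right, wip_smul_right]
      refine (abs_add_le _ _).trans ?_
      rw [abs_mul, abs_of_nonneg hyy]
      gcongr
    gcongr
    exact T.bound₂ _
  · rw [abs_mul, abs_mul, abs_two, abs_of_nonneg hyy]
    gcongr
    exact T.bound₁ _

/-- The t-derivative of the remainder is κ times an increment of second derivatives with shift t y.
Integrating the bound on it from 0 to s turns 48 t² -type and 6 t³ -type contributions into 24 s²
and 2 s³, the integrands being linear and quadratic in t. -/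
lemma TestData.abs_taylor_le (T : TestData lam h h₁ h₂ H₁ H₂) (hν : IsIsotropic ν ρ)
    (hρ0 : 0 ≤ ρ) (hκ0 : 0 ≤ κ) (hκ1 : κ ≤ 1) (hρ : ρ + κ ^ 2 ≤ 1) (y : Fin N → ℝ) {s : ℝ}
    (hs : 0 ≤ s) :
    |κ * ((∫ p, firstDer lam h₁ y (mix κ p + s • y) ∂(ν.prod (stdNormal (Fin N))))
        - (∫ p, firstDer lam h₁ y (mix κ p) ∂(ν.prod (stdNormal (Fin N))))
        - s * ∫ p, secondDer lam h₁ h₂ y (mix κ p) ∂(ν.prod (stdNormal (Fin N))))|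
      ≤ H₂ * (24 * (s ^ 2 * (wnorm lam y ^ 3 * √(∑ j, lam j)))
          + (2 * √N + 2) * (s ^ 3 * wnorm lam y ^ 4)) := by
  have hm := hν.hasMoment_prod
  set Q := ν.prod (stdNormal (Fin N)) with hQ
  set f : ℝ → ℝ := fun t => κ * ((∫ p, firstDer lam h₁ y (mix κ p + t • y) ∂Q)
        - (∫ p, firstDer lam h₁ y (mix κ p) ∂Q)
        - t * ∫ p, secondDer lam h₁ h₂ y (mix κ p) ∂Q) with hf
  set f' : ℝ → ℝ := fun t => κ * ∫ p, (secondDer lam h₁ h₂ y (mix κ p + t • y)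
    - secondDer lam h₁ h₂ y (mix κ p)) ∂Q with hf'
  have gs := T.polyGrowth_secondDer y
  have hfd : ∀ t, HasDerivAt f (f' t) t := by
    intro t
    have h1 := T.hasDerivAt_integral_firstDer (κ := κ) hν y t
    have h2 := (hasDerivAt_id t).mul_const (∫ p, secondDer lam h₁ h₂ y (mix κ p) ∂Q)
    refine (((h1.sub_const _).sub h2).const_mul κ).congr_deriv ?_
    simp only [hf', one_mul]
    rw [integral_sub ((gs.comp_mix_add κ _).integrable (hm.mono (by norm_num)))
      ((gs.comp_mix κ).integrable (hm.mono (by norm_num)))]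
  set Y := wnorm lam y
  set σ := √(∑ j, lam j)
  have hB : ∀ t : ℝ, HasDerivAt (fun t => H₂ * (24 * (t ^ 2 * (Y ^ 3 * σ))
      + (2 * √N + 2) * (t ^ 3 * Y ^ 4)))
      (H₂ * (48 * (Y ^ 2 * (t * Y) * σ) + (6 * √N + 6) * (Y ^ 2 * (t * Y) ^ 2))) t := by
    intro t
    have h1 := (((hasDerivAt_id t).pow 2).mul_const (Y ^ 3 * σ)).const_mul 24
    have h2 := (((hasDerivAt_id t).pow 3).mul_const (Y ^ 4)).const_mul (2 * √N + 2)
    refine ((h1.add h2).const_mul H₂).congr_deriv ?_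
    simp only [id_eq, mul_one, Nat.cast_ofNat, Nat.reduceSub, pow_one]
    ring
  have := image_norm_le_of_norm_deriv_right_le_deriv_boundary (f := f) (f' := f') (a := 0) (b := s)
    (fun t _ => (hfd t).continuousAt.continuousWithinAt) (fun t _ => (hfd t).hasDerivWithinAt)
    (by simp [hf]) hB (fun t ht => by
      have := T.abs_integral_secondDer_sub_le hν hρ0 hκ0 hκ1 hρ y (t • y)
      rw [wnorm_smul, abs_of_nonneg ht.1] at this
      exact this) (Set.right_mem_Icc.2 hs)
  exact this

/-- Summation of the second-derivative estimate over the basis directions, whose squared weighted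
norms are the lam j. -/
lemma TestData.abs_integral_lapl_sub_le (T : TestData lam h h₁ h₂ H₁ H₂) (hν : IsIsotropic ν ρ)
    (hρ0 : 0 ≤ ρ) (hκ0 : 0 ≤ κ) (hκ1 : κ ≤ 1) (hρ : ρ + κ ^ 2 ≤ 1) (b : Fin N → ℝ) :
    |κ * ((∫ p, lapl lam h₁ h₂ (mix κ p + b) ∂(ν.prod (stdNormal (Fin N))))
        - ∫ p, lapl lam h₁ h₂ (mix κ p) ∂(ν.prod (stdNormal (Fin N))))|
      ≤ H₂ * (∑ j, lam j) * (48 * (wnorm lam b * √(∑ j, lam j))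
          + (6 * √N + 6) * wnorm lam b ^ 2) := by
  have hm := hν.hasMoment_prod
  have gs := fun m : Fin N => T.polyGrowth_secondDer (Pi.single m 1)
  have i1 := fun m => ((gs m).comp_mix_add κ b).integrable (hm.mono (by norm_num))
  have i2 := fun m => ((gs m).comp_mix κ).integrable (hm.mono (by norm_num))
  simp only [lapl]
  rw [integral_finsetSum _ fun m _ => i1 m, integral_finsetSum _ fun m _ => i2 m,
    ← Finset.sum_sub_distrib, Finset.mul_sum]
  refine (Finset.abs_sum_le_sum_abs _ _).trans ?_
  rw [Finset.mul_sum, Finset.sum_mul]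
  refine Finset.sum_le_sum fun m _ => ?_
  rw [← integral_sub (i1 m) (i2 m)]
  refine (T.abs_integral_secondDer_sub_le hν hρ0 hκ0 hκ1 hρ (Pi.single m 1) b).trans (le_of_eq ?_)
  rw [wnorm_sq T.nonneg, wip_single_single]
  ring

variable {μ : Measure (Fin N → ℝ)}

lemma IsIsotropic.integral_secondDer (hμ : IsIsotropic μ 1) (x : Fin N → ℝ) :
    ∫ y, secondDer lam h₁ h₂ y x ∂μ = lapl lam h₁ h₂ x := by
  have e : ∀ y, secondDer lam h₁ h₂ y x = (4 * h₂ (wip lam x x)) * ((lam * x) ⬝ᵥ y) ^ 2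
      + 2 * h₁ (wip lam x x) * wip lam y y := fun y => by
    rw [secondDer, wip_comm lam y x, wip_eq_dotProduct lam x y]; ring
  have hyy : ∫ y, wip lam y y ∂μ = ∑ j, lam j := by
    simp only [wip, mul_assoc]
    rw [integral_finsetSum _ fun j _ => (((PolyGrowth.apply j).mul (PolyGrowth.apply j)).const_mul
      (lam j)).integrable (hμ.moment.mono (by norm_num))]
    simp [integral_const_mul, hμ.cov]
  simp only [e]
  rw [integral_add ((((polyGrowth_dotProduct (lam * x)).pow 2).const_mul _).integrable
    (hμ.moment.mono (by norm_num)))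
    (((polyGrowth_wip PolyGrowth.apply PolyGrowth.apply).const_mul _).integrable
      (hμ.moment.mono (by norm_num))), integral_const_mul, integral_const_mul, hyy,
    hμ.integral_dotProduct_sq, lapl_eq]
  ring

lemma IsIsotropic.integral_firstDer (hμ : IsIsotropic μ 1) (x : Fin N → ℝ) :
    ∫ y, firstDer lam h₁ y x ∂μ = 0 := by
  have e : ∀ y, firstDer lam h₁ y x = (2 * h₁ (wip lam x x)) * ((lam * x) ⬝ᵥ y) := fun y => by
    rw [firstDer, wip_comm lam y x, wip_eq_dotProduct lam x y]; ring
  simp only [e]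
  rw [integral_const_mul, hμ.integral_dotProduct, mul_zero]

/-- The contribution of one summand to the derivative of the interpolation. -/
lemma TestData.abs_integral_summand_le [IsProbabilityMeasure μ]
    (T : TestData lam h h₁ h₂ H₁ H₂) (hν : IsIsotropic ν ρ) (hμ : IsIsotropic μ 1) (hρ0 : 0 ≤ ρ)
    (hκ0 : 0 ≤ κ) (hκ1 : κ ≤ 1) (hρ : ρ + κ ^ 2 ≤ 1) {s : ℝ}
    (hs : 0 ≤ s) :
    |κ * ∫ y, ∫ p, (firstDer lam h₁ y (mix κ p + s • y) - s * lapl lam h₁ h₂ (mix κ p + s • y))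
        ∂(ν.prod (stdNormal (Fin N))) ∂μ|
      ≤ H₂ * (s ^ 2 * (24 * √(∑ j, lam j) * (∫ y, wnorm lam y ^ 3 ∂μ)
            + 48 * (∑ j, lam j) * √(∑ j, lam j) * ∫ y, wnorm lam y ∂μ)
          + s ^ 3 * ((2 * √N + 2) * (∫ y, wnorm lam y ^ 4 ∂μ)
            + (6 * √N + 6) * (∑ j, lam j) * ∫ y, wnorm lam y ^ 2 ∂μ)) := by
  have hm := hν.hasMoment_prod
  set Q := ν.prod (stdNormal (Fin N)) with hQ
  have hmm : HasMoment 4 (μ.prod Q) := hμ.moment.prod hm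
  have hy : ∀ j, PolyGrowth 1 (fun q : (Fin N → ℝ) × ((Fin N → ℝ) × (Fin N → ℝ)) => q.1 j) :=
    fun j => (PolyGrowth.apply j).comp_fst
  have hx0 : ∀ j, PolyGrowth 1
      (fun q : (Fin N → ℝ) × ((Fin N → ℝ) × (Fin N → ℝ)) => mix κ q.2 j) :=
    fun j => ((PolyGrowth.apply j).comp_mix κ).comp_snd
  have hxs : ∀ j, PolyGrowth 1
      (fun q : (Fin N → ℝ) × ((Fin N → ℝ) × (Fin N → ℝ)) => (mix κ q.2 + s • q.1) j) :=
    fun j => (hx0 j).add ((hy j).const_mul s)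
  have glap : PolyGrowth 4 (fun q : (Fin N → ℝ) × ((Fin N → ℝ) × (Fin N → ℝ)) =>
      lapl lam h₁ h₂ (mix κ q.2 + s • q.1)) :=
    PolyGrowth.sum _ fun m _ => T.polyGrowth_secondDer' (a := fun _ => Pi.single m 1)
      (fun j => PolyGrowth.const _) hxs
  have j1 : Integrable (fun q => firstDer lam h₁ q.1 (mix κ q.2 + s • q.1)) (μ.prod Q) :=
    (T.polyGrowth_firstDer hy hxs).integrable (hmm.mono (by norm_num))
  have j2 : Integrable (fun q => firstDer lam h₁ q.1 (mix κ q.2)) (μ.prod Q) :=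
    (T.polyGrowth_firstDer hy hx0).integrable (hmm.mono (by norm_num))
  have j3 : Integrable (fun q => secondDer lam h₁ h₂ q.1 (mix κ q.2)) (μ.prod Q) :=
    (T.polyGrowth_secondDer' hy hx0).integrable hmm
  have j4 : Integrable (fun q : (Fin N → ℝ) × ((Fin N → ℝ) × (Fin N → ℝ)) =>
      lapl lam h₁ h₂ (mix κ q.2 + s • q.1)) (μ.prod Q) := glap.integrable hmm
  set c₁ : (Fin N → ℝ) → ℝ := fun y => ∫ p, firstDer lam h₁ y (mix κ p + s • y) ∂Q with hc1
  set c₂ : (Fin N → ℝ) → ℝ := fun y => ∫ p, firstDer lam h₁ y (mix κ p) ∂Q with hc2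
  set c₃ : (Fin N → ℝ) → ℝ := fun y => ∫ p, secondDer lam h₁ h₂ y (mix κ p) ∂Q with hc3
  set c₄ : (Fin N → ℝ) → ℝ := fun y => ∫ p, lapl lam h₁ h₂ (mix κ p + s • y) ∂Q with hc4
  set c₅ : ℝ := ∫ p, lapl lam h₁ h₂ (mix κ p) ∂Q with hc5
  have k1 : Integrable c₁ μ := j1.integral_prod_left
  have k2 : Integrable c₂ μ := j2.integral_prod_left
  have k3 : Integrable c₃ μ := j3.integral_prod_left
  have k4 : Integrable c₄ μ := j4.integral_prod_left
  -- Integrating over y first, the zero mean of y removes the first-order term, and its identity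
  -- covariance turns the second-order term into the Laplacian.
  have z2 : ∫ y, c₂ y ∂μ = 0 := by
    simp only [hc2]
    rw [integral_integral_swap j2]
    simp [hμ.integral_firstDer]
  have z3 : ∫ y, c₃ y ∂μ = c₅ := by
    simp only [hc3]
    rw [integral_integral_swap j3]
    simp only [hμ.integral_secondDer, hc5]
  have einner : ∀ y, ∫ p, (firstDer lam h₁ y (mix κ p + s • y)
      - s * lapl lam h₁ h₂ (mix κ p + s • y)) ∂Q = c₁ y - s * c₄ y := by
    intro y
    have gf : PolyGrowth 2 (firstDer lam h₁ y) :=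
      T.polyGrowth_firstDer (a := fun _ => y) (x := fun x => x) (fun j => PolyGrowth.const (y j))
        PolyGrowth.apply
    rw [integral_sub ((gf.comp_mix_add κ _).integrable (hm.mono (by norm_num)))
      (((T.polyGrowth_lapl.comp_mix_add κ _).const_mul s).integrable (hm.mono (by norm_num))),
      integral_const_mul]
  simp only [einner]
  have kA : Integrable (fun y => c₁ y - c₂ y - s * c₃ y) μ := (k1.sub k2).sub (k3.const_mul s)
  have kB : Integrable (fun y => s * (c₄ y - c₅)) μ :=
    (k4.sub (integrable_const c₅)).const_mul s
  -- The inserted terms have total integral zero. What is left is the Taylor remainder in direction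
  -- y and the change of the Laplacian under the shift s • y, both controlled after multiplication
  -- by κ.
  have hsplit : ∫ y, (c₁ y - s * c₄ y) ∂μ
      = ∫ y, ((c₁ y - c₂ y - s * c₃ y) - s * (c₄ y - c₅)) ∂μ := by
    have e : ∀ y, c₁ y - s * c₄ y
        = ((c₁ y - c₂ y - s * c₃ y) - s * (c₄ y - c₅)) + (c₂ y + s * (c₃ y - c₅)) :=
      fun y => by ring
    have k5 : Integrable (fun y => s * (c₃ y - c₅)) μ :=
      (k3.sub (integrable_const c₅)).const_mul s
    have kAB : Integrable (fun y => (c₁ y - c₂ y - s * c₃ y) - s * (c₄ y - c₅)) μ := kA.sub kB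
    have k25 : Integrable (fun y => c₂ y + s * (c₃ y - c₅)) μ := k2.add k5
    simp only [e]
    rw [integral_add kAB k25, integral_add k2 k5, z2, integral_const_mul,
      integral_sub k3 (integrable_const c₅), z3]
    simp
  rw [hsplit, ← integral_const_mul]
  set σ := √(∑ j, lam j)
  have gw : PolyGrowth 1 (fun y => wnorm lam y) := by
    have : PolyGrowth (2 * 1) (fun y : Fin N → ℝ => wip lam y y) :=
      polyGrowth_wip (k := 1) (l := 1) PolyGrowth.apply PolyGrowth.apply
    exact this.sqrt
  have w1 := gw.integrable (hμ.moment.mono (by norm_num))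
  have w2 := (gw.pow 2).integrable (hμ.moment.mono (by norm_num))
  have w3 := (gw.pow 3).integrable (hμ.moment.mono (by norm_num))
  have w4 := (gw.pow 4).integrable (hμ.moment.mono (by norm_num))
  have hintg := ((w3.const_mul (H₂ * (24 * s ^ 2 * σ))).add
    (w4.const_mul (H₂ * ((2 * √N + 2) * s ^ 3)))).add
    ((w1.const_mul (H₂ * (48 * (∑ j, lam j) * σ * s ^ 2))).add
    (w2.const_mul (H₂ * ((6 * √N + 6) * (∑ j, lam j) * s ^ 3))))
  calc |∫ y, κ * ((c₁ y - c₂ y - s * c₃ y) - s * (c₄ y - c₅)) ∂μ|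
      ≤ ∫ y, (H₂ * (24 * s ^ 2 * σ) * wnorm lam y ^ 3
          + H₂ * ((2 * √N + 2) * s ^ 3) * wnorm lam y ^ 4
          + (H₂ * (48 * (∑ j, lam j) * σ * s ^ 2) * wnorm lam y
          + H₂ * ((6 * √N + 6) * (∑ j, lam j) * s ^ 3) * wnorm lam y ^ 2)) ∂μ := by
        refine (abs_integral_le_integral_abs).trans
          (integral_mono_of_nonneg (.of_forall fun p => abs_nonneg _) hintg
            (.of_forall fun y => ?_))
        have t1 := T.abs_taylor_le hν hρ0 hκ0 hκ1 hρ y hs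
        have t2 := T.abs_integral_lapl_sub_le hν hρ0 hκ0 hκ1 hρ (s • y)
        rw [wnorm_smul, abs_of_nonneg hs] at t2
        have t3 := mul_le_mul_of_nonneg_left t2 hs
        have e : κ * ((c₁ y - c₂ y - s * c₃ y) - s * (c₄ y - c₅))
            = κ * (c₁ y - c₂ y - s * c₃ y) - s * (κ * (c₄ y - c₅)) := by ring
        show |κ * _| ≤ _
        rw [e]
        have t4 : |s * (κ * (c₄ y - c₅))| ≤ s * (H₂ * (∑ j, lam j) * (48 * (s * wnorm lam y * σ)
            + (6 * √N + 6) * (s * wnorm lam y) ^ 2)) := by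
          rw [abs_mul, abs_of_nonneg hs]
          exact t3
        refine (abs_sub _ _).trans ((add_le_add t1 t4).trans (le_of_eq ?_))
        simp only [σ]
        ring
    _ = _ := by
        have e1 := integral_add (w3.const_mul (H₂ * (24 * s ^ 2 * σ)))
          (w4.const_mul (H₂ * ((2 * √N + 2) * s ^ 3)))
        have e2 := integral_add (w1.const_mul (H₂ * (48 * (∑ j, lam j) * σ * s ^ 2)))
          (w2.const_mul (H₂ * ((6 * √N + 6) * (∑ j, lam j) * s ^ 3)))
        have e3 := integral_add
          ((w3.const_mul (H₂ * (24 * s ^ 2 * σ))).add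
            (w4.const_mul (H₂ * ((2 * √N + 2) * s ^ 3))))
          ((w1.const_mul (H₂ * (48 * (∑ j, lam j) * σ * s ^ 2))).add
            (w2.const_mul (H₂ * ((6 * √N + 6) * (∑ j, lam j) * s ^ 3))))
        simp only [Pi.add_apply] at e3
        rw [e3, e1, e2, integral_const_mul, integral_const_mul, integral_const_mul,
          integral_const_mul]
        ring

end Taylor

/-! ### Interpolation between the normalised sum and the Gaussian vector -/

section Interpolation

variable {N : ℕ} {lam : Fin N → ℝ} {h h₁ h₂ : ℝ → ℝ} {H₁ H₂ : ℝ}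
  {μ : Measure (Fin N → ℝ)} [IsProbabilityMeasure μ]

/-- The law of `c` times a sum of `k` independent vectors with law `μ`. -/
def sumLaw (μ : Measure (Fin N → ℝ)) (k : ℕ) (c : ℝ) : Measure (Fin N → ℝ) :=
  (Measure.pi fun _ : Fin k => μ).map fun v => c • ∑ i, v i

lemma continuous_smul_sum (k : ℕ) (c : ℝ) :
    Continuous fun v : Fin k → Fin N → ℝ => c • ∑ i, v i := by fun_prop

instance (k : ℕ) (c : ℝ) : IsProbabilityMeasure (sumLaw μ k c) :=
  Measure.isProbabilityMeasure_map (continuous_smul_sum k c).measurable.aemeasurable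

lemma norm_sum_le_mul (k : ℕ) (v : Fin k → Fin N → ℝ) : ‖∑ i, v i‖ ≤ k * ‖v‖ := by
  refine (norm_sum_le _ _).trans ?_
  calc ∑ i, ‖v i‖ ≤ ∑ _i : Fin k, ‖v‖ := Finset.sum_le_sum fun i _ => norm_le_pi_norm v i
    _ = k * ‖v‖ := by simp

lemma norm_smul_sum_le (k : ℕ) (c : ℝ) (v : Fin k → Fin N → ℝ) :
    ‖c • ∑ i, v i‖ ≤ (|c| * k) * (1 + ‖v‖) := by
  rw [norm_smul, Real.norm_eq_abs, mul_assoc]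
  refine mul_le_mul_of_nonneg_left ((norm_sum_le_mul k v).trans ?_) (abs_nonneg c)
  exact mul_le_mul_of_nonneg_left (by linarith) (Nat.cast_nonneg k)

lemma polyGrowth_apply_apply {k : ℕ} (i : Fin k) (j : Fin N) :
    PolyGrowth 1 (fun v : Fin k → Fin N → ℝ => v i j) :=
  (PolyGrowth.apply j).comp (continuous_apply i) (A := 1) fun v => by
    linarith [norm_le_pi_norm v i]

/-- Distinct summands are independent and centred, so only the k diagonal covariances survive. -/
lemma IsIsotropic.sumLaw (hμ : IsIsotropic μ 1) (k : ℕ) (c : ℝ) :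
    IsIsotropic (sumLaw μ k c) (c ^ 2 * k) := by
  have hm : HasMoment 4 (Measure.pi fun _ : Fin k => μ) := hμ.moment.pi
  have hmeas := (continuous_smul_sum (N := N) k c).measurable.aemeasurable
    (μ := Measure.pi fun _ : Fin k => μ)
  have e1 : ∀ (i : Fin k) (j : Fin N), ∫ v, v i j ∂(Measure.pi fun _ : Fin k => μ) = 0 := by
    intro i j
    rw [integral_comp_eval (μ := fun _ : Fin k => μ) (i := i) (f := fun y : Fin N → ℝ => y j)
      (continuous_apply j).aestronglyMeasurable, hμ.mean]
  refine ⟨hm.map (continuous_smul_sum k c) (norm_smul_sum_le k c), fun j => ?_, fun j l => ?_⟩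
  · rw [Wilks.sumLaw, integral_map hmeas (continuous_apply j).aestronglyMeasurable]
    simp only [Pi.smul_apply, Finset.sum_apply, smul_eq_mul]
    rw [integral_const_mul, integral_finsetSum _ fun i _ =>
      (polyGrowth_apply_apply i j).integrable (hm.mono (by norm_num))]
    simp [e1]
  · rw [Wilks.sumLaw, integral_map hmeas
      (Continuous.aestronglyMeasurable (by fun_prop))]
    simp only [Pi.smul_apply, Finset.sum_apply, smul_eq_mul]
    have e : ∀ v : Fin k → Fin N → ℝ, c * (∑ i, v i j) * (c * ∑ i, v i l)
        = c ^ 2 * ∑ i, ∑ i', v i j * v i' l := by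
      intro v; rw [← Finset.sum_mul_sum]; ring
    have hintg : ∀ i i' : Fin k, Integrable (fun v : Fin k → Fin N → ℝ => v i j * v i' l)
        (Measure.pi fun _ : Fin k => μ) := fun i i' =>
      ((polyGrowth_apply_apply i j).mul (polyGrowth_apply_apply i' l)).integrable
        (hm.mono (by norm_num))
    have e2 : ∀ i i' : Fin k, ∫ v, v i j * v i' l ∂(Measure.pi fun _ : Fin k => μ)
        = if i = i' then (if j = l then 1 else 0) else 0 := by
      intro i i'
      split_ifs with h1 h2
      · subst h1
        rw [integral_comp_eval (μ := fun _ : Fin k => μ) (i := i)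
          (f := fun y : Fin N → ℝ => y j * y l) (Continuous.aestronglyMeasurable (by fun_prop)),
          hμ.cov, if_pos h2]
      · subst h1
        rw [integral_comp_eval (μ := fun _ : Fin k => μ) (i := i)
          (f := fun y : Fin N → ℝ => y j * y l) (Continuous.aestronglyMeasurable (by fun_prop)),
          hμ.cov, if_neg h2]
      · have hI := iIndepFun_pi (μ := fun _ : Fin k => μ) (X := fun _ (y : Fin N → ℝ) => y)
          (fun _ => aemeasurable_id)
        have hI2 := (hI.indepFun h1).comp (measurable_pi_apply j) (measurable_pi_apply l)
        have := hI2.integral_fun_mul_eq_mul_integral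
          (polyGrowth_apply_apply i j).continuous.aestronglyMeasurable
          (polyGrowth_apply_apply i' l).continuous.aestronglyMeasurable
        simp only [Function.comp] at this
        rw [this, e1, zero_mul]
    simp only [e]
    rw [integral_const_mul, integral_finsetSum _ fun i _ => integrable_finsetSum _ fun i' _ =>
      hintg i i', Finset.sum_congr rfl fun i _ => integral_finsetSum _ fun i' _ => hintg i i']
    simp only [e2, Finset.sum_ite_eq, Finset.mem_univ, if_true]
    split_ifs <;> simp

lemma integral_prod_sumLaw (k : ℕ) (c : ℝ) {F : (Fin N → ℝ) × (Fin N → ℝ) → ℝ}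
    (hF : Continuous F) :
    ∫ p, F p ∂((sumLaw μ k c).prod (stdNormal (Fin N)))
      = ∫ r : (Fin k → Fin N → ℝ) × (Fin N → ℝ), F (c • ∑ i, r.1 i, r.2)
          ∂((Measure.pi fun _ : Fin k => μ).prod (stdNormal (Fin N))) := by
  have hmeas := (continuous_smul_sum (N := N) k c).measurable
  have h1 : (sumLaw μ k c).prod (stdNormal (Fin N))
      = ((Measure.pi fun _ : Fin k => μ).prod (stdNormal (Fin N))).map
          (Prod.map (fun v : Fin k → Fin N → ℝ => c • ∑ i, v i) id) := by
    rw [← Measure.map_prod_map _ _ hmeas measurable_id, Measure.map_id]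
    rfl
  rw [h1, integral_map (hmeas.prodMap measurable_id).aemeasurable hF.aestronglyMeasurable]
  rfl

lemma norm_insertNth_le {k : ℕ} (i : Fin (k + 1)) (y : Fin N → ℝ) (r : Fin k → Fin N → ℝ) :
    ‖(i.insertNth y r : Fin (k + 1) → Fin N → ℝ)‖ ≤ ‖y‖ + ‖r‖ := by
  refine (pi_norm_le_iff_of_nonneg (by positivity)).2 fun l => ?_
  refine Fin.succAboveCases i ?_ (fun j => ?_) l
  · rw [Fin.insertNth_apply_same]; linarith [norm_nonneg r]
  · rw [Fin.insertNth_apply_succAbove]; linarith [norm_le_pi_norm r j, norm_nonneg y]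

/-- Isolates the i-th summand y, so that the other summands and the Gaussian vector are integrated
with y held fixed. -/
lemma integral_pi_prod_split (hμ : HasMoment 4 μ) {k : ℕ} (i : Fin (k + 1))
    {g : (Fin (k + 1) → Fin N → ℝ) × (Fin N → ℝ) → ℝ} (hg : PolyGrowth 4 g) :
    ∫ q, g q ∂((Measure.pi fun _ : Fin (k + 1) => μ).prod (stdNormal (Fin N)))
      = ∫ y, ∫ r : (Fin k → Fin N → ℝ) × (Fin N → ℝ), g (i.insertNth y r.1, r.2)
          ∂((Measure.pi fun _ : Fin k => μ).prod (stdNormal (Fin N))) ∂μ := by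
  have hm : HasMoment 4 ((Measure.pi fun _ : Fin (k + 1) => μ).prod (stdNormal (Fin N))) :=
    hμ.pi.prod (hasMoment_stdNormal _ 4)
  have hm' : HasMoment 4 ((Measure.pi fun _ : Fin k => μ).prod (stdNormal (Fin N))) :=
    hμ.pi.prod (hasMoment_stdNormal _ 4)
  have mp := (measurePreserving_piFinSuccAbove (fun _ : Fin (k + 1) => μ) i).symm
  have hgi := hg.integrable hm
  set q : (Fin (k + 1) → Fin N → ℝ) → ℝ := fun v => ∫ z, g (v, z) ∂(stdNormal (Fin N)) with hq
  have hqi : Integrable q (Measure.pi fun _ : Fin (k + 1) => μ) := hgi.integral_prod_left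
  have h1 := (mp.integrable_comp_emb (MeasurableEquiv.measurableEmbedding _) (g := q)).2 hqi
  rw [integral_prod _ hgi, ← mp.integral_comp (MeasurableEquiv.measurableEmbedding _),
    integral_prod (fun x => q ((MeasurableEquiv.piFinSuccAbove (fun _ => Fin N → ℝ) i).symm x)) h1]
  congr 1
  ext y
  have hc : PolyGrowth 4 (fun r : (Fin k → Fin N → ℝ) × (Fin N → ℝ) =>
      g (i.insertNth y r.1, r.2)) := by
    refine hg.comp ?_ (A := 1 + ‖y‖) fun r => ?_
    · have hci : Continuous fun r : (Fin k → Fin N → ℝ) × (Fin N → ℝ) =>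
          (i.insertNth y r.1 : Fin (k + 1) → Fin N → ℝ) :=
        Continuous.finInsertNth i continuous_const continuous_fst
      exact hci.prodMk continuous_snd
    · have h1 := norm_insertNth_le i y r.1
      have h2 := norm_fst_le r
      have h3 := norm_snd_le r
      have h4 := norm_nonneg y
      have h5 := norm_nonneg r
      rw [Prod.norm_def]
      refine max_le ?_ ?_
      · simp only; nlinarith
      · simp only; nlinarith
  rw [integral_prod _ (hc.integrable hm')]
  rfl

/-- The interpolation between the normalised sum and the Gaussian vector. -/
def interp (k : ℕ) (φ : ℝ) (q : (Fin (k + 1) → Fin N → ℝ) × (Fin N → ℝ)) : Fin N → ℝ :=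
  mix (Real.cos φ) ((Real.sin φ / √((k + 1 : ℕ) : ℝ)) • ∑ i, q.1 i, q.2)

lemma polyGrowth_interp (k : ℕ) (φ : ℝ) (j : Fin N) :
    PolyGrowth 1 (fun q => interp (N := N) k φ q j) := by
  have h1 : PolyGrowth 1 (fun q : (Fin (k + 1) → Fin N → ℝ) × (Fin N → ℝ) =>
      (Real.sin φ / √((k + 1 : ℕ) : ℝ)) * ∑ i, q.1 i j) :=
    (PolyGrowth.sum _ fun i _ => (polyGrowth_apply_apply i j).comp_fst).const_mul _
  have h2 : PolyGrowth 1 (fun q : (Fin (k + 1) → Fin N → ℝ) × (Fin N → ℝ) =>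
      Real.cos φ * q.2 j) := ((PolyGrowth.apply j).comp_snd).const_mul _
  simpa [interp, mix] using h1.add h2

lemma firstDer_add (a b x : Fin N → ℝ) :
    firstDer lam h₁ (a + b) x = firstDer lam h₁ a x + firstDer lam h₁ b x := by
  simp only [firstDer, wip_add_left]; ring

lemma firstDer_smul (t : ℝ) (a x : Fin N → ℝ) :
    firstDer lam h₁ (t • a) x = t * firstDer lam h₁ a x := by
  simp only [firstDer, wip_smul_left]; ring

lemma firstDer_sum {ι : Type*} (s : Finset ι) (a : ι → Fin N → ℝ) (x : Fin N → ℝ) :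
    firstDer lam h₁ (∑ i ∈ s, a i) x = ∑ i ∈ s, firstDer lam h₁ (a i) x := by
  classical
  induction s using Finset.induction_on with
  | empty => simp [firstDer, wip_zero_left]
  | insert i s hi ih => rw [Finset.sum_insert hi, Finset.sum_insert hi, firstDer_add, ih]

/-- Gaussian integration by parts for the gradient. -/
lemma TestData.integral_firstDer_snd (T : TestData lam h h₁ h₂ H₁ H₂)
    {ν : Measure (Fin N → ℝ)} [IsProbabilityMeasure ν] {ρ : ℝ} (hν : IsIsotropic ν ρ) (κ : ℝ) :
    ∫ p, firstDer lam h₁ p.2 (mix κ p) ∂(ν.prod (stdNormal (Fin N)))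
      = κ * ∫ p, lapl lam h₁ h₂ (mix κ p) ∂(ν.prod (stdNormal (Fin N))) := by
  have hm := hν.hasMoment_prod
  have e : ∀ p : (Fin N → ℝ) × (Fin N → ℝ), firstDer lam h₁ p.2 (mix κ p)
      = ∑ m, p.2 m * firstDer lam h₁ (Pi.single m 1) (mix κ p) := by
    intro p
    have : p.2 = ∑ m, p.2 m • (Pi.single m 1 : Fin N → ℝ) := by
      ext j; simp [Finset.sum_apply, Pi.single_apply]
    conv_lhs => rw [this, firstDer_sum]
    exact Finset.sum_congr rfl fun m _ => firstDer_smul _ _ _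
  have gf : ∀ m, PolyGrowth 2 (fun p => firstDer lam h₁ (Pi.single m 1) (mix (N := N) κ p)) :=
    fun m => T.polyGrowth_firstDer (fun j => PolyGrowth.const _)
      fun j => (PolyGrowth.apply j).comp_mix κ
  have gs : ∀ m, PolyGrowth 2 (fun p => secondDer lam h₁ h₂ (Pi.single m 1) (mix (N := N) κ p)) :=
    fun m => (T.polyGrowth_secondDer _).comp_mix κ
  simp only [e, lapl]
  rw [integral_finsetSum _ fun m _ =>
      ((polyGrowth_snd m).mul (gf m)).integrable (hm.mono (by norm_num)),
    integral_finsetSum _ fun m _ => (gs m).integrable (hm.mono (by norm_num)), Finset.mul_sum]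
  refine Finset.sum_congr rfl fun m _ => ?_
  rw [← integral_const_mul]
  refine integral_coord_mul_prod_stdNormal hν.moment m ((gf m).mono (by norm_num))
    (((gs m).const_mul κ).mono (by norm_num)) fun p => ?_
  unfold HasLineDerivAt
  simp only [mix_add_smul]
  have h1 : HasDerivAt (fun t : ℝ => κ * t) κ 0 := by
    simpa using (hasDerivAt_id (0 : ℝ)).const_mul κ
  have h2 := T.hasDerivAt_firstDer (mix κ p) (Pi.single m 1) (κ * 0)
  have h3 := HasDerivAt.comp (0 : ℝ) (h₂ := fun t : ℝ => firstDer lam h₁ (Pi.single m 1)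
    (mix κ p + t • (Pi.single m 1 : Fin N → ℝ))) h2 h1
  refine h3.congr_deriv ?_
  simp only [mul_zero, zero_smul, add_zero]
  ring

lemma hasDerivAt_interp (k : ℕ) (φ : ℝ) (q : (Fin (k + 1) → Fin N → ℝ) × (Fin N → ℝ)) :
    HasDerivAt (fun φ => interp k φ q)
      ((Real.cos φ / √((k + 1 : ℕ) : ℝ)) • ∑ i, q.1 i + (-Real.sin φ) • q.2) φ := by
  unfold interp mix
  exact (((Real.hasDerivAt_sin φ).div_const _).smul_const _).add
    ((Real.hasDerivAt_cos φ).smul_const _)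

lemma TestData.hasDerivAt_comp_wip (T : TestData lam h h₁ h₂ H₁ H₂) {x : ℝ → Fin N → ℝ}
    {x' : Fin N → ℝ} {t : ℝ} (hx : HasDerivAt x x' t) :
    HasDerivAt (fun t => h (wip lam (x t) (x t))) (firstDer lam h₁ x' (x t)) t := by
  have hj : ∀ j, HasDerivAt (fun t => x t j) (x' j) t := hasDerivAt_pi.1 hx
  have h1 : HasDerivAt (fun t => wip lam (x t) (x t)) (2 * wip lam x' (x t)) t := by
    have := HasDerivAt.fun_sum (u := Finset.univ)
      (A := fun j t => lam j * x t j * x t j)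
      (A' := fun j => lam j * x' j * x t j + lam j * x t j * x' j)
      (fun j _ => ((hj j).const_mul (lam j)).mul (hj j))
    refine this.congr_deriv ?_
    rw [wip, Finset.mul_sum]
    exact Finset.sum_congr rfl fun j _ => by ring
  refine (HasDerivAt.comp t (h₂ := h) (T.deriv _) h1).congr_deriv ?_
  rw [firstDer]; ring

/-- Differentiation under the integral sign. Since sine and cosine are bounded by 1, the dominating
function does not depend on φ and the whole line serves as neighbourhood. -/
lemma TestData.hasDerivAt_integral_interp (T : TestData lam h h₁ h₂ H₁ H₂) {H₀ : ℝ}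
    (hb : ∀ x, |h x| ≤ H₀) (hμ : HasMoment 4 μ) (k : ℕ) (φ₀ : ℝ) :
    HasDerivAt (fun φ => ∫ q, h (wip lam (interp k φ q) (interp k φ q))
        ∂((Measure.pi fun _ : Fin (k + 1) => μ).prod (stdNormal (Fin N))))
      (∫ q, firstDer lam h₁
        ((Real.cos φ₀ / √((k + 1 : ℕ) : ℝ)) • ∑ i, q.1 i + (-Real.sin φ₀) • q.2) (interp k φ₀ q)
        ∂((Measure.pi fun _ : Fin (k + 1) => μ).prod (stdNormal (Fin N)))) φ₀ := by
  have hm : HasMoment 4 ((Measure.pi fun _ : Fin (k + 1) => μ).prod (stdNormal (Fin N))) :=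
    hμ.pi.prod (hasMoment_stdNormal _ 4)
  set M := (Measure.pi fun _ : Fin (k + 1) => μ).prod (stdNormal (Fin N)) with hM
  have hic : ∀ φ, Continuous (interp (N := N) k φ) := fun φ =>
    continuous_pi fun j => (polyGrowth_interp k φ j).continuous
  have gh : ∀ φ, PolyGrowth 0 (fun q => h (wip lam (interp (N := N) k φ q) (interp k φ q))) :=
    fun φ => .of_bounded (T.continuous.comp (continuous_wip lam (hic φ) (hic φ))) fun _ => hb _
  have gd : ∀ φ (j : Fin N), PolyGrowth 1 (fun q : (Fin (k + 1) → Fin N → ℝ) × (Fin N → ℝ) =>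
      ((Real.cos φ / √((k + 1 : ℕ) : ℝ)) • ∑ i, q.1 i + (-Real.sin φ) • q.2) j) := by
    intro φ j
    have h1 : PolyGrowth 1 (fun q : (Fin (k + 1) → Fin N → ℝ) × (Fin N → ℝ) =>
        (Real.cos φ / √((k + 1 : ℕ) : ℝ)) * ∑ i, q.1 i j) :=
      (PolyGrowth.sum _ fun i _ => (polyGrowth_apply_apply i j).comp_fst).const_mul _
    have h2 : PolyGrowth 1 (fun q : (Fin (k + 1) → Fin N → ℝ) × (Fin N → ℝ) =>
        (-Real.sin φ) * q.2 j) := ((PolyGrowth.apply j).comp_snd).const_mul _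
    simpa using h1.add h2
  have gS : ∀ j : Fin N, PolyGrowth 1 (fun q : (Fin (k + 1) → Fin N → ℝ) × (Fin N → ℝ) =>
      |(√((k + 1 : ℕ) : ℝ))⁻¹ * ∑ i, q.1 i j| + |q.2 j|) := fun j =>
    ((PolyGrowth.sum _ fun i _ => (polyGrowth_apply_apply i j).comp_fst).const_mul _).abs.add
      ((PolyGrowth.apply j).comp_snd).abs
  have gbound : PolyGrowth 2 (fun q : (Fin (k + 1) → Fin N → ℝ) × (Fin N → ℝ) =>
      2 * H₁ * ∑ j, lam j * (|(√((k + 1 : ℕ) : ℝ))⁻¹ * ∑ i, q.1 i j| + |q.2 j|) ^ 2) :=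
    (PolyGrowth.sum _ fun j _ => ((gS j).pow 2).const_mul (lam j)).const_mul _
  refine (hasDerivAt_integral_of_dominated_loc_of_deriv_le
    (F := fun φ q => h (wip lam (interp k φ q) (interp k φ q)))
    (F' := fun φ q => firstDer lam h₁
        ((Real.cos φ / √((k + 1 : ℕ) : ℝ)) • ∑ i, q.1 i + (-Real.sin φ) • q.2) (interp k φ q))
    Filter.univ_mem
    (.of_forall fun φ => (gh φ).continuous.aestronglyMeasurable)
    ((gh φ₀).integrable (hm.mono (by norm_num)))
    (T.polyGrowth_firstDer (gd φ₀) (polyGrowth_interp k φ₀)).continuous.aestronglyMeasurable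
    (.of_forall fun q φ _ => ?_) (gbound.integrable (hm.mono (by norm_num)))
    (.of_forall fun q φ _ => T.hasDerivAt_comp_wip (hasDerivAt_interp k φ q))).2
  have hc := Real.abs_cos_le_one φ
  have hs := Real.abs_sin_le_one φ
  rw [Real.norm_eq_abs, firstDer, abs_mul, abs_two, abs_mul, mul_assoc]
  refine mul_le_mul_of_nonneg_left ?_ zero_le_two
  rw [mul_comm]
  refine mul_le_mul (T.bound₁ _) ?_ (abs_nonneg _) ((abs_nonneg _).trans (T.bound₁ 0))
  refine (Finset.abs_sum_le_sum_abs _ _).trans (Finset.sum_le_sum fun j _ => ?_)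
  rw [abs_mul, abs_mul, abs_of_nonneg (T.nonneg j), mul_assoc]
  refine mul_le_mul_of_nonneg_left ?_ (T.nonneg j)
  rw [sq]
  have hS : ∀ t u : ℝ, |t| ≤ 1 → |u| ≤ 1 →
      |(t / √((k + 1 : ℕ) : ℝ)) * ∑ i, q.1 i j + u * q.2 j|
        ≤ |(√((k + 1 : ℕ) : ℝ))⁻¹ * ∑ i, q.1 i j| + |q.2 j| := by
    intro t u ht hu
    rw [div_eq_mul_inv, mul_assoc]
    refine (abs_add_le _ _).trans (add_le_add ?_ ?_)
    · rw [abs_mul]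
      exact mul_le_of_le_one_left (abs_nonneg _) ht
    · rw [abs_mul]
      exact mul_le_of_le_one_left (abs_nonneg _) hu
  refine mul_le_mul ?_ ?_ (abs_nonneg _) (by positivity)
  · simpa using hS (Real.cos φ) (-Real.sin φ) hc (by simpa using hs)
  · simpa [interp, mix] using hS (Real.sin φ) (Real.cos φ) hs hc

end Interpolation

/-! ### Normal approximation in isotropic coordinates -/

section NormalApproximation

variable {N : ℕ} {lam : Fin N → ℝ} {h h₁ h₂ : ℝ → ℝ} {H₁ H₂ : ℝ}
/-- The constant of order `n^{-1/2}` in the normal approximation of the quadratic form. -/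
def thirdCoeff (lam : Fin N → ℝ) (μ : Measure (Fin N → ℝ)) : ℝ :=
  24 * √(∑ j, lam j) * (∫ y, wnorm lam y ^ 3 ∂μ)
    + 48 * (∑ j, lam j) * √(∑ j, lam j) * ∫ y, wnorm lam y ∂μ

/-- The constant of order `n^{-1}` in the normal approximation of the quadratic form. -/
def fourthCoeff (lam : Fin N → ℝ) (μ : Measure (Fin N → ℝ)) : ℝ :=
  (2 * √N + 2) * (∫ y, wnorm lam y ^ 4 ∂μ)
    + (6 * √N + 6) * (∑ j, lam j) * ∫ y, wnorm lam y ^ 2 ∂μ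

lemma fourthCoeff_nonneg {N : ℕ} {lam : Fin N → ℝ} {μ : Measure (Fin N → ℝ)}
    (hl : ∀ j, 0 ≤ lam j) : 0 ≤ fourthCoeff lam μ := by
  have h0 : 0 ≤ ∑ j, lam j := Finset.sum_nonneg fun j _ => hl j
  have h1 : 0 ≤ ∫ y, wnorm lam y ^ 4 ∂μ :=
    integral_nonneg fun y => pow_nonneg (Real.sqrt_nonneg _) 4
  have h2 : 0 ≤ ∫ y, wnorm lam y ^ 2 ∂μ := integral_nonneg fun y => sq_nonneg _
  unfold fourthCoeff
  positivity

variable {μ : Measure (Fin N → ℝ)} [IsProbabilityMeasure μ]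

lemma interp_insertNth (k : ℕ) (φ : ℝ) (i : Fin (k + 1)) (y : Fin N → ℝ)
    (r : (Fin k → Fin N → ℝ) × (Fin N → ℝ)) :
    interp k φ (i.insertNth y r.1, r.2)
      = mix (Real.cos φ) ((Real.sin φ / √((k + 1 : ℕ) : ℝ)) • ∑ j, r.1 j, r.2)
        + (Real.sin φ / √((k + 1 : ℕ) : ℝ)) • y := by
  unfold interp mix
  simp only [Fin.sum_univ_succAbove _ i, Fin.insertNth_apply_same, Fin.insertNth_apply_succAbove,
    smul_add]
  abel

lemma TestData.polyGrowth_lapl_interp (T : TestData lam h h₁ h₂ H₁ H₂) (k : ℕ) (φ : ℝ) :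
    PolyGrowth 2 (fun q => lapl lam h₁ h₂ (interp (N := N) k φ q)) := by
  refine (T.polyGrowth_lapl.comp_mix (Real.cos φ)).comp
    (A := |Real.sin φ / √((k + 1 : ℕ) : ℝ)| * (k + 1 : ℕ) + 1) ?_ fun q => ?_
  · exact ((continuous_smul_sum (k + 1) _).comp continuous_fst).prodMk continuous_snd
  · have h1 := norm_smul_sum_le (k + 1) (Real.sin φ / √((k + 1 : ℕ) : ℝ)) q.1
    have h2 := norm_fst_le q
    have h3 := norm_snd_le q
    have h4 : 0 ≤ |Real.sin φ / √((k + 1 : ℕ) : ℝ)| * ((k + 1 : ℕ) : ℝ) := by positivity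
    rw [Prod.norm_def]
    refine max_le ?_ ?_
    · simp only; nlinarith [norm_nonneg q]
    · simp only; nlinarith [norm_nonneg q]

/-- With the i-th summand set aside, the other k have law `sumLaw μ k c` for c = sin φ / √(k + 1),
hence covariance c² k. Because c² (k + 1) = sin² φ, the condition ρ + κ² ≤ 1 holds with κ = cos φ,
and the single-summand estimate applies with s = c. -/
lemma TestData.abs_integral_interp_summand_le (T : TestData lam h h₁ h₂ H₁ H₂)
    (hμ : IsIsotropic μ 1) (k : ℕ) {φ : ℝ} (hs : 0 ≤ Real.sin φ) (hc : 0 ≤ Real.cos φ)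
    (i : Fin (k + 1)) :
    |Real.cos φ * ∫ q, (firstDer lam h₁ (q.1 i) (interp k φ q)
        - Real.sin φ / √((k + 1 : ℕ) : ℝ) * lapl lam h₁ h₂ (interp k φ q))
        ∂((Measure.pi fun _ : Fin (k + 1) => μ).prod (stdNormal (Fin N)))|
      ≤ H₂ * ((Real.sin φ / √((k + 1 : ℕ) : ℝ)) ^ 2 * thirdCoeff lam μ
        + (Real.sin φ / √((k + 1 : ℕ) : ℝ)) ^ 3 * fourthCoeff lam μ) := by
  set c : ℝ := Real.sin φ / √((k + 1 : ℕ) : ℝ) with hcdef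
  have hk : (0 : ℝ) < ((k + 1 : ℕ) : ℝ) := by positivity
  have hc0 : 0 ≤ c := by positivity
  have hc2 : c ^ 2 * ((k + 1 : ℕ) : ℝ) = Real.sin φ ^ 2 := by
    rw [hcdef, div_pow, Real.sq_sqrt hk.le]; field_simp
  have hρ : c ^ 2 * k + Real.cos φ ^ 2 ≤ 1 := by
    have := Real.sin_sq_add_cos_sq φ
    push_cast at hc2
    nlinarith [sq_nonneg c]
  have hintg : PolyGrowth 4 (fun q : (Fin (k + 1) → Fin N → ℝ) × (Fin N → ℝ) =>
      firstDer lam h₁ (q.1 i) (interp k φ q) - c * lapl lam h₁ h₂ (interp k φ q)) := by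
    refine PolyGrowth.mono (k := 2) (PolyGrowth.sub ?_ (PolyGrowth.const_mul ?_ _)) (by norm_num)
    · exact T.polyGrowth_firstDer (fun j => (polyGrowth_apply_apply i j).comp_fst)
        (polyGrowth_interp k φ)
    · exact T.polyGrowth_lapl_interp k φ
  have hcont : ∀ y : Fin N → ℝ, Continuous fun p : (Fin N → ℝ) × (Fin N → ℝ) =>
      firstDer lam h₁ y (mix (Real.cos φ) p + c • y)
        - c * lapl lam h₁ h₂ (mix (Real.cos φ) p + c • y) := by
    intro y
    have gf : PolyGrowth 2 (firstDer lam h₁ y) :=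
      T.polyGrowth_firstDer (a := fun _ => y) (x := fun x => x) (fun j => PolyGrowth.const (y j))
        PolyGrowth.apply
    exact (gf.comp_mix_add _ _).continuous.sub
      ((T.polyGrowth_lapl.comp_mix_add _ _).const_mul c).continuous
  rw [integral_pi_prod_split hμ.moment i hintg]
  simp only [interp_insertNth, Fin.insertNth_apply_same, ← hcdef]
  simp only [← fun y => integral_prod_sumLaw (μ := μ) k c (hcont y)]
  exact T.abs_integral_summand_le (hμ.sumLaw k c) hμ (by positivity) hc (Real.cos_le_one φ) hρ hc0

/-- Integration by parts turns the Gaussian part of the velocity into −sin φ cos φ times the mean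
Laplacian. This is distributed equally over the k + 1 summands, where it becomes the compensator of
each first-order term. -/
lemma TestData.integral_firstDer_interp (T : TestData lam h h₁ h₂ H₁ H₂)
    (hμ : IsIsotropic μ 1) (k : ℕ) (φ : ℝ) :
    ∫ q, firstDer lam h₁
        ((Real.cos φ / √((k + 1 : ℕ) : ℝ)) • ∑ i, q.1 i + (-Real.sin φ) • q.2) (interp k φ q)
        ∂((Measure.pi fun _ : Fin (k + 1) => μ).prod (stdNormal (Fin N)))
      = (√((k + 1 : ℕ) : ℝ))⁻¹ * ∑ i : Fin (k + 1), Real.cos φ *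
        ∫ q, (firstDer lam h₁ (q.1 i) (interp k φ q)
        - Real.sin φ / √((k + 1 : ℕ) : ℝ) * lapl lam h₁ h₂ (interp k φ q))
        ∂((Measure.pi fun _ : Fin (k + 1) => μ).prod (stdNormal (Fin N))) := by
  have hm : HasMoment 4 ((Measure.pi fun _ : Fin (k + 1) => μ).prod (stdNormal (Fin N))) :=
    hμ.moment.pi.prod (hasMoment_stdNormal _ 4)
  set M := (Measure.pi fun _ : Fin (k + 1) => μ).prod (stdNormal (Fin N)) with hM
  have hk : (0 : ℝ) < √((k + 1 : ℕ) : ℝ) := by positivity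
  have gi : ∀ i, Integrable (fun q : (Fin (k + 1) → Fin N → ℝ) × (Fin N → ℝ) =>
      firstDer lam h₁ (q.1 i) (interp k φ q)) M := fun i =>
    (T.polyGrowth_firstDer (fun j => (polyGrowth_apply_apply i j).comp_fst)
      (polyGrowth_interp k φ)).integrable (hm.mono (by norm_num))
  have gz : Integrable (fun q : (Fin (k + 1) → Fin N → ℝ) × (Fin N → ℝ) =>
      firstDer lam h₁ q.2 (interp k φ q)) M :=
    (T.polyGrowth_firstDer (fun j => (PolyGrowth.apply j).comp_snd)
      (polyGrowth_interp k φ)).integrable (hm.mono (by norm_num))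
  have gl : Integrable (fun q => lapl lam h₁ h₂ (interp k φ q)) M :=
    (T.polyGrowth_lapl_interp k φ).integrable (hm.mono (by norm_num))
  have hz : ∫ q, firstDer lam h₁ q.2 (interp k φ q) ∂M
      = Real.cos φ * ∫ q, lapl lam h₁ h₂ (interp k φ q) ∂M := by
    have := T.integral_firstDer_snd (hμ.sumLaw (k + 1) (Real.sin φ / √((k + 1 : ℕ) : ℝ)))
      (Real.cos φ)
    rw [integral_prod_sumLaw, integral_prod_sumLaw] at this
    · exact this
    · exact (T.polyGrowth_lapl.comp_mix _).continuous
    · exact (T.polyGrowth_firstDer polyGrowth_snd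
        fun j => (PolyGrowth.apply j).comp_mix _).continuous
  simp only [firstDer_add, firstDer_smul, firstDer_sum]
  rw [integral_add ((integrable_finsetSum _ fun i _ => gi i).const_mul _) (gz.const_mul _),
    integral_const_mul, integral_const_mul, integral_finsetSum _ fun i _ => gi i, hz]
  simp only [integral_sub (gi _) (gl.const_mul _), integral_const_mul]
  rw [← Finset.mul_sum, Finset.sum_sub_distrib]
  simp only [Finset.sum_const, Finset.card_univ, Fintype.card_fin, nsmul_eq_mul]
  have hsq : ((k + 1 : ℕ) : ℝ) = √((k + 1 : ℕ) : ℝ) * √((k + 1 : ℕ) : ℝ) :=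
    (Real.mul_self_sqrt (by positivity)).symm
  have e : ((k + 1 : ℕ) : ℝ) * (Real.sin φ / √((k + 1 : ℕ) : ℝ) *
      ∫ q, lapl lam h₁ h₂ (interp k φ q) ∂M)
      = √((k + 1 : ℕ) : ℝ) * (Real.sin φ * ∫ q, lapl lam h₁ h₂ (interp k φ q) ∂M) := by
    conv_lhs => rw [hsq]
    rw [Real.sqrt_mul_self hk.le]
    field_simp
  rw [e]
  field_simp
  ring

lemma TestData.abs_integral_firstDer_interp_le (T : TestData lam h h₁ h₂ H₁ H₂)
    (hμ : IsIsotropic μ 1) (k : ℕ) {φ : ℝ} (hs : 0 ≤ Real.sin φ) (hc : 0 ≤ Real.cos φ) :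
    |∫ q, firstDer lam h₁
        ((Real.cos φ / √((k + 1 : ℕ) : ℝ)) • ∑ i, q.1 i + (-Real.sin φ) • q.2) (interp k φ q)
        ∂((Measure.pi fun _ : Fin (k + 1) => μ).prod (stdNormal (Fin N)))|
      ≤ H₂ * (thirdCoeff lam μ / √((k + 1 : ℕ) : ℝ) + fourthCoeff lam μ / ((k + 1 : ℕ) : ℝ))
        * Real.sin φ ^ 2 := by
  have hk : (0 : ℝ) < √((k + 1 : ℕ) : ℝ) := by positivity
  have hH : 0 ≤ H₂ := (abs_nonneg _).trans (T.bound₂ 0)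
  rw [T.integral_firstDer_interp hμ, abs_mul, abs_of_pos (inv_pos.2 hk)]
  have h1 := (Finset.abs_sum_le_sum_abs _ Finset.univ).trans
    (Finset.sum_le_sum fun i _ => T.abs_integral_interp_summand_le hμ k hs hc i)
  rw [Finset.sum_const, Finset.card_univ, Fintype.card_fin, nsmul_eq_mul] at h1
  refine (mul_le_mul_of_nonneg_left h1 (inv_pos.2 hk).le).trans ?_
  have hsq : ((k + 1 : ℕ) : ℝ) = √((k + 1 : ℕ) : ℝ) ^ 2 := (Real.sq_sqrt (by positivity)).symm
  generalize √((k + 1 : ℕ) : ℝ) = R at hk hsq ⊢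
  rw [hsq]
  -- Lets the single profile sin² φ dominate the contributions of both orders.
  have h3 : Real.sin φ ^ 3 ≤ Real.sin φ ^ 2 :=
    pow_le_pow_of_le_one hs (Real.sin_le_one φ) (by norm_num)
  have hF := fourthCoeff_nonneg (μ := μ) T.nonneg
  have e : R⁻¹ * (R ^ 2 * (H₂ * ((Real.sin φ / R) ^ 2 * thirdCoeff lam μ
        + (Real.sin φ / R) ^ 3 * fourthCoeff lam μ)))
      = H₂ * (thirdCoeff lam μ / R * Real.sin φ ^ 2
        + fourthCoeff lam μ / R ^ 2 * Real.sin φ ^ 3) := by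
    field_simp
  rw [e, mul_assoc, add_mul]
  exact mul_le_mul_of_nonneg_left (add_le_add le_rfl
    (mul_le_mul_of_nonneg_left h3 (by positivity))) hH

/-- Normal approximation of a quadratic form in a normalised sum of isotropic vectors. -/
theorem TestData.abs_integral_sub_integral_le (T : TestData lam h h₁ h₂ H₁ H₂) {H₀ : ℝ}
    (hb : ∀ x, |h x| ≤ H₀) (hμ : IsIsotropic μ 1) {n : ℕ} (hn : 1 ≤ n) :
    |(∫ v, h (wip lam ((1 / √(n : ℝ)) • ∑ i, v i) ((1 / √(n : ℝ)) • ∑ i, v i))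
          ∂(Measure.pi fun _ : Fin n => μ))
        - ∫ z, h (wip lam z z) ∂(stdNormal (Fin N))|
      ≤ H₂ * (thirdCoeff lam μ / √(n : ℝ) + fourthCoeff lam μ / n) * (Real.pi / 4) := by
  obtain ⟨k, rfl⟩ : ∃ k, n = k + 1 := ⟨n - 1, by omega⟩
  set K := H₂ * (thirdCoeff lam μ / √((k + 1 : ℕ) : ℝ) + fourthCoeff lam μ / ((k + 1 : ℕ) : ℝ))
  set Ψ : ℝ → ℝ := fun φ => ∫ q, h (wip lam (interp k φ q) (interp k φ q))
        ∂((Measure.pi fun _ : Fin (k + 1) => μ).prod (stdNormal (Fin N))) with hΨ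
  have hd : ∀ φ, HasDerivAt Ψ _ φ := fun φ => T.hasDerivAt_integral_interp hb hμ.moment k φ
  have h0 : Ψ 0 = ∫ z, h (wip lam z z) ∂(stdNormal (Fin N)) := by
    simp only [hΨ, interp, mix, Real.sin_zero, Real.cos_zero, zero_div, zero_smul, zero_add,
      one_smul]
    rw [integral_fun_snd (fun z => h (wip lam z z))]
    simp
  have h1 : Ψ (Real.pi / 2) = ∫ v, h (wip lam ((1 / √((k + 1 : ℕ) : ℝ)) • ∑ i, v i)
      ((1 / √((k + 1 : ℕ) : ℝ)) • ∑ i, v i)) ∂(Measure.pi fun _ : Fin (k + 1) => μ) := by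
    simp only [hΨ, interp, mix, Real.sin_pi_div_two, Real.cos_pi_div_two, zero_smul, add_zero]
    rw [integral_fun_fst (fun v : Fin (k + 1) → Fin N → ℝ =>
      h (wip lam ((1 / √((k + 1 : ℕ) : ℝ)) • ∑ i, v i) ((1 / √((k + 1 : ℕ) : ℝ)) • ∑ i, v i)))]
    simp
  -- The antiderivative of sin², whose increment over the quarter circle is π / 4.
  have hB : ∀ φ, HasDerivAt (fun φ => K * ((φ - Real.sin φ * Real.cos φ) / 2))
      (K * Real.sin φ ^ 2) φ := by
    intro φ
    refine (((((hasDerivAt_id φ).sub ((Real.hasDerivAt_sin φ).mul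
      (Real.hasDerivAt_cos φ))).div_const 2).const_mul K)).congr_deriv ?_
    have := Real.sin_sq_add_cos_sq φ
    have hcc : Real.cos φ * Real.cos φ = 1 - Real.sin φ ^ 2 := by linarith
    rw [hcc]; ring
  have key := image_norm_le_of_norm_deriv_right_le_deriv_boundary
    (f := fun φ => Ψ φ - Ψ 0) (a := 0) (b := Real.pi / 2)
    (fun φ _ => ((hd φ).sub_const _).continuousAt.continuousWithinAt)
    (fun φ _ => ((hd φ).sub_const _).hasDerivWithinAt) (by simp) hB
    (fun φ hφ => by
      have hφ' : φ ≤ Real.pi := by linarith [hφ.2, Real.pi_pos]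
      exact T.abs_integral_firstDer_interp_le hμ k (Real.sin_nonneg_of_nonneg_of_le_pi hφ.1 hφ')
        (Real.cos_nonneg_of_neg_pi_div_two_le_of_le (by linarith [hφ.1, Real.pi_pos]) hφ.2.le))
    (x := Real.pi / 2) ⟨by positivity, le_rfl⟩
  rw [Real.norm_eq_abs] at key
  simp only [h1, h0] at key
  refine key.trans (le_of_eq ?_)
  rw [Real.cos_pi_div_two]; ring

end NormalApproximation

/-! ### Reduction to isotropic coordinates -/

section Diagonalisation

variable {ι : Type*} [Fintype ι]

/-- An orthonormal basis, written as a matrix of rows, transports the standard normal law. -/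
lemma map_mulVec_stdNormal_of_orthonormalBasis {κ : Type*} [Fintype κ]
    (b : OrthonormalBasis κ ℝ (EuclideanSpace ℝ ι)) :
    (stdNormal ι).map (fun z => (Matrix.of fun m k => b m k) *ᵥ z) = stdNormal κ := by
  have hm : Measurable (WithLp.toLp 2 : (ι → ℝ) → EuclideanSpace ℝ ι) := by fun_prop
  have hm' : Measurable (WithLp.ofLp : EuclideanSpace ℝ κ → κ → ℝ) := by fun_prop
  have hr : Measurable b.repr := b.repr.continuous.measurable
  have h1 := stdGaussian_map b.repr
  rw [← map_pi_eq_stdGaussian, ← map_pi_eq_stdGaussian, Measure.map_map hr hm] at h1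
  have h2 := congrArg (fun ρ => ρ.map (WithLp.ofLp : EuclideanSpace ℝ κ → κ → ℝ)) h1
  simp only at h2
  rw [Measure.map_map hm' (hr.comp hm), Measure.map_map hm' (by fun_prop)] at h2
  have e1 : ((WithLp.ofLp : EuclideanSpace ℝ κ → κ → ℝ) ∘ WithLp.toLp 2) = id := rfl
  rw [e1, Measure.map_id] at h2
  rw [stdNormal, stdNormal, ← h2]
  congr 1
  ext z m
  simp [b.repr_apply_apply, PiLp.inner_apply, mulVec, dotProduct, mul_comm]

variable [DecidableEq ι]

/-- Spectral theorem with increasing eigenvalues, as a diagonalisation of a quadratic form. -/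
lemma exists_orthogonal_diagonal {B : Matrix ι ι ℝ} (hB : B.PosSemidef) :
    ∃ (R : Matrix (Fin (Fintype.card ι)) ι ℝ) (lam : Fin (Fintype.card ι) → ℝ),
      Monotone lam ∧ (∀ j, 0 ≤ lam j) ∧ R * Rᵀ = 1 ∧ Rᵀ * R = 1 ∧ Rᵀ * diagonal lam * R = B ∧
      (stdNormal ι).map (fun z => R *ᵥ z) = stdNormal (Fin (Fintype.card ι)) := by
  let e₀ := (Fintype.equivFin ι).symm
  let v := hB.isHermitian.eigenvalues ∘ e₀
  let e : Fin (Fintype.card ι) ≃ ι := (Tuple.sort v).trans e₀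
  let b := hB.isHermitian.eigenvectorBasis.reindex e.symm
  let R : Matrix (Fin (Fintype.card ι)) ι ℝ := Matrix.of fun m k => b m k
  have hRR : R * Rᵀ = 1 := by
    ext m m'
    have := orthonormal_iff_ite.1 b.orthonormal m' m
    rw [PiLp.inner_apply] at this
    rw [mul_apply, one_apply]
    simp only [R, transpose_apply, of_apply]
    simpa [eq_comm] using this
  have hRR' : Rᵀ * R = 1 := (mul_eq_one_comm_of_card_eq _ _ _ (by simp)).1 hRR
  refine ⟨R, v ∘ Tuple.sort v, Tuple.monotone_sort v, fun j => hB.eigenvalues_nonneg _, hRR, hRR',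
    ?_, map_mulVec_stdNormal_of_orthonormalBasis b⟩
  have h1 : Rᵀ * diagonal (v ∘ Tuple.sort v) = B * Rᵀ := by
    ext j m
    have := congrFun (hB.isHermitian.mulVec_eigenvectorBasis (e m)) j
    simp only [mulVec, dotProduct, Pi.smul_apply, smul_eq_mul] at this
    rw [mul_diagonal, mul_apply]
    simp only [R, transpose_apply, of_apply, b, OrthonormalBasis.reindex_apply, Equiv.symm_symm]
    rw [this, mul_comm]
    rfl
  rw [h1, Matrix.mul_assoc, hRR', Matrix.mul_one]

lemma dotProduct_mulVec_of_orthogonal {κ : Type*} [Fintype κ] {R : Matrix κ ι ℝ}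
    (hR : Rᵀ * R = 1) (a b : ι → ℝ) : (R *ᵥ a) ⬝ᵥ (R *ᵥ b) = a ⬝ᵥ b := by
  rw [dotProduct_mulVec, vecMul_mulVec, hR, vecMul_one]

lemma integral_pow_four_dotProduct {N : ℕ} (c : Fin N → ℝ) :
    ∫ z, (c ⬝ᵥ z) ^ 4 ∂(stdNormal (Fin N)) = 3 * (c ⬝ᵥ c) ^ 2 := by
  have e : ∀ z : Fin N → ℝ, (c ⬝ᵥ z) ^ 4 = ∑ i, c i * (z i * (c ⬝ᵥ z) ^ 3) := by
    intro z
    rw [pow_succ', show (c ⬝ᵥ z) * (c ⬝ᵥ z) ^ 3 = (∑ i, c i * z i) * (c ⬝ᵥ z) ^ 3 from rfl,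
      Finset.sum_mul]
    exact Finset.sum_congr rfl fun i _ => by ring
  have hg := polyGrowth_dotProduct c
  have hs : ∀ i, ∫ z, z i * (c ⬝ᵥ z) ^ 3 ∂(stdNormal (Fin N)) = 3 * c i * (c ⬝ᵥ c) := by
    intro i
    rw [integral_coord_mul_stdNormal (k := 3) i (f' := fun z => 3 * c i * (c ⬝ᵥ z) ^ 2)
      (hg.pow 3) (((hg.pow 2).const_mul _).mono (by norm_num)) fun z => ?_,
      integral_const_mul, integral_dotProduct_sq_stdNormal]
    have := hasLineDerivAt_dotProduct c z i
    unfold HasLineDerivAt at this ⊢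
    refine (this.pow 3).congr_deriv ?_
    simp; ring
  simp only [e]
  rw [integral_finsetSum _ fun i _ => (((PolyGrowth.apply i).mul (hg.pow 3)).const_mul
    (c i)).integrable (hasMoment_stdNormal _ _)]
  simp only [integral_const_mul, hs]
  rw [sq, ← mul_assoc]
  nth_rewrite 2 [dotProduct]
  rw [Finset.mul_sum, Finset.sum_mul]
  exact Finset.sum_congr rfl fun i _ => by ring

/-- The difference of the two sides factors as |x| (|x| − r)² (|x| + 2 r) / (2 r³), so they touch at
|x| = r. Integrated, this bounds a first absolute moment below by the second and fourth moments. -/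
lemma three_mul_sq_div_le_abs (x : ℝ) {r : ℝ} (hr : 0 < r) :
    3 / (2 * r) * x ^ 2 - 1 / (2 * r ^ 3) * x ^ 4 ≤ |x| := by
  have hx : |x| - (3 / (2 * r) * |x| ^ 2 - 1 / (2 * r ^ 3) * |x| ^ 4)
      = |x| * (|x| - r) ^ 2 * (|x| + 2 * r) / (2 * r ^ 3) := by
    field_simp
    ring
  have h0 : 0 ≤ |x| * (|x| - r) ^ 2 * (|x| + 2 * r) / (2 * r ^ 3) := by positivity
  have h4 : |x| ^ 4 = x ^ 4 := by
    rw [show 4 = 2 * 2 from rfl, pow_mul, sq_abs, ← pow_mul]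
  rw [← hx, sq_abs, h4] at h0
  linarith

/-- A lower bound for the first absolute moment of a Gaussian variable. -/
lemma sqrt_dotProduct_self_le_integral_abs (c : ι → ℝ) :
    √(c ⬝ᵥ c) ≤ √3 * ∫ z, |c ⬝ᵥ z| ∂(stdNormal ι) := by
  -- The zero matrix is diagonalised only to obtain an orthogonal change of variables to coordinates
  -- indexed by `Fin`, where the Gaussian moments were computed.
  obtain ⟨R, -, -, -, -, hR, -, hmap⟩ := exists_orthogonal_diagonal (ι := ι) (B := 0) .zero
  have hRm : Measurable fun z : ι → ℝ => R *ᵥ z := by fun_prop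
  set a := R *ᵥ c with ha
  have e : ∫ z, |c ⬝ᵥ z| ∂(stdNormal ι) = ∫ z, |a ⬝ᵥ z| ∂(stdNormal (Fin (Fintype.card ι))) := by
    rw [← hmap, integral_map hRm.aemeasurable
      (polyGrowth_dotProduct a).abs.continuous.aestronglyMeasurable]
    simp only [ha, dotProduct_mulVec_of_orthogonal hR]
  rw [e, ← dotProduct_mulVec_of_orthogonal hR c c, ← ha]
  have hv0 : 0 ≤ a ⬝ᵥ a := Finset.sum_nonneg fun i _ => mul_self_nonneg _
  rcases hv0.eq_or_lt with hv | hv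
  · rw [← hv, Real.sqrt_zero]
    exact mul_nonneg (Real.sqrt_nonneg _) (integral_nonneg fun _ => abs_nonneg _)
  have hg := polyGrowth_dotProduct a
  have i2 := (hg.pow 2).integrable (hasMoment_stdNormal _ _)
  have i4 := (hg.pow 4).integrable (hasMoment_stdNormal _ _)
  -- With v = a ⬝ᵥ a the integrated lower bound is 3 v / (2 r) − 3 v² / (2 r³); this r maximises it,
  -- with value v / r.
  set r := √3 * √(a ⬝ᵥ a) with hr
  have hr0 : 0 < r := by positivity
  have hr2 : r ^ 2 = 3 * (a ⬝ᵥ a) := by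
    rw [hr, mul_pow, Real.sq_sqrt (by norm_num), Real.sq_sqrt hv.le]
  have h1 := integral_mono ((i2.const_mul (3 / (2 * r))).sub (i4.const_mul (1 / (2 * r ^ 3))))
    (hg.abs.integrable (hasMoment_stdNormal _ _)) fun z => three_mul_sq_div_le_abs (a ⬝ᵥ z) hr0
  have h2 : ∫ z, (3 / (2 * r) * (a ⬝ᵥ z) ^ 2 - 1 / (2 * r ^ 3) * (a ⬝ᵥ z) ^ 4)
      ∂(stdNormal (Fin (Fintype.card ι))) = (a ⬝ᵥ a) / r := by
    rw [integral_sub (i2.const_mul _) (i4.const_mul _), integral_const_mul, integral_const_mul,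
      integral_dotProduct_sq_stdNormal, integral_pow_four_dotProduct]
    have : a ⬝ᵥ a = r ^ 2 / 3 := by linarith
    rw [this]
    field_simp
    norm_num
  have h3 : (a ⬝ᵥ a) / r ≤ ∫ z, |a ⬝ᵥ z| ∂(stdNormal (Fin (Fintype.card ι))) := by
    rw [← h2]; exact h1
  have h4 : √3 * ((a ⬝ᵥ a) / r) = √(a ⬝ᵥ a) := by
    rw [hr]
    nth_rewrite 1 [← Real.mul_self_sqrt hv.le]
    field_simp
  rw [← h4]
  exact mul_le_mul_of_nonneg_left h3 (Real.sqrt_nonneg _)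

end Diagonalisation

/-! ### The square root of the information matrix -/

section Sqrt

variable {ι : Type*} [Fintype ι] [DecidableEq ι] {I : Matrix ι ι ℝ}

lemma sqrt_mul_sqrt (hI : I.PosDef) : CFC.sqrt I * CFC.sqrt I = I :=
  CFC.sqrt_mul_sqrt_self I hI.posSemidef.nonneg

lemma transpose_sqrt : (CFC.sqrt I)ᵀ = CFC.sqrt I := by
  have h : (CFC.sqrt I).PosSemidef := (CFC.sqrt_nonneg I).posSemidef
  rw [← conjTranspose_eq_transpose_of_trivial]
  exact h.isHermitian

lemma isUnit_det_sqrt (hI : I.PosDef) : IsUnit (CFC.sqrt I).det := by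
  have h := congrArg det (sqrt_mul_sqrt hI)
  rw [det_mul] at h
  exact isUnit_of_mul_isUnit_left (h ▸ (hI.det_pos.ne').isUnit)

/-- Entry (s, s) of S⁻¹ S is 1, so by Cauchy–Schwarz the norms of row s of S⁻¹ and column s of S
have product at least 1. The column has squared norm I s s ≤ tr I, and the norm of the row is at
most √3 times the Gaussian absolute moment. -/
lemma one_le_gaussAbs_mul (hI : I.PosDef) (s : ι) : 1 ≤ √3 * gaussAbs I s * √I.trace := by
  set S := CFC.sqrt I with hS
  have h1 : (S⁻¹ * S) s s = 1 := by rw [nonsing_inv_mul _ (isUnit_det_sqrt hI), one_apply_eq]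
  have h2 : ∑ k, S k s ^ 2 = I s s := by
    rw [← sqrt_mul_sqrt hI, ← hS, mul_apply]
    refine Finset.sum_congr rfl fun k _ => ?_
    have : S s k = S k s := by
      conv_lhs => rw [hS, ← transpose_sqrt (I := I)]
      rfl
    rw [this, sq]
  have h3 : I s s ≤ I.trace :=
    Finset.single_le_sum (f := fun k => I k k) (fun k _ => (hI.diag_pos (i := k)).le)
      (Finset.mem_univ s)
  have h4 := Real.sum_mul_le_sqrt_mul_sqrt Finset.univ (fun k => S⁻¹ s k) (fun k => S k s)
  rw [mul_apply] at h1
  rw [h1, h2] at h4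
  refine h4.trans (mul_le_mul ?_ (Real.sqrt_le_sqrt h3) (Real.sqrt_nonneg _) ?_)
  · have := sqrt_dotProduct_self_le_integral_abs (fun k => S⁻¹ s k)
    refine le_trans (le_of_eq ?_) this
    simp only [dotProduct, sq]
  · exact mul_nonneg (Real.sqrt_nonneg _) (integral_nonneg fun _ => abs_nonneg _)

end Sqrt

/-! ### Normal approximation for a general covariance and quadratic form -/

section General

variable {ι : Type*} [Fintype ι] [DecidableEq ι] {I A : Matrix ι ι ℝ}

lemma wip_eq_dotProduct_diagonal {N : ℕ} (lam a b : Fin N → ℝ) :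
    wip lam a b = a ⬝ᵥ (diagonal lam *ᵥ b) := by
  simp only [wip, dotProduct, mulVec_diagonal]
  exact Finset.sum_congr rfl fun j _ => by ring

lemma norm_mulVec_le {ι κ : Type*} [Fintype ι] [Fintype κ] (M : Matrix κ ι ℝ) (y : ι → ℝ) :
    ‖M *ᵥ y‖ ≤ (∑ m, ∑ j, |M m j|) * ‖y‖ := by
  refine (pi_norm_le_iff_of_nonneg (by positivity)).2 fun m => ?_
  rw [Real.norm_eq_abs, mulVec, dotProduct]
  calc |∑ j, M m j * y j| ≤ ∑ j, |M m j| * ‖y‖ :=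
        (Finset.abs_sum_le_sum_abs _ _).trans (Finset.sum_le_sum fun j _ => by
          rw [abs_mul]
          exact mul_le_mul_of_nonneg_left (norm_le_pi_norm y j) (abs_nonneg _))
    _ = (∑ j, |M m j|) * ‖y‖ := (Finset.sum_mul _ _ _).symm
    _ ≤ (∑ m, ∑ j, |M m j|) * ‖y‖ := mul_le_mul_of_nonneg_right
        (Finset.single_le_sum (f := fun m => ∑ j, |M m j|)
          (fun _ _ => Finset.sum_nonneg fun _ _ => abs_nonneg _) (Finset.mem_univ m))
        (norm_nonneg y)

/-- The image of a centred law with covariance `I` under `M` is isotropic if `M I Mᵀ = 1`. -/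
lemma isIsotropic_map_mulVec {ι : Type*} [Fintype ι] {I : Matrix ι ι ℝ} {N : ℕ}
    {M : Matrix (Fin N) ι ℝ} {μ₀ : Measure (ι → ℝ)}
    [IsProbabilityMeasure μ₀] (hm : HasMoment 4 μ₀) (hmean : ∀ j, ∫ y, y j ∂μ₀ = 0)
    (hcov : ∀ j k, ∫ y, y j * y k ∂μ₀ = I j k) (hM : M * I * Mᵀ = 1) :
    IsIsotropic (μ₀.map fun y => M *ᵥ y) 1 := by
  have hc : Continuous fun y : ι → ℝ => M *ᵥ y := by fun_prop
  refine ⟨hm.map hc (A := ∑ m, ∑ j, |M m j|) fun y => ?_, fun m => ?_, fun m m' => ?_⟩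
  · refine (norm_mulVec_le M y).trans (mul_le_mul_of_nonneg_left (by linarith) (by positivity))
  · rw [integral_map hc.measurable.aemeasurable (continuous_apply m).aestronglyMeasurable]
    simp only [mulVec, dotProduct]
    rw [integral_finsetSum _ fun j _ => ((PolyGrowth.apply j).const_mul _).integrable
      (hm.mono (by norm_num))]
    simp [integral_const_mul, hmean]
  · rw [integral_map hc.measurable.aemeasurable (Continuous.aestronglyMeasurable (by fun_prop))]
    have hi : ∀ j k, Integrable (fun y : ι → ℝ => M m j * M m' k * (y j * y k)) μ₀ := fun j k =>
      (((PolyGrowth.apply j).mul (PolyGrowth.apply k)).const_mul _).integrable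
        (hm.mono (by norm_num))
    have e : ∀ y : ι → ℝ, (M *ᵥ y) m * (M *ᵥ y) m'
        = ∑ j, ∑ k, M m j * M m' k * (y j * y k) := by
      intro y
      simp only [mulVec, dotProduct, Finset.sum_mul_sum]
      exact Finset.sum_congr rfl fun j _ => Finset.sum_congr rfl fun k _ => by ring
    simp only [e]
    rw [integral_finsetSum _ fun j _ => integrable_finsetSum _ fun k _ => hi j k,
      Finset.sum_congr rfl fun j _ => integral_finsetSum _ fun k _ => hi j k]
    simp only [integral_const_mul, hcov]
    have h1 := congrFun (congrFun hM m) m'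
    rw [one_apply, mul_apply] at h1
    simp only [mul_apply, transpose_apply, Finset.sum_mul] at h1
    rw [← h1, Finset.sum_comm]
    exact Finset.sum_congr rfl fun j _ => Finset.sum_congr rfl fun k _ => by ring

lemma IsIsotropic.integral_wip {N : ℕ} {lam : Fin N → ℝ} {μ : Measure (Fin N → ℝ)}
    (hμ : IsIsotropic μ 1) : ∫ y, wip lam y y ∂μ = ∑ j, lam j := by
  simp only [wip, mul_assoc]
  rw [integral_finsetSum _ fun j _ => (((PolyGrowth.apply j).mul
    (PolyGrowth.apply j)).const_mul _).integrable (hμ.moment.mono (by norm_num))]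
  simp [integral_const_mul, hμ.cov]

/-- Let R diagonalise S A S and put M = R S⁻¹. Then M I Mᵀ = R Rᵀ = 1 and Mᵀ diag(lam) M = A, so M
makes the law isotropic and turns Q into the weighted square. The same M sends S z to R z, which is
again standard normal. -/
lemma abs_integral_quadratic_sub_le (hI : I.PosDef) (hA : A.PosSemidef) {μ₀ : Measure (ι → ℝ)}
    [IsProbabilityMeasure μ₀] (hm : HasMoment 4 μ₀) (hmean : ∀ j, ∫ y, y j ∂μ₀ = 0)
    (hcov : ∀ j k, ∫ y, y j * y k ∂μ₀ = I j k) {Q : (ι → ℝ) → ℝ}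
    (hQ : ∀ y, Q y = y ⬝ᵥ (A *ᵥ y)) {h h₁ h₂ : ℝ → ℝ} {H₀ H₁ H₂ : ℝ}
    (hd₁ : ∀ x, HasDerivAt h (h₁ x) x) (hd₂ : ∀ x, HasDerivAt h₁ (h₂ x) x) (hc₂ : Continuous h₂)
    (hb : ∀ x, |h x| ≤ H₀) (hb₁ : ∀ x, |h₁ x| ≤ H₁) (hb₂ : ∀ x, |h₂ x| ≤ H₂)
    {n : ℕ} (hn : 1 ≤ n) :
    |(∫ v, h (Q ((1 / √(n : ℝ)) • ∑ i, v i)) ∂(Measure.pi fun _ : Fin n => μ₀))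
        - ∫ z, h (Q (CFC.sqrt I *ᵥ z)) ∂(stdNormal ι)|
      ≤ H₂ * ((24 * √(∫ y, Q y ∂μ₀) * (∫ y, √(Q y) ^ 3 ∂μ₀)
            + 48 * (∫ y, Q y ∂μ₀) * √(∫ y, Q y ∂μ₀) * ∫ y, √(Q y) ∂μ₀) / √(n : ℝ)
          + ((2 * √(Fintype.card ι) + 2) * (∫ y, √(Q y) ^ 4 ∂μ₀)
            + (6 * √(Fintype.card ι) + 6) * (∫ y, Q y ∂μ₀) * ∫ y, √(Q y) ^ 2 ∂μ₀) / n)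
        * (Real.pi / 4) := by
  set S := CFC.sqrt I with hS
  have hST : Sᵀ = S := transpose_sqrt
  have hSi : S * S⁻¹ = 1 := mul_nonsing_inv _ (isUnit_det_sqrt hI)
  have hSi' : S⁻¹ * S = 1 := nonsing_inv_mul _ (isUnit_det_sqrt hI)
  have hSS : S * S = I := sqrt_mul_sqrt hI
  have hB : (S * A * S).PosSemidef := by
    have := hA.conjTranspose_mul_mul_same S
    rwa [conjTranspose_eq_transpose_of_trivial, hST] at this
  obtain ⟨R, lam, hmono, hnn, hRR, -, hdiag, hmap⟩ := exists_orthogonal_diagonal hB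
  set M := R * S⁻¹ with hMdef
  have hSiT : (S⁻¹)ᵀ = S⁻¹ := by rw [transpose_nonsing_inv, hST]
  have hMS : M * S = R := by rw [hMdef, Matrix.mul_assoc, hSi', Matrix.mul_one]
  have hMI : M * I * Mᵀ = 1 := by
    calc M * I * Mᵀ = (M * S) * (M * S)ᵀ := by
          rw [transpose_mul M, hST, ← hSS]; simp only [Matrix.mul_assoc]
      _ = 1 := by rw [hMS, hRR]
  have hMA : Mᵀ * diagonal lam * M = A := by
    calc Mᵀ * diagonal lam * M = S⁻¹ * (Rᵀ * diagonal lam * R) * S⁻¹ := by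
          rw [hMdef, transpose_mul, hSiT]; simp only [Matrix.mul_assoc]
      _ = (S⁻¹ * S) * A * (S * S⁻¹) := by rw [hdiag]; simp only [Matrix.mul_assoc]
      _ = A := by rw [hSi, hSi', Matrix.one_mul, Matrix.mul_one]
  have hwip : ∀ y, wip lam (M *ᵥ y) (M *ᵥ y) = Q y := by
    intro y
    rw [wip_eq_dotProduct_diagonal, hQ, ← hMA, ← mulVec_mulVec y (Mᵀ * diagonal lam) M,
      ← mulVec_mulVec (M *ᵥ y) Mᵀ (diagonal lam), dotProduct_mulVec y, vecMul_transpose]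
  have hwipS : ∀ z, wip lam (R *ᵥ z) (R *ᵥ z) = Q (S *ᵥ z) := by
    intro z
    rw [← hwip, mulVec_mulVec, hMS]
  have T : TestData lam h h₁ h₂ H₁ H₂ := ⟨hnn, hmono, hd₁, hd₂, hc₂, hb₁, hb₂⟩
  have hMc : Continuous fun y : ι → ℝ => M *ᵥ y := by fun_prop
  have hMm := hMc.measurable
  have hiso := isIsotropic_map_mulVec hm hmean hcov hMI
  have : IsProbabilityMeasure (μ₀.map fun y => M *ᵥ y) :=
    Measure.isProbabilityMeasure_map hMm.aemeasurable
  set μ := μ₀.map fun y => M *ᵥ y with hμ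
  have key := T.abs_integral_sub_integral_le hb hiso hn
  have tr : ∀ f : ℝ → ℝ, Continuous f → ∫ y, f (wip lam y y) ∂μ = ∫ y, f (Q y) ∂μ₀ := by
    intro f hf
    have hfc : Continuous fun y => f (wip lam y y) :=
      hf.comp (continuous_wip lam continuous_id continuous_id)
    rw [hμ, integral_map hMm.aemeasurable
      hfc.aestronglyMeasurable]
    simp only [hwip]
  have hpi : Measure.pi (fun _ : Fin n => μ)
      = (Measure.pi fun _ : Fin n => μ₀).map fun v i => M *ᵥ v i :=
    (Measure.pi_map_pi (μ := fun _ : Fin n => μ₀) (f := fun _ y => M *ᵥ y)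
      fun _ => hMm.aemeasurable).symm
  have e1 : ∫ v, h (wip lam ((1 / √(n : ℝ)) • ∑ i, v i) ((1 / √(n : ℝ)) • ∑ i, v i))
        ∂(Measure.pi fun _ : Fin n => μ)
      = ∫ v, h (Q ((1 / √(n : ℝ)) • ∑ i, v i)) ∂(Measure.pi fun _ : Fin n => μ₀) := by
    rw [hpi, integral_map]
    · simp only [← hwip, mulVec_smul, mulVec_sum]
    · exact (Continuous.measurable (by fun_prop)).aemeasurable
    · have hcs := continuous_smul_sum (N := Fintype.card ι) n (1 / √(n : ℝ))
      exact (T.continuous.comp (continuous_wip lam hcs hcs)).aestronglyMeasurable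
  have e2 : ∫ z, h (wip lam z z) ∂(stdNormal (Fin (Fintype.card ι)))
      = ∫ z, h (Q (S *ᵥ z)) ∂(stdNormal ι) := by
    have hfc : Continuous fun y => h (wip lam y y) :=
      T.continuous.comp (continuous_wip lam continuous_id continuous_id)
    have hRm : Measurable fun z : ι → ℝ => R *ᵥ z := by fun_prop
    rw [← hmap, integral_map hRm.aemeasurable hfc.aestronglyMeasurable]
    simp only [hwipS]
  -- The total weight is the mean of the quadratic form, so the eigenvalues disappear from the final
  -- estimate.
  have e3 : ∑ j, lam j = ∫ y, Q y ∂μ₀ := by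
    rw [← hiso.integral_wip, tr (fun x => x) continuous_id]
  rw [e1, e2] at key
  simp only [thirdCoeff, fourthCoeff, wnorm, e3] at key
  rw [tr (fun x => √x ^ 3) (by fun_prop), tr (fun x => √x) (by fun_prop),
    tr (fun x => √x ^ 4) (by fun_prop), tr (fun x => √x ^ 2) (by fun_prop)] at key
  exact key

end General

/-! ### The quadratic form -/

section QuadForm

variable {r q : ℕ}

/-- The matrix of the linear map `(x, y) ↦ x - D y`. -/
def residualMatrix (D : Matrix (Fin r) (Fin q) ℝ) : Matrix (Fin r) (Fin r ⊕ Fin q) ℝ :=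
  fromCols 1 (-D)

/-- The matrix of the quadratic form `quadForm U D`. -/
def quadMatrix (U : Matrix (Fin r) (Fin r) ℝ) (D : Matrix (Fin r) (Fin q) ℝ) :
    Matrix (Fin r ⊕ Fin q) (Fin r ⊕ Fin q) ℝ :=
  (residualMatrix D)ᵀ * U * residualMatrix D

lemma quadForm_eq (U : Matrix (Fin r) (Fin r) ℝ) (D : Matrix (Fin r) (Fin q) ℝ)
    (w : Fin r ⊕ Fin q → ℝ) : quadForm U D w = w ⬝ᵥ (quadMatrix U D *ᵥ w) := by
  have h : (fun i => w (Sum.inl i)) - D *ᵥ (fun i => w (Sum.inr i)) = residualMatrix D *ᵥ w := by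
    rw [residualMatrix, fromCols_mulVec, one_mulVec, neg_mulVec, sub_eq_add_neg]
    rfl
  simp only [quadForm, h]
  rw [quadMatrix, ← mulVec_mulVec w _ (residualMatrix D), ← mulVec_mulVec _ _ U,
    dotProduct_mulVec w, vecMul_transpose]

lemma posSemidef_quadMatrix {U : Matrix (Fin r) (Fin r) ℝ} (hU : U.PosSemidef)
    (D : Matrix (Fin r) (Fin q) ℝ) : (quadMatrix U D).PosSemidef := by
  have := hU.conjTranspose_mul_mul_same (residualMatrix D)
  rwa [conjTranspose_eq_transpose_of_trivial] at this

lemma quadMatrix_eq_fromBlocks (U : Matrix (Fin r) (Fin r) ℝ) (D : Matrix (Fin r) (Fin q) ℝ) :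
    quadMatrix U D = fromBlocks U (-(U * D)) (-(Dᵀ * U)) (Dᵀ * U * D) := by
  rw [quadMatrix, residualMatrix, transpose_fromCols, fromRows_mul, fromRows_mul_fromCols]
  simp

lemma abs_le_rowSumNorm {κ₁ κ₂ : Type*} [Finite κ₁] [Fintype κ₂] (A : Matrix κ₁ κ₂ ℝ) (i : κ₁)
    (j : κ₂) : |A i j| ≤ rowSumNorm A :=
  (Finset.single_le_sum (f := fun j => |A i j|) (fun _ _ => abs_nonneg _)
    (Finset.mem_univ j)).trans (le_ciSup (f := fun i => ∑ j, |A i j|)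
      (Set.finite_range _).bddAbove i)

/-- The off-diagonal blocks −U D and −Dᵀ U are transposes of each other, so three matrix norms
control all four blocks. -/
lemma abs_quadMatrix_le {U : Matrix (Fin r) (Fin r) ℝ} (hU : U.PosSemidef)
    (D : Matrix (Fin r) (Fin q) ℝ) (j k : Fin r ⊕ Fin q) : |quadMatrix U D j k| ≤ cConst U D := by
  have hUT : Uᵀ = U := by
    rw [← conjTranspose_eq_transpose_of_trivial]
    exact hU.isHermitian
  have hs : ∀ i l, (U * D) i l = (Dᵀ * U) l i := by
    intro i l
    have : (U * D)ᵀ = Dᵀ * U := by rw [transpose_mul, hUT]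
    rw [← this, transpose_apply]
  rw [quadMatrix_eq_fromBlocks]
  rcases j with j | j <;> rcases k with k | k
  · exact (abs_le_rowSumNorm U j k).trans (le_max_left _ _)
  · rw [fromBlocks_apply₁₂, Matrix.neg_apply, abs_neg, hs]
    exact (abs_le_rowSumNorm (Dᵀ * U) k j).trans ((le_max_right _ _).trans (le_max_right _ _))
  · rw [fromBlocks_apply₂₁, Matrix.neg_apply, abs_neg]
    exact (abs_le_rowSumNorm (Dᵀ * U) j k).trans ((le_max_right _ _).trans (le_max_right _ _))
  · rw [fromBlocks_apply₂₂]
    exact (abs_le_rowSumNorm (Dᵀ * U * D) j k).trans ((le_max_left _ _).trans (le_max_right _ _))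

lemma cConst_nonneg (U : Matrix (Fin r) (Fin r) ℝ) (D : Matrix (Fin r) (Fin q) ℝ) :
    0 ≤ cConst U D :=
  le_max_of_le_left (Real.iSup_nonneg fun _ => Finset.sum_nonneg fun _ _ => abs_nonneg _)

end QuadForm

/-! ### Comparison of moments -/

section Moments

variable {ι : Type*} [Fintype ι] {A I : Matrix ι ι ℝ} {Q : (ι → ℝ) → ℝ} {c : ℝ}

/-- The `ℓ¹`-norm of a vector. -/
def absSum (y : ι → ℝ) : ℝ := ∑ j, |y j|

/-- The squared Euclidean norm of a vector. -/
def sqSum (y : ι → ℝ) : ℝ := ∑ j, y j ^ 2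

lemma absSum_nonneg (y : ι → ℝ) : 0 ≤ absSum y := Finset.sum_nonneg fun _ _ => abs_nonneg _

lemma sqSum_nonneg (y : ι → ℝ) : 0 ≤ sqSum y := Finset.sum_nonneg fun _ _ => sq_nonneg _

lemma absSum_sq_le (y : ι → ℝ) : absSum y ^ 2 ≤ Fintype.card ι * sqSum y := by
  have := sq_sum_le_card_mul_sum_sq (s := Finset.univ) (f := fun j => |y j|)
  simpa [absSum, sqSum] using this

lemma polyGrowth_absSum : PolyGrowth 1 (absSum (ι := ι)) :=
  PolyGrowth.sum _ fun j _ => (PolyGrowth.apply j).abs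

lemma polyGrowth_sqSum : PolyGrowth 2 (sqSum (ι := ι)) :=
  PolyGrowth.sum _ fun j _ => (PolyGrowth.apply j).pow 2

lemma quadratic_le_absSum_sq (hA : ∀ j k, |A j k| ≤ c) (y : ι → ℝ) :
    y ⬝ᵥ (A *ᵥ y) ≤ c * absSum y ^ 2 := by
  rw [sq, absSum, Finset.sum_mul_sum, Finset.mul_sum, dotProduct]
  refine Finset.sum_le_sum fun j _ => ?_
  rw [mulVec, dotProduct, Finset.mul_sum, Finset.mul_sum]
  refine Finset.sum_le_sum fun k _ => ?_
  calc y j * (A j k * y k) ≤ |y j * (A j k * y k)| := le_abs_self _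
    _ = |A j k| * (|y j| * |y k|) := by rw [abs_mul, abs_mul]; ring
    _ ≤ c * (|y j| * |y k|) := mul_le_mul_of_nonneg_right (hA j k) (by positivity)

lemma polyGrowth_quadratic (A : Matrix ι ι ℝ) : PolyGrowth 2 (fun y : ι → ℝ => y ⬝ᵥ (A *ᵥ y)) :=
  PolyGrowth.sum _ fun j _ => (PolyGrowth.apply j).mul
    (PolyGrowth.sum _ fun k _ => (PolyGrowth.apply k).const_mul (A j k))

variable {μ₀ : Measure (ι → ℝ)}

lemma integral_quadratic (hm : HasMoment 2 μ₀) (hcov : ∀ j k, ∫ y, y j * y k ∂μ₀ = I j k) :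
    ∫ y, y ⬝ᵥ (A *ᵥ y) ∂μ₀ = ∑ j, ∑ k, A j k * I j k := by
  have hi : ∀ j k, Integrable (fun y : ι → ℝ => A j k * (y j * y k)) μ₀ := fun j k =>
    (((PolyGrowth.apply j).mul (PolyGrowth.apply k)).const_mul _).integrable hm
  have e : ∀ y : ι → ℝ, y ⬝ᵥ (A *ᵥ y) = ∑ j, ∑ k, A j k * (y j * y k) := by
    intro y
    simp only [mulVec, dotProduct, Finset.mul_sum]
    exact Finset.sum_congr rfl fun j _ => Finset.sum_congr rfl fun k _ => by ring
  simp only [e]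
  rw [integral_finsetSum _ fun j _ => integrable_finsetSum _ fun k _ => hi j k,
    Finset.sum_congr rfl fun j _ => integral_finsetSum _ fun k _ => hi j k]
  simp only [integral_const_mul, hcov]

lemma integral_sqSum (hm : HasMoment 2 μ₀) (hcov : ∀ j k, ∫ y, y j * y k ∂μ₀ = I j k) :
    ∫ y, sqSum y ∂μ₀ = I.trace := by
  simp only [sqSum]
  rw [integral_finsetSum _ fun j _ => ((PolyGrowth.apply j).pow 2).integrable hm]
  simp only [sq, hcov]
  rfl

/-- Weight of the moments in the bound, `tr I + |y|² / n`. -/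
def momentWeight (I : Matrix ι ι ℝ) (n : ℕ) (y : ι → ℝ) : ℝ := I.trace + sqSum y / n

lemma polyGrowth_momentWeight (I : Matrix ι ι ℝ) (n : ℕ) : PolyGrowth 2 (momentWeight I n) := by
  have h1 : PolyGrowth 2 (fun y : ι → ℝ => (n : ℝ)⁻¹ * sqSum y) := polyGrowth_sqSum.const_mul _
  have h2 : PolyGrowth 2 (fun _ : ι → ℝ => I.trace) := PolyGrowth.const _
  have e : momentWeight I n = fun y => I.trace + (n : ℝ)⁻¹ * sqSum y :=
    funext fun y => by rw [momentWeight, div_eq_inv_mul]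
  rw [e]
  exact h2.add h1

/-- The inequality 2 s u ≤ s² + u² with u² = |y|² / n. It trades an extra factor |y| / √n for the
moment weight. -/
lemma sqrt_sqSum_div_sqrt_le {s : ℝ} (hs : 0 < s) (hI : I.trace = s ^ 2) {n : ℕ} (hn : 1 ≤ n)
    (y : ι → ℝ) : √(sqSum y) / √(n : ℝ) ≤ momentWeight I n y / (2 * s) := by
  have hn0 : (0 : ℝ) < n := by exact_mod_cast hn
  rw [momentWeight, hI, ← Real.sqrt_div (sqSum_nonneg y)]
  have h0 : 0 ≤ sqSum y / n := div_nonneg (sqSum_nonneg y) hn0.le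
  rw [le_div_iff₀ (by positivity)]
  nlinarith [sq_nonneg (√(sqSum y / n) - s), Real.sq_sqrt h0]

/-- In the terms of order n^{-1/2} the weight enters through tr I = s² ≤ `momentWeight`. In those of
order n^{-1} one factor √(Q y) / √n is exchanged for `momentWeight` / (2 s). All terms then share
the factor c² d / √n, and the constants add up as 26 = 24 + 2 and 54 = 48 + 6. -/
lemma moment_bound [IsProbabilityMeasure μ₀] [Nonempty ι]
    (hQ : ∀ y, Q y = y ⬝ᵥ (A *ᵥ y)) (hQ0 : ∀ y, 0 ≤ Q y)
    (hA : ∀ j k, |A j k| ≤ c) (hm : HasMoment 5 μ₀)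
    (hcov : ∀ j k, ∫ y, y j * y k ∂μ₀ = I j k) {s : ℝ} (hs : 0 < s) (hI : I.trace = s ^ 2)
    {n : ℕ} (hn : 1 ≤ n) :
    (24 * √(∫ y, Q y ∂μ₀) * (∫ y, √(Q y) ^ 3 ∂μ₀)
            + 48 * (∫ y, Q y ∂μ₀) * √(∫ y, Q y ∂μ₀) * ∫ y, √(Q y) ∂μ₀) / √(n : ℝ)
          + ((2 * √(Fintype.card ι) + 2) * (∫ y, √(Q y) ^ 4 ∂μ₀)
            + (6 * √(Fintype.card ι) + 6) * (∫ y, Q y ∂μ₀) * ∫ y, √(Q y) ^ 2 ∂μ₀) / n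
      ≤ c ^ 2 * Fintype.card ι / √(n : ℝ)
        * ((26 * (∫ y, absSum y ^ 3 * momentWeight I n y ∂μ₀)
          + 54 * (∑ j, ∑ k, |I j k|) * ∫ y, absSum y * momentWeight I n y ∂μ₀) / s) := by
  have hn0 : (0 : ℝ) < n := by exact_mod_cast hn
  obtain ⟨j₀⟩ := ‹Nonempty ι›
  have hc : 0 ≤ c := (abs_nonneg _).trans (hA j₀ j₀)
  have hd1 : (1 : ℝ) ≤ Fintype.card ι := by
    exact_mod_cast Fintype.card_pos_iff.2 ⟨j₀⟩
  set d : ℝ := ((Fintype.card ι : ℕ) : ℝ) with hd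
  set e := √d with he
  have he1 : 1 ≤ e := Real.one_le_sqrt.2 hd1
  have hde : d = e ^ 2 := (Real.sq_sqrt (by linarith)).symm
  set b := √c with hb
  have hb0 : 0 ≤ b := Real.sqrt_nonneg _
  have hcb : c = b ^ 2 := (Real.sq_sqrt hc).symm
  set m := √(n : ℝ) with hmdef
  have hm0 : 0 < m := Real.sqrt_pos.2 hn0
  have hnm : (n : ℝ) = m ^ 2 := (Real.sq_sqrt hn0.le).symm
  set τ := ∑ j, ∑ k, |I j k| with hτ
  have hτ0 : 0 ≤ τ := Finset.sum_nonneg fun _ _ => Finset.sum_nonneg fun _ _ => abs_nonneg _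
  have gQ : PolyGrowth 2 Q := (funext hQ : Q = _) ▸ polyGrowth_quadratic A
  have gR : PolyGrowth 1 (fun y => √(Q y)) := PolyGrowth.sqrt gQ
  have hw : ∀ y, 0 ≤ momentWeight I n y := fun y => by
    rw [momentWeight, hI]; have := sqSum_nonneg y; positivity
  have hwT : ∀ y, s ^ 2 ≤ momentWeight I n y := fun y => by
    rw [momentWeight, hI]
    have : 0 ≤ sqSum y / n := div_nonneg (sqSum_nonneg y) hn0.le
    linarith
  have gw := polyGrowth_momentWeight I n
  have ga := polyGrowth_absSum (ι := ι)
  -- pointwise comparisons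
  have q1 : ∀ y, √(Q y) ≤ b * absSum y := fun y => by
    rw [hb, ← Real.sqrt_sq (absSum_nonneg y), ← Real.sqrt_mul hc, hQ]
    exact Real.sqrt_le_sqrt (quadratic_le_absSum_sq hA y)
  have q0 : ∀ y, Q y ≤ c * d * sqSum y := fun y => by
    rw [hQ, mul_assoc]
    exact (quadratic_le_absSum_sq hA y).trans (mul_le_mul_of_nonneg_left (absSum_sq_le y) hc)
  have q2 : ∀ y, √(Q y) / m ≤ b * e * (momentWeight I n y / (2 * s)) := fun y => by
    have h1 : √(Q y) ≤ b * e * √(sqSum y) := by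
      rw [hb, he, ← Real.sqrt_mul hc, ← Real.sqrt_mul (by positivity)]
      exact Real.sqrt_le_sqrt (q0 y)
    calc √(Q y) / m ≤ b * e * √(sqSum y) / m := div_le_div_of_nonneg_right h1 hm0.le
      _ = b * e * (√(sqSum y) / m) := by ring
      _ ≤ _ := mul_le_mul_of_nonneg_left (sqrt_sqSum_div_sqrt_le hs hI hn y) (by positivity)
  set V₃ := ∫ y, absSum y ^ 3 * momentWeight I n y ∂μ₀ with hV₃
  set V₁ := ∫ y, absSum y * momentWeight I n y ∂μ₀ with hV₁
  have i3 : Integrable (fun y => absSum y ^ 3 * momentWeight I n y) μ₀ :=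
    ((ga.pow 3).mul gw).integrable hm
  have i1 : Integrable (fun y => absSum y * momentWeight I n y) μ₀ :=
    (ga.mul gw).integrable (hm.mono (by norm_num))
  have hV₃0 : 0 ≤ V₃ := integral_nonneg fun y =>
    mul_nonneg (pow_nonneg (absSum_nonneg y) 3) (hw y)
  have hV₁0 : 0 ≤ V₁ := integral_nonneg fun y => mul_nonneg (absSum_nonneg y) (hw y)
  -- the integrals
  have m3 : s ^ 2 * ∫ y, √(Q y) ^ 3 ∂μ₀ ≤ b ^ 3 * V₃ := by
    rw [← integral_const_mul, hV₃, ← integral_const_mul]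
    refine integral_mono (((gR.pow 3).const_mul _).integrable (hm.mono (by norm_num)))
      (i3.const_mul _) fun y => ?_
    have h1 := pow_le_pow_left₀ (Real.sqrt_nonneg _) (q1 y) 3
    calc s ^ 2 * √(Q y) ^ 3 ≤ momentWeight I n y * (b * absSum y) ^ 3 :=
          mul_le_mul (hwT y) h1 (by positivity) (hw y)
      _ = b ^ 3 * (absSum y ^ 3 * momentWeight I n y) := by ring
  have m1 : s ^ 2 * ∫ y, √(Q y) ∂μ₀ ≤ b * V₁ := by
    rw [← integral_const_mul, hV₁, ← integral_const_mul]
    refine integral_mono ((gR.const_mul _).integrable (hm.mono (by norm_num)))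
      (i1.const_mul _) fun y => ?_
    calc s ^ 2 * √(Q y) ≤ momentWeight I n y * (b * absSum y) :=
          mul_le_mul (hwT y) (q1 y) (by positivity) (hw y)
      _ = b * (absSum y * momentWeight I n y) := by ring
  have m4 : (∫ y, √(Q y) ^ 4 ∂μ₀) / m ≤ b ^ 4 * e / (2 * s) * V₃ := by
    rw [← integral_div, hV₃, ← integral_const_mul]
    refine integral_mono (((gR.pow 4).integrable (hm.mono (by norm_num))).div_const _)
      (i3.const_mul _) fun y => ?_
    have h1 := pow_le_pow_left₀ (Real.sqrt_nonneg _) (q1 y) 3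
    have h0 := absSum_nonneg y
    calc √(Q y) ^ 4 / m = √(Q y) ^ 3 * (√(Q y) / m) := by ring
      _ ≤ (b * absSum y) ^ 3 * (b * e * (momentWeight I n y / (2 * s))) :=
          mul_le_mul h1 (q2 y) (by positivity) (by positivity)
      _ = b ^ 4 * e / (2 * s) * (absSum y ^ 3 * momentWeight I n y) := by ring
  have m2 : (∫ y, √(Q y) ^ 2 ∂μ₀) / m ≤ b ^ 2 * e / (2 * s) * V₁ := by
    rw [← integral_div, hV₁, ← integral_const_mul]
    refine integral_mono (((gR.pow 2).integrable (hm.mono (by norm_num))).div_const _)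
      (i1.const_mul _) fun y => ?_
    have h0 := absSum_nonneg y
    calc √(Q y) ^ 2 / m = √(Q y) * (√(Q y) / m) := by ring
      _ ≤ (b * absSum y) * (b * e * (momentWeight I n y / (2 * s))) :=
          mul_le_mul (q1 y) (q2 y) (by positivity) (by positivity)
      _ = b ^ 2 * e / (2 * s) * (absSum y * momentWeight I n y) := by ring
  set σ₂ := ∫ y, Q y ∂μ₀ with hσ₂
  have hσ0 : 0 ≤ σ₂ := integral_nonneg hQ0
  have s1 : σ₂ ≤ b ^ 2 * τ := by
    rw [hσ₂, ← hcb, integral_congr_ae (.of_forall hQ),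
      integral_quadratic (hm.mono (by norm_num)) hcov, hτ, Finset.mul_sum]
    refine Finset.sum_le_sum fun j _ => ?_
    rw [Finset.mul_sum]
    refine Finset.sum_le_sum fun k _ => (le_abs_self _).trans ?_
    rw [abs_mul]
    exact mul_le_mul_of_nonneg_right (hA j k) (abs_nonneg _)
  -- Here the mean of Q is at most c d tr I, because the mean of |y|² is the trace.
  have s2 : √σ₂ ≤ b * e * s := by
    rw [← Real.sqrt_sq (show 0 ≤ b * e * s by positivity)]
    refine Real.sqrt_le_sqrt ?_
    rw [mul_pow, mul_pow, ← hcb, ← hde, ← hI, ← integral_sqSum (hm.mono (by norm_num)) hcov,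
      ← integral_const_mul]
    exact integral_mono (gQ.integrable (hm.mono (by norm_num)))
      ((polyGrowth_sqSum.integrable (hm.mono (by norm_num))).const_mul _) q0
  set J₃ := ∫ y, √(Q y) ^ 3 ∂μ₀
  set J₁ := ∫ y, √(Q y) ∂μ₀
  set J₄ := ∫ y, √(Q y) ^ 4 ∂μ₀
  set J₂ := ∫ y, √(Q y) ^ 2 ∂μ₀
  have hJ₃ : 0 ≤ J₃ := integral_nonneg fun y => by positivity
  have hJ₁ : 0 ≤ J₁ := integral_nonneg fun y => by positivity
  have hJ₂ : 0 ≤ J₂ := integral_nonneg fun y => by positivity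
  have t3 : √σ₂ * J₃ ≤ b ^ 4 * e ^ 2 * (V₃ / s) := by
    have h1 : J₃ ≤ b ^ 3 * V₃ / s ^ 2 := by rw [le_div_iff₀ (by positivity)]; linarith
    calc √σ₂ * J₃ ≤ (b * e * s) * (b ^ 3 * V₃ / s ^ 2) := mul_le_mul s2 h1 hJ₃ (by positivity)
      _ = b ^ 4 * e * (V₃ / s) := by field_simp
      -- A factor e = √d ≥ 1 is given away to match the power of d in the terms of order n^{-1}.
      _ ≤ b ^ 4 * e ^ 2 * (V₃ / s) := by
        have : e ≤ e ^ 2 := by nlinarith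
        gcongr
  have t1 : σ₂ * √σ₂ * J₁ ≤ b ^ 4 * e ^ 2 * (τ * V₁ / s) := by
    have h1 : J₁ ≤ b * V₁ / s ^ 2 := by rw [le_div_iff₀ (by positivity)]; linarith
    calc σ₂ * √σ₂ * J₁ ≤ (b ^ 2 * τ) * (b * e * s) * (b * V₁ / s ^ 2) :=
          mul_le_mul (mul_le_mul s1 s2 (Real.sqrt_nonneg _) (by positivity)) h1 hJ₁ (by positivity)
      _ = b ^ 4 * e * (τ * V₁ / s) := by field_simp
      _ ≤ b ^ 4 * e ^ 2 * (τ * V₁ / s) := by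
        have : e ≤ e ^ 2 := by nlinarith
        gcongr
  have t4 : (2 * e + 2) * (J₄ / m) ≤ 2 * (b ^ 4 * e ^ 2 * (V₃ / s)) := by
    calc (2 * e + 2) * (J₄ / m) ≤ (4 * e) * (b ^ 4 * e / (2 * s) * V₃) :=
          mul_le_mul (by linarith) m4 (by positivity) (by positivity)
      _ = 2 * (b ^ 4 * e ^ 2 * (V₃ / s)) := by field_simp; ring
  have t2 : (6 * e + 6) * σ₂ * (J₂ / m) ≤ 6 * (b ^ 4 * e ^ 2 * (τ * V₁ / s)) := by
    calc (6 * e + 6) * σ₂ * (J₂ / m) ≤ (12 * e) * (b ^ 2 * τ) * (b ^ 2 * e / (2 * s) * V₁) :=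
          mul_le_mul (mul_le_mul (by linarith) s1 hσ0 (by positivity)) m2 (by positivity)
            (by positivity)
      _ = 6 * (b ^ 4 * e ^ 2 * (τ * V₁ / s)) := by field_simp; ring
  have hL : (24 * √σ₂ * J₃ + 48 * σ₂ * √σ₂ * J₁) / m
      + ((2 * e + 2) * J₄ + (6 * e + 6) * σ₂ * J₂) / n
      = (24 * (√σ₂ * J₃) + 48 * (σ₂ * √σ₂ * J₁) + (2 * e + 2) * (J₄ / m)
        + (6 * e + 6) * σ₂ * (J₂ / m)) / m := by
    rw [hnm]; field_simp; ring
  have hR : c ^ 2 * d / m * ((26 * V₃ + 54 * τ * V₁) / s)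
      = (26 * (b ^ 4 * e ^ 2 * (V₃ / s)) + 54 * (b ^ 4 * e ^ 2 * (τ * V₁ / s))) / m := by
    rw [hcb, hde]; ring
  rw [hL, hR]
  exact div_le_div_of_nonneg_right (by linarith) hm0.le

end Moments

/-! ### A lower bound for the right-hand side -/

section LowerBound

variable {ι : Type*} [Fintype ι] {I : Matrix ι ι ℝ} {μ₀ : Measure (ι → ℝ)}

lemma sum_integral_abs_mul {w : (ι → ℝ) → ℝ} (hw : PolyGrowth 2 w) (hm : HasMoment 3 μ₀) :
    ∑ l, ∫ y, |y l| * w y ∂μ₀ = ∫ y, absSum y * w y ∂μ₀ := by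
  simp only [absSum, Finset.sum_mul]
  rw [integral_finsetSum _ fun l _ => ((PolyGrowth.apply l).abs.mul hw).integrable hm]

lemma sum_integral_abs_mul_mul {w : (ι → ℝ) → ℝ} (hw : PolyGrowth 2 w) (hm : HasMoment 5 μ₀) :
    ∑ j, ∑ k, ∑ l, ∫ y, |y j * y k * y l| * w y ∂μ₀ = ∫ y, absSum y ^ 3 * w y ∂μ₀ := by
  have hi : ∀ j k l : ι, Integrable (fun y : ι → ℝ => |y j * y k * y l| * w y) μ₀ := fun j k l =>
    ((((PolyGrowth.apply j).mul (PolyGrowth.apply k)).mul (PolyGrowth.apply l)).abs.mul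
      hw).integrable hm
  have e : ∀ y : ι → ℝ, absSum y ^ 3 * w y = ∑ j, ∑ k, ∑ l, |y j * y k * y l| * w y := by
    intro y
    simp only [abs_mul, ← Finset.sum_mul, ← Finset.mul_sum, absSum]
    ring
  simp only [e]
  rw [integral_finsetSum _ fun j _ => integrable_finsetSum _ fun k _ =>
    integrable_finsetSum _ fun l _ => hi j k l]
  refine Finset.sum_congr rfl fun j _ => ?_
  rw [integral_finsetSum _ fun k _ => integrable_finsetSum _ fun l _ => hi j k l]
  exact Finset.sum_congr rfl fun k _ => (integral_finsetSum _ fun l _ => hi j k l).symm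

/-- The origin of `momentWeight`: summing over t turns the I t t into the trace and the y t ^ 2 into
|y|². -/
lemma sum_four_mul_integral {F : (ι → ℝ) → ℝ} (hF : PolyGrowth 3 F) (hm : HasMoment 5 μ₀)
    (n : ℕ) : ∑ t, (4 * (∫ y, F y ∂μ₀) * I t t + 4 / n * ∫ y, F y * y t ^ 2 ∂μ₀)
      = 4 * ∫ y, F y * momentWeight I n y ∂μ₀ := by
  have i1 : Integrable (fun y => F y * I.trace) μ₀ :=
    (hF.integrable (hm.mono (by norm_num))).mul_const _
  have i2 : ∀ t, Integrable (fun y => F y * y t ^ 2) μ₀ := fun t =>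
    (hF.mul ((PolyGrowth.apply t).pow 2)).integrable hm
  have i3 : Integrable (fun y => F y * sqSum y) μ₀ := (hF.mul polyGrowth_sqSum).integrable hm
  have e : ∀ y, F y * momentWeight I n y = F y * I.trace + F y * sqSum y / n := by
    intro y; rw [momentWeight]; ring
  simp only [e]
  rw [integral_add i1 (i3.div_const _), integral_mul_const, integral_div]
  simp only [sqSum, Finset.mul_sum]
  rw [integral_finsetSum _ fun t _ => i2 t, Finset.sum_add_distrib, ← Finset.mul_sum,
    ← Finset.mul_sum]
  simp only [trace, diag_apply]
  ring

end LowerBound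

section RBound

variable {Ω : Type*} [MeasurableSpace Ω] {P : Measure Ω} {n r q : ℕ}
  {Y : Fin n → Ω → (Fin r ⊕ Fin q) → ℝ} {I : Matrix (Fin r ⊕ Fin q) (Fin r ⊕ Fin q) ℝ}
  {μ₀ : Measure (Fin r ⊕ Fin q → ℝ)}

/-- Only the terms with E(W_t²) and with 1/n are kept; everything dropped is nonnegative. They give
32 = 8 · 4 and 128 = 2 · 16 · 4. The n identical summands cancel the 1/n in front, and the lower
bound on `gaussAbs I s` is uniform in s, so it passes to the minimum. -/
lemma le_rBound [Nonempty (Fin r ⊕ Fin q)] (hn : 1 ≤ n) (hY : ∀ i, AEMeasurable (Y i) P)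
    (hlaw : ∀ i, P.map (Y i) = μ₀) (hm : HasMoment 5 μ₀)
    (hcov : ∀ j k, ∫ y, y j * y k ∂μ₀ = I j k)
    (hW : ∀ t, ∫ ω, normSum Y ω t ^ 2 ∂P = I t t) (hI : I.PosDef)
    (U : Matrix (Fin r) (Fin r) ℝ) (D : Matrix (Fin r) (Fin q) ℝ) :
    32 * cConst U D ^ 2 * ((r : ℝ) + q) / √3
        * (((∫ y, absSum y ^ 3 * momentWeight I n y ∂μ₀)
          + 4 * (∑ j, ∑ k, |I j k|) * ∫ y, absSum y * momentWeight I n y ∂μ₀) / √I.trace)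
      ≤ rBound P Y I U D := by
  have hn0 : (0 : ℝ) < n := by exact_mod_cast hn
  have hc := cConst_nonneg U D
  have hw := polyGrowth_momentWeight I n
  have htr : ∀ i (G : (Fin r ⊕ Fin q → ℝ) → ℝ), Continuous G →
      ∫ ω, G (Y i ω) ∂P = ∫ y, G y ∂μ₀ := by
    intro i G hG
    rw [← hlaw i, integral_map (hY i) hG.aestronglyMeasurable]
  have e3 : ∀ i j k l, ∫ ω, |Y i ω j * Y i ω k * Y i ω l| ∂P = ∫ y, |y j * y k * y l| ∂μ₀ :=
    fun i j k l => htr i (fun y => |y j * y k * y l|) (by fun_prop)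
  have e5 : ∀ i j k l t, ∫ ω, |Y i ω j * Y i ω k * Y i ω l * Y i ω t ^ 2| ∂P
      = ∫ y, |y j * y k * y l| * y t ^ 2 ∂μ₀ := fun i j k l t => by
    rw [← htr i (fun y => |y j * y k * y l| * y t ^ 2) (by fun_prop)]
    simp only [abs_mul _ (_ ^ 2), abs_sq]
  have e1 : ∀ i l, ∫ ω, |Y i ω l| ∂P = ∫ y, |y l| ∂μ₀ :=
    fun i l => htr i (fun y => |y l|) (by fun_prop)
  have e1' : ∀ i l t, ∫ ω, |Y i ω l * Y i ω t ^ 2| ∂P = ∫ y, |y l| * y t ^ 2 ∂μ₀ :=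
    fun i l t => by
    rw [← htr i (fun y => |y l| * y t ^ 2) (by fun_prop)]
    simp only [abs_mul _ (_ ^ 2), abs_sq]
  have e2 : ∀ i j k, ∫ ω, Y i ω j * Y i ω k ∂P = I j k := fun i j k => by
    rw [← hcov, ← htr i (fun y => y j * y k) (by fun_prop)]
  have g3 : ∀ j k l, PolyGrowth 3 (fun y : Fin r ⊕ Fin q → ℝ => |y j * y k * y l|) := fun j k l =>
    (((PolyGrowth.apply j).mul (PolyGrowth.apply k)).mul (PolyGrowth.apply l)).abs
  have g1 : ∀ l, PolyGrowth 3 (fun y : Fin r ⊕ Fin q → ℝ => |y l|) := fun l =>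
    (PolyGrowth.apply l).abs.mono (by norm_num)
  dsimp only [rBound]
  simp only [e3, e5, e1, e1', e2, hW]
  set c := cConst U D
  set d : ℝ := (r : ℝ) + q
  have hd : 0 ≤ d := by positivity
  set V₃ := ∫ y, absSum y ^ 3 * momentWeight I n y ∂μ₀ with hV₃
  set V₁ := ∫ y, absSum y * momentWeight I n y ∂μ₀ with hV₁
  set τ := ∑ j, ∑ k, |I j k| with hτ
  have hw0 : ∀ y, 0 ≤ momentWeight I n y := fun y =>
    add_nonneg (Finset.sum_nonneg fun t _ => (hI.diag_pos (i := t)).le)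
      (div_nonneg (sqSum_nonneg y) hn0.le)
  have hV₃0 : 0 ≤ V₃ := integral_nonneg fun y =>
    mul_nonneg (pow_nonneg (absSum_nonneg y) 3) (hw0 y)
  have hV₁0 : 0 ≤ V₁ := integral_nonneg fun y => mul_nonneg (absSum_nonneg y) (hw0 y)
  have hτ0 : 0 ≤ τ := Finset.sum_nonneg fun _ _ => Finset.sum_nonneg fun _ _ => abs_nonneg _
  have htrpos : 0 < √I.trace := by
    obtain ⟨t⟩ := ‹Nonempty (Fin r ⊕ Fin q)›
    exact Real.sqrt_pos.2 (Finset.sum_pos (fun t _ => hI.diag_pos) ⟨t, Finset.mem_univ t⟩)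
  have hα : ∀ s, 0 ≤ gaussAbs I s := fun s => integral_nonneg fun _ => abs_nonneg _
  have hβ : ∀ s t, 0 ≤ gaussAbsSq I s t / gaussAbs I s := fun s t =>
    div_nonneg (integral_nonneg fun _ => abs_nonneg _) (hα s)
  -- lower bound of one summand
  have hF : ∀ (F : (Fin r ⊕ Fin q → ℝ) → ℝ), PolyGrowth 3 F → (∀ y, 0 ≤ F y) → ∀ s,
      4 * ∫ y, F y * momentWeight I n y ∂μ₀ ≤ ∑ t, (4 * (∫ y, F y ∂μ₀) * I t t
        + 4 / n * (∫ y, F y * y t ^ 2 ∂μ₀) + gaussAbsSq I s t / gaussAbs I s * ∫ y, F y ∂μ₀) := by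
    intro F hF hF0 s
    rw [← sum_four_mul_integral hF hm n]
    refine Finset.sum_le_sum fun t _ => ?_
    have := mul_nonneg (hβ s t) (integral_nonneg (μ := μ₀) hF0)
    linarith
  have hterm : ∀ s j k l, 32 * c * d * (∫ y, |y j * y k * y l| * momentWeight I n y ∂μ₀)
      + 128 * c * d * (|I j k| * ∫ y, |y l| * momentWeight I n y ∂μ₀)
      ≤ (∫ y, |y j * y k * y l| ∂μ₀)
        + 8 * c * d * ∑ t : Fin r ⊕ Fin q,
            (4 * (∫ y, |y j * y k * y l| ∂μ₀) * I t t
              + 4 / n * (∫ y, |y j * y k * y l| * y t ^ 2 ∂μ₀)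
              + gaussAbsSq I s t / gaussAbs I s * (∫ y, |y j * y k * y l| ∂μ₀))
        + 2 * |I j k| *
            ((∫ y, |y l| ∂μ₀)
              + 16 * c * d * ∑ t : Fin r ⊕ Fin q,
                  (4 * (∫ y, |y l| ∂μ₀) * I t t
                    + 4 / n * (∫ y, |y l| * y t ^ 2 ∂μ₀)
                    + gaussAbsSq I s t / gaussAbs I s * (∫ y, |y l| ∂μ₀))) := by
    intro s j k l
    have h3 := mul_le_mul_of_nonneg_left (hF _ (g3 j k l) (fun _ => abs_nonneg _) s)
      (show 0 ≤ 8 * c * d by positivity)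
    have h1 := mul_le_mul_of_nonneg_left (hF _ (g1 l) (fun _ => abs_nonneg _) s)
      (show 0 ≤ 16 * c * d by positivity)
    have p3 : 0 ≤ ∫ y, |y j * y k * y l| ∂μ₀ := integral_nonneg fun _ => abs_nonneg _
    have p1 : 0 ≤ ∫ y, |y l| ∂μ₀ := integral_nonneg fun _ => abs_nonneg _
    have h2 := mul_le_mul_of_nonneg_left (h1.trans (le_add_of_nonneg_left p1))
      (show 0 ≤ 2 * |I j k| by positivity)
    linarith
  have hsum : 32 * c * d * V₃ + 128 * c * d * (τ * V₁)
      = ∑ j, ∑ k, ∑ l, (32 * c * d * (∫ y, |y j * y k * y l| * momentWeight I n y ∂μ₀)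
        + 128 * c * d * (|I j k| * ∫ y, |y l| * momentWeight I n y ∂μ₀)) := by
    simp only [Finset.sum_add_distrib, ← Finset.mul_sum,
      sum_integral_abs_mul hw (hm.mono (by norm_num : 3 ≤ 5)), sum_integral_abs_mul_mul hw hm,
      ← Finset.sum_mul]
    rfl
  have hmin : n * (32 * c * d * (V₃ + 4 * τ * V₁)) / (√3 * √I.trace) ≤
      ⨅ s : Fin r ⊕ Fin q, gaussAbs I s *
    ∑ _i : Fin n, ∑ j : Fin r ⊕ Fin q, ∑ k : Fin r ⊕ Fin q, ∑ l : Fin r ⊕ Fin q,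
      ((∫ y, |y j * y k * y l| ∂μ₀)
        + 8 * c * d * ∑ t : Fin r ⊕ Fin q,
            (4 * (∫ y, |y j * y k * y l| ∂μ₀) * I t t
              + 4 / n * (∫ y, |y j * y k * y l| * y t ^ 2 ∂μ₀)
              + gaussAbsSq I s t / gaussAbs I s * (∫ y, |y j * y k * y l| ∂μ₀))
        + 2 * |I j k| *
            ((∫ y, |y l| ∂μ₀)
              + 16 * c * d * ∑ t : Fin r ⊕ Fin q,
                  (4 * (∫ y, |y l| ∂μ₀) * I t t
                    + 4 / n * (∫ y, |y l| * y t ^ 2 ∂μ₀)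
                    + gaussAbsSq I s t / gaussAbs I s * (∫ y, |y l| ∂μ₀)))) := by
    refine le_ciInf fun s => ?_
    rw [Finset.sum_const, Finset.card_univ, Fintype.card_fin, nsmul_eq_mul]
    have h1 := hsum.le.trans (Finset.sum_le_sum fun j _ => Finset.sum_le_sum fun k _ =>
      Finset.sum_le_sum fun l _ => hterm s j k l)
    refine le_trans ?_ (mul_le_mul_of_nonneg_left
      (mul_le_mul_of_nonneg_left h1 hn0.le) (hα s))
    rw [div_le_iff₀ (by positivity)]
    have hK : 0 ≤ n * (32 * c * d * (V₃ + 4 * τ * V₁)) := by positivity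
    have := mul_le_mul_of_nonneg_right (one_le_gaussAbs_mul hI s) hK
    linarith
  refine le_trans (le_of_eq ?_) (mul_le_mul_of_nonneg_left hmin (div_nonneg hc hn0.le))
  field_simp

end RBound

/-! ### The law and the second moments of the normalised sum -/

section NormSum

variable {Ω : Type*} [MeasurableSpace Ω] {P : Measure Ω} [IsProbabilityMeasure P] {ι : Type*}
  [Fintype ι] {n : ℕ} {Y : Fin n → Ω → ι → ℝ} {μ₀ : Measure (ι → ℝ)}

lemma integral_comp_normSum (hY : ∀ i, AEMeasurable (Y i) P) (hind : iIndepFun Y P)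
    (hlaw : ∀ i, P.map (Y i) = μ₀) {F : (ι → ℝ) → ℝ} (hF : Continuous F) :
    ∫ ω, F (normSum Y ω) ∂P
      = ∫ v, F ((1 / √(n : ℝ)) • ∑ i, v i) ∂(Measure.pi fun _ : Fin n => μ₀) := by
  have h1 := (iIndepFun_iff_map_fun_eq_pi_map hY).1 hind
  simp only [hlaw] at h1
  have hc : Continuous fun v : Fin n → ι → ℝ => F ((1 / √(n : ℝ)) • ∑ i, v i) := by fun_prop
  rw [← h1, integral_map (aemeasurable_pi_lambda _ hY) hc.aestronglyMeasurable]
  congr 1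
  ext ω
  congr 1
  ext j
  simp [normSum]

lemma integral_normSum_sq (hn : 1 ≤ n) (hY : ∀ i, AEMeasurable (Y i) P) (hind : iIndepFun Y P)
    (hlaw : ∀ i, P.map (Y i) = μ₀) (hm : HasMoment 2 μ₀) (hmean : ∀ j, ∫ y, y j ∂μ₀ = 0) (t : ι) :
    ∫ ω, normSum Y ω t ^ 2 ∂P = ∫ y, y t * y t ∂μ₀ := by
  have hn0 : (0 : ℝ) < n := by exact_mod_cast hn
  have htr : ∀ i (G : (ι → ℝ) → ℝ), Continuous G → ∫ ω, G (Y i ω) ∂P = ∫ y, G y ∂μ₀ := by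
    intro i G hG
    rw [← hlaw i, integral_map (hY i) hG.aestronglyMeasurable]
  have hYt : ∀ i, AEMeasurable (fun ω => Y i ω t) P := fun i =>
    (measurable_pi_apply t).comp_aemeasurable (hY i)
  have h2 : ∀ i, Integrable (fun ω => Y i ω t ^ 2) P := by
    intro i
    have := ((PolyGrowth.apply t).pow 2).integrable hm
    rw [← hlaw i] at this
    exact this.comp_aemeasurable (hY i)
  have hL : ∀ i, MemLp (fun ω => Y i ω t) 2 P := fun i =>
    (memLp_two_iff_integrable_sq (hYt i).aestronglyMeasurable).2 (h2 i)
  have hI : ∀ i, Integrable (fun ω => Y i ω t) P := fun i => (hL i).integrable (by norm_num)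
  have hvar := IndepFun.variance_sum (μ := P) (X := fun i ω => Y i ω t) (s := Finset.univ)
    (fun i _ => hL i) (fun i _ j _ hij =>
      (hind.indepFun hij).comp (measurable_pi_apply t) (measurable_pi_apply t))
  have h0 : ∀ i, ∫ ω, Y i ω t ∂P = 0 := fun i => by
    rw [htr i (fun y => y t) (continuous_apply t), hmean]
  rw [variance_of_integral_eq_zero (Finset.aemeasurable_sum _ fun i _ => hYt i)
    (by simp only [Finset.sum_apply]; rw [integral_finsetSum _ fun i _ => hI i]; simp [h0]),
    Finset.sum_congr rfl fun i _ => variance_of_integral_eq_zero (hYt i) (h0 i)] at hvar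
  simp only [Finset.sum_apply] at hvar
  have e : ∀ i, ∫ ω, Y i ω t ^ 2 ∂P = ∫ y, y t * y t ∂μ₀ := fun i => by
    rw [← htr i (fun y => y t * y t) (by fun_prop)]
    simp only [sq]
  simp only [e, Finset.sum_const, Finset.card_univ, Fintype.card_fin, nsmul_eq_mul] at hvar
  simp only [normSum, mul_pow]
  rw [integral_const_mul, hvar, div_pow, Real.sq_sqrt hn0.le]
  field_simp

end NormSum

/-! ### Assembly of the two estimates -/

lemma abs_le_supNorm {φ : ℝ → ℝ} (h : ∃ C, ∀ x, |φ x| ≤ C) (x : ℝ) : |φ x| ≤ supNorm φ := by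
  obtain ⟨C, hC⟩ := h
  exact le_ciSup (f := fun x => |φ x|) ⟨C, by rintro _ ⟨y, rfl⟩; exact hC y⟩ x

/-- The bound for independent copies `Y i` of a centred random vector with covariance `I`. -/
lemma abs_integral_quadForm_normSum_sub_le {Ω : Type*} [MeasurableSpace Ω] {P : Measure Ω}
    [IsProbabilityMeasure P] {n r q : ℕ} (hn : 1 ≤ n) (hr : 1 ≤ r)
    {Y : Fin n → Ω → (Fin r ⊕ Fin q) → ℝ} {I : Matrix (Fin r ⊕ Fin q) (Fin r ⊕ Fin q) ℝ}
    {μ₀ : Measure (Fin r ⊕ Fin q → ℝ)} [IsProbabilityMeasure μ₀]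
    (hY : ∀ i, AEMeasurable (Y i) P) (hind : iIndepFun Y P) (hlaw : ∀ i, P.map (Y i) = μ₀)
    (hm : HasMoment 5 μ₀) (hmean : ∀ j, ∫ y, y j ∂μ₀ = 0)
    (hcov : ∀ j k, ∫ y, y j * y k ∂μ₀ = I j k) (hI : I.PosDef)
    {U : Matrix (Fin r) (Fin r) ℝ} (hU : U.PosSemidef) (D : Matrix (Fin r) (Fin q) ℝ)
    {h : ℝ → ℝ} (hh : IsCb2 h) :
    |(∫ ω, h (quadForm U D (normSum Y ω)) ∂P)
        - ∫ z, h (quadForm U D (CFC.sqrt I *ᵥ z)) ∂(stdNormal (Fin r ⊕ Fin q))|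
      ≤ 2 * (supNorm (deriv h) + supNorm (deriv (deriv h))) / √(n : ℝ) * rBound P Y I U D := by
  have : Nonempty (Fin r ⊕ Fin q) := ⟨Sum.inl ⟨0, hr⟩⟩
  have hn0 : (0 : ℝ) < n := by exact_mod_cast hn
  obtain ⟨H₀, hb⟩ := hh.bounded
  have hb₁ := abs_le_supNorm hh.bounded_deriv
  have hb₂ := abs_le_supNorm hh.bounded_deriv2
  have hC := contDiff_succ_iff_deriv.1 (show ContDiff ℝ (1 + 1) h from hh.contDiff)
  have hC₁ := contDiff_one_iff_deriv.1 hC.2.2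
  have hQc : Continuous (quadForm U D) :=
    (funext (quadForm_eq U D) : quadForm U D = _) ▸ (polyGrowth_quadratic _).continuous
  have hpsd := posSemidef_quadMatrix hU D
  have hQ0 : ∀ y, 0 ≤ quadForm U D y := fun y => by
    rw [quadForm_eq]
    simpa using hpsd.dotProduct_mulVec_nonneg y
  have htr : 0 < I.trace := Finset.sum_pos (fun t _ => hI.diag_pos) Finset.univ_nonempty
  have key := abs_integral_quadratic_sub_le hI hpsd (hm.mono (by norm_num)) hmean hcov
    (quadForm_eq U D) (fun x => (hC.1 x).hasDerivAt) (fun x => (hC₁.1 x).hasDerivAt) hC₁.2 hb hb₁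
    hb₂ hn
  have hmom := moment_bound (quadForm_eq U D) hQ0 (abs_quadMatrix_le hU D) hm hcov
    (Real.sqrt_pos.2 htr) (Real.sq_sqrt htr.le).symm hn
  have hR := le_rBound hn hY hlaw hm hcov
    (fun t => (integral_normSum_sq hn hY hind hlaw (hm.mono (by norm_num)) hmean t).trans
      (hcov t t)) hI U D
  rw [integral_comp_normSum hY hind hlaw (F := fun w => h (quadForm U D w))
    (hC.1.continuous.comp hQc)]
  refine key.trans ?_
  have hd : ((Fintype.card (Fin r ⊕ Fin q) : ℕ) : ℝ) = (r : ℝ) + q := by simp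
  set K := supNorm (deriv h)
  set H := supNorm (deriv (deriv h))
  have hK : 0 ≤ K := (abs_nonneg _).trans (hb₁ 0)
  have hH : 0 ≤ H := (abs_nonneg _).trans (hb₂ 0)
  have hw0 : ∀ y, 0 ≤ momentWeight I n y := fun y =>
    add_nonneg htr.le (div_nonneg (sqSum_nonneg y) hn0.le)
  have hV₃0 : 0 ≤ ∫ y, absSum y ^ 3 * momentWeight I n y ∂μ₀ := integral_nonneg fun y =>
    mul_nonneg (pow_nonneg (absSum_nonneg y) 3) (hw0 y)
  have hV₁0 : 0 ≤ ∫ y, absSum y * momentWeight I n y ∂μ₀ :=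
    integral_nonneg fun y => mul_nonneg (absSum_nonneg y) (hw0 y)
  have hτ0 : 0 ≤ ∑ j, ∑ k, |I j k| :=
    Finset.sum_nonneg fun _ _ => Finset.sum_nonneg fun _ _ => abs_nonneg _
  refine (mul_le_mul_of_nonneg_right (mul_le_mul_of_nonneg_left hmom hH)
    (by positivity)).trans ?_
  refine le_trans ?_ (mul_le_mul_of_nonneg_left hR (by positivity))
  rw [hd]
  generalize (∫ y, absSum y ^ 3 * momentWeight I n y ∂μ₀) = V₃ at *
  generalize (∫ y, absSum y * momentWeight I n y ∂μ₀) = V₁ at *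
  generalize (∑ j, ∑ k, |I j k|) = τ at *
  have hs : 0 < √I.trace := Real.sqrt_pos.2 htr
  have hm0 : 0 < √(n : ℝ) := Real.sqrt_pos.2 hn0
  set E := cConst U D ^ 2 * ((r : ℝ) + q) / √(n : ℝ) / √I.trace with hE
  have hE0 : 0 ≤ E := by positivity
  -- With the factor 2 in the claim this makes 36 ≥ 26 and 4 · 36 = 144 ≥ 54 available; π / 4 is
  -- simply bounded by 1.
  have h3 : (18 : ℝ) ≤ 32 / √3 := by
    rw [le_div_iff₀ (by positivity)]
    have : √3 ≤ 16 / 9 := Real.sqrt_le_iff.2 (by norm_num)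
    linarith
  have hpi : Real.pi / 4 ≤ 1 := by linarith [Real.pi_le_four]
  have hτV : 0 ≤ τ * V₁ := mul_nonneg hτ0 hV₁0
  calc H * (cConst U D ^ 2 * ((r : ℝ) + q) / √(n : ℝ) * ((26 * V₃ + 54 * τ * V₁) / √I.trace))
        * (Real.pi / 4)
      = H * E * ((26 * V₃ + 54 * (τ * V₁)) * (Real.pi / 4)) := by rw [hE]; ring
    -- The estimate so far contains only the bound H on the second derivative; K is added because it
    -- is nonnegative.
    _ ≤ (K + H) * E * (2 * (32 / √3) * (V₃ + 4 * (τ * V₁))) := by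
        refine mul_le_mul (mul_le_mul_of_nonneg_right (by linarith) hE0) ?_ (by positivity)
          (by positivity)
        calc (26 * V₃ + 54 * (τ * V₁)) * (Real.pi / 4) ≤ (26 * V₃ + 54 * (τ * V₁)) * 1 :=
              mul_le_mul_of_nonneg_left hpi (by positivity)
          _ ≤ 2 * 18 * (V₃ + 4 * (τ * V₁)) := by linarith
          _ ≤ _ := mul_le_mul_of_nonneg_right (by linarith) (by positivity)
    _ = _ := by rw [hE]; ring

end Wilks

end

/-! ### Application to the score of a statistical model -/

theorem proposition3 {Ω 𝓧 : Type*} [MeasurableSpace Ω] [MeasurableSpace 𝓧]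
    (P : Measure Ω) [IsProbabilityMeasure P] (ν : Measure 𝓧) {n r q : ℕ}
    (hn : 1 ≤ n) (hr : 1 ≤ r)
    -- the statistical model, with parameter space `Θ ⊆ ℝ^(r+q)`
    (Θ : Set (Fin r ⊕ Fin q → ℝ)) (hΘ : IsOpen Θ)
    (f : 𝓧 → (Fin r ⊕ Fin q → ℝ) → ℝ) (hf : Wilks.IsDensityFamily ν Θ f)
    (θ₀ : Fin r ⊕ Fin q → ℝ) (hθ₀ : θ₀ ∈ Θ)
    -- the i.i.d. observations
    (X : Fin n → Ω → 𝓧) (hX : ∀ i, Measurable (X i)) (hindep : iIndepFun X P)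
    (hlaw : ∀ i, P.map (X i) = Wilks.obsLaw ν f θ₀)
    -- regularity at the true parameter: smoothness of the log-likelihood, centred score with
    -- finite fifth absolute moments, positive definite Fisher information
    (hdiff : ∀ᵐ x ∂(Wilks.obsLaw ν f θ₀), (∀ᶠ θ in nhds θ₀, 0 < f x θ) ∧
      DifferentiableAt ℝ (fun θ => Real.log (f x θ)) θ₀)
    (hmoment : ∀ j, MemLp (fun x => Wilks.score f θ₀ x j) 5 (Wilks.obsLaw ν f θ₀))
    (hmean : ∀ j, ∫ x, Wilks.score f θ₀ x j ∂(Wilks.obsLaw ν f θ₀) = 0)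
    (hfisher : (Wilks.fisherInfo ν f θ₀).PosDef)
    -- the quadratic form and the test function
    (U : Matrix (Fin r) (Fin r) ℝ) (hU : U.PosSemidef) (D : Matrix (Fin r) (Fin q) ℝ)
    (h : ℝ → ℝ) (hh : Wilks.IsCb2 h) :
    |(∫ ω, h (Wilks.quadForm U D
          (Wilks.normSum (fun i ω => Wilks.score f θ₀ (X i ω)) ω)) ∂P)
        - ∫ z, h (Wilks.quadForm U D (CFC.sqrt (Wilks.fisherInfo ν f θ₀) *ᵥ z))
            ∂(Wilks.stdNormal (Fin r ⊕ Fin q))|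
      ≤ 2 * (Wilks.supNorm (deriv h) + Wilks.supNorm (deriv (deriv h))) / √(n : ℝ)
        * Wilks.rBound P (fun i ω => Wilks.score f θ₀ (X i ω))
            (Wilks.fisherInfo ν f θ₀) U D := by
  -- Since n ≥ 1 there is an observation, and its law is the measure in question.
  have hprob : IsProbabilityMeasure (Wilks.obsLaw ν f θ₀) :=
    hlaw ⟨0, hn⟩ ▸ Measure.isProbabilityMeasure_map (hX _).aemeasurable
  -- Almost everywhere measurability of the score comes with its membership in L⁵, so no joint
  -- measurability of f in the parameter is involved.
  have hsc : AEMeasurable (Wilks.score f θ₀) (Wilks.obsLaw ν f θ₀) :=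
    aemeasurable_pi_lambda _ fun j => (hmoment j).aestronglyMeasurable.aemeasurable
  have hsc' : ∀ i, AEMeasurable (Wilks.score f θ₀) (P.map (X i)) := fun i => by rwa [hlaw i]
  have : IsProbabilityMeasure ((Wilks.obsLaw ν f θ₀).map (Wilks.score f θ₀)) :=
    Measure.isProbabilityMeasure_map hsc
  refine Wilks.abs_integral_quadForm_normSum_sub_le hn hr
    (μ₀ := (Wilks.obsLaw ν f θ₀).map (Wilks.score f θ₀))
    (fun i => (hsc' i).comp_measurable (hX i))
    (hindep.comp₀ (fun _ => Wilks.score f θ₀) (fun i => (hX i).aemeasurable) hsc')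
    (fun i => ?_) (Wilks.hasMoment_of_memLp ?_) (fun j => ?_) (fun j k => ?_) hfisher hU D hh
  · rw [← hlaw i]
    exact (AEMeasurable.map_map_of_aemeasurable (hsc' i) (hX i).aemeasurable).symm
  · refine (memLp_map_measure_iff aestronglyMeasurable_id hsc).2 (MemLp.of_eval fun j => ?_)
    exact_mod_cast hmoment j
  · rw [integral_map hsc (continuous_apply j).aestronglyMeasurable, hmean]
  · rw [integral_map hsc (Continuous.aestronglyMeasurable (by fun_prop))]
    rfl
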